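/- **Conventions.** A presentation $\alpha=\langle X\mid R\rangle$ of a group $G$ has a finite generating set $X$ with $n=|X|$ (different letters may name the same element of $G$). Its Cayley graph $\mathcal G$ has vertex set $G$ and, for each $g\in G$ and $x\in X$, one edge labelled $x$ from $g$ to $gx$. For a finite non-empty subgraph $\mathcal H$ let $\beta_0,\beta_1$ be the numbers of its vertices and edges and $\beta_2(\mathcal H)$ its cyclomatic number (number of components $-\beta_0+\beta_1$), and put $$\xi(\mathcal H)=\frac{\beta_2(\mathcal H)}{\beta_0(\mathcal H)},\qquad \psi(\mathcal H)=\frac{\beta_2(\mathcal H)}{\beta_0(\mathcal H)-1}\ \text{ if }\beta_0(\mathcal H)>1 .$$ Then $\Xi(G)=\sup_C\limsup_{i}\xi(\mathcal G_i)$, the supremum over all increasing chains $C=(\mathcal G_1\subseteq\mathcal G_2\subseteq\cdots)$ of finite connected subgraphs with union $\mathcal G$; $\hat\Xi(G)=1-n+\Xi(G)$; and $\Psi(G)=\sup\psi(\mathcal H)$ over all finite subgraphs with more than one vertex. For $Y\subseteq X$, $Gp(Y)$ is the subgroup of $G$ generated by $Y$, with the induced presentation on the generators $Y$. A presentation is *reduced*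 if no generator equals $1$ in $G$, and *minimal* if no proper subset of $X$ generates $G$; *$G$ is free on $X$* means that $X$ is a basis of $G$. Let $c(x)$ be the length of a shortest simple circuit of $\mathcal G$ with an edge labelled $x$ ($0$ if there is none), and $c(G)=\max_{x\in X}c(x)$. A group is amenable if there is an invariant mean on its bounded complex-valued functions. $C_2$ is the group of order $2$, and $1/|G|=0$ if $G$ is infinite. **Corollary 5.5.** Let $r\ge 2$, and for $1\le i\le r$ let $G_i$ be a non-trivial group with a reduced $n_i$-generated presentation $\langle X_i\mid R_i\rangle$, numbered so that $\Psi(G_1)\ge\Psi(G_2)\ge\cdots\ge\Psi(G_r)$. Let $G=G_1*\cdots*G_r$ have the induced presentation $\langle\bigsqcup X_i\mid\bigcup R_i\rangle$ with $n=\sum n_i$ generators. Then: (i) $\Psi(G_2)\le\Xi(G)\le\Psi(G_1)$. (ii) $\Xi(G)\ge\max_i\Xi(G_i)$. Moreover $\Xi(G)=\Xi(G_1)$ in each of the following cases: (a) $\Xi(G_1)=\Psi(G_1)$; (b) $Gp(X_1')$ is infinite for every non-empty $X_1'\subseteq X_1$, in particular if $G_1$ is torsion-free; (c) $\xi$ has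 no maximum on the finite non-empty subgraphs of the Cayley graph of $G_1$, and $(c(G_1)-1)\,\Psi(G_2)\le 1$; (d) the presentation of $G_1$ is minimal, and there is $Y_1\subseteq X_1$ such that $H_1=Gp(Y_1)$ is finite, $\Psi(G_1)=\Psi(H_1)>\Xi(G_1)$, $Z_1=X_1\setminus Y_1$ is non-empty, and $\Psi(Gp(Z_1))\ge\Psi(G_2)$. (iii) $\hat\Xi(G)\le 1-r+\sum_{i=1}^r\hat\Xi(G_i)$. Equality holds if and only if either $G_2$ is free on $X_2$, or for each $i\in\{1,2\}$ the group $G_i$ is the free product of a subgroup isomorphic to $C_2$ generated by some of the generators in $X_i$ and of a (possibly trivial) free group with basis the remaining generators in $X_i$, and $G_3$ (if $r\ge3$) is free on $X_3$. (iv) If $G_1$ is infinite amenable and its presentation is minimal, then $\hat\Xi(G)=n_1-n$. (v) If $G_1$ is finite and its presentation is minimal, then $$\Xi(G)=\Xi(G_1)+\frac{\Psi(G_2)}{|G_1|}=n_1-1+\frac{\Psi(G_2)+1}{|G_1|}.$$ If $G_1$ and $G_2$ are finite and both presentations are minimal, then $$\Xi(G)=n_1-1+\frac{n_2|G_2|}{|G_1|(|G_2|-1)}.$$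 (vi) If all the $G_i$ are (finite or infinite) cyclic and single-generated ($n_i=1$), then $$\hat\Xi(G)=1-r+\frac{1}{|G_1|\left(1-\frac1{|G_2|}\right)},$$ where the fraction is $0$ if $G_1$ is infinite. (vii) $\Psi(G)=\Psi(G_1)$. -/

import Mathlib

/-- A presentation `⟨X | R⟩` of the group `G`: generators `gen x`, `x : X`, which generate `G`, and
a set `rels` of words whose normal closure in the free group on `X` is the kernel of `F(X) → G`.
Distinct labels may name the same group element. -/
structure GroupPresentation (X : Type*) (G : Type*) [Group G] where
  gen : X → G
  rels : Set (FreeGroup X)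
  closure_gen : Subgroup.closure (Set.range gen) = ⊤
  ker_eq : (FreeGroup.lift gen).ker = Subgroup.normalClosure rels

namespace GroupPresentation

section Basic

variable {X G : Type*} [Group G] (P : GroupPresentation X G)

/-- No generator is the identity. -/
def IsReduced : Prop := ∀ x, P.gen x ≠ 1

/-- No proper subset of the generators generates `G`. -/
def IsMinimal : Prop :=
  ∀ Y : Set X, Subgroup.closure (P.gen '' Y) = ⊤ → Y = Set.univ

/-- `G` is free with basis the given generators. -/
def IsFree : Prop := Function.Bijective (FreeGroup.lift P.gen)

/-- The subgroup `Gp(Y)` generated by a set `Y` of generators. -/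
def Gp (Y : Set X) : Subgroup G := Subgroup.closure (P.gen '' Y)

/-- The induced presentation of `Gp(Y)`: the generators are those in `Y`, the relators are all the
words in them that are trivial in `G`. -/
def sub (Y : Set X) : GroupPresentation Y (P.Gp Y) where
  gen y := ⟨P.gen y, Subgroup.subset_closure ⟨y, y.2, rfl⟩⟩
  rels := (FreeGroup.lift fun y : Y =>
    (⟨P.gen y, Subgroup.subset_closure ⟨y, y.2, rfl⟩⟩ : P.Gp Y)).ker
  closure_gen := by
    have h := Subgroup.closure_closure_coe_preimage (k := P.gen '' Y)
    have hset : (Set.range fun y : Y =>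
        (⟨P.gen y, Subgroup.subset_closure ⟨y, y.2, rfl⟩⟩ : P.Gp Y)) =
        ((↑) : Subgroup.closure (P.gen '' Y) → G) ⁻¹' (P.gen '' Y) := by
      apply Set.ext
      rintro ⟨g, hg⟩
      constructor
      · rintro ⟨y, hy⟩
        exact ⟨y, y.2, congrArg Subtype.val hy⟩
      · rintro ⟨x, hx, hy⟩
        exact ⟨⟨x, hx⟩, Subtype.ext hy⟩
    rw [hset]
    exact h
  ker_eq := (Subgroup.normalClosure_eq_self _).symm

/-- A finite subgraph of the Cayley graph of the presentation. The vertices of the Cayley graph are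
the elements of `G`; for all `g` and `x` there is one edge `(g, x)`, labelled `x`, which joins `g`
to `g * gen x`. -/
structure FinSubgraph where
  verts : Finset G
  edges : Finset (G × X)
  source_mem : ∀ e ∈ edges, e.1 ∈ verts
  target_mem : ∀ e ∈ edges, e.1 * P.gen e.2 ∈ verts

end Basic

namespace FinSubgraph

variable {X G : Type*} [Group G] {P : GroupPresentation X G} (H : P.FinSubgraph)

/-- The adjacency relation of the subgraph (used for connectedness only). -/
def toSimpleGraph : SimpleGraph H.verts :=
  SimpleGraph.fromRel fun u v => ∃ x, ((u : G), x) ∈ H.edges ∧ (u : G) * P.gen x = v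

/-- Connected (and non-empty). -/
def IsConnected : Prop := H.toSimpleGraph.Connected

/-- The number `α` of connected components. -/
noncomputable def numComponents : ℕ := Nat.card H.toSimpleGraph.ConnectedComponent

/-- The number `β₀` of vertices. -/
def beta0 : ℕ := H.verts.card

/-- The number `β₁` of edges. -/
def beta1 : ℕ := H.edges.card

/-- The cyclomatic number `β₂ = α - β₀ + β₁`, that is, the sum of the ranks of the fundamental
groups of the components. -/
noncomputable def beta2 : ℤ := (H.numComponents : ℤ) - H.beta0 + H.beta1

/-- `ξ = β₂ / β₀`. -/
noncomputable def xi : ℝ := (H.beta2 : ℝ) / (H.beta0 : ℝ)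

/-- `ψ = β₂ / (β₀ - 1)`. -/
noncomputable def psi : ℝ := (H.beta2 : ℝ) / ((H.beta0 : ℝ) - 1)

end FinSubgraph

section Quotients

variable {X G : Type*} [Group G] (P : GroupPresentation X G)

/-- An exhausting chain: an increasing sequence of finite connected subgraphs whose union is the
whole Cayley graph. -/
def IsExhaustingChain (C : ℕ → P.FinSubgraph) : Prop :=
  (∀ i, (C i).IsConnected) ∧
  (∀ i, (C i).verts ⊆ (C (i + 1)).verts ∧ (C i).edges ⊆ (C (i + 1)).edges) ∧
  (∀ g, ∃ i, g ∈ (C i).verts) ∧ ∀ e, ∃ i, e ∈ (C i).edges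

/-- The cyclomatic quotient `Ξ`. -/
noncomputable def Xi : ℝ :=
  sSup {η : ℝ | ∃ C : ℕ → P.FinSubgraph, P.IsExhaustingChain C ∧
    η = Filter.limsup (fun i => (C i).xi) Filter.atTop}

/-- The normalized cyclomatic quotient `Ξ̂ = 1 - n + Ξ`, with `n` the number of generators. -/
noncomputable def hatXi [Fintype X] : ℝ := 1 - (Fintype.card X : ℝ) + P.Xi

/-- `Ψ`, the supremum of `ψ` over the finite subgraphs with more than one vertex. -/
noncomputable def Psi : ℝ :=
  sSup {t : ℝ | ∃ H : P.FinSubgraph, 1 < H.beta0 ∧ t = H.psi}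

/-- `ξ` has a maximum on the finite non-empty subgraphs of the Cayley graph. -/
def XiHasMax : Prop :=
  ∃ H : P.FinSubgraph, H.verts.Nonempty ∧
    ∀ K : P.FinSubgraph, K.verts.Nonempty → K.xi ≤ H.xi

/-- The element of `G` represented by a word; the letter `(x, true)` is `x` and `(x, false)` is
its inverse. -/
def eval (w : List (X × Bool)) : G := FreeGroup.lift P.gen (FreeGroup.mk w)

/-- The word `w` is the label of a simple circuit of the Cayley graph: it is non-empty, reduced and
trivial in `G`, and the path that it labels visits no vertex twice, except that it closes up. -/
def IsSimpleCircuit (w : List (X × Bool)) : Prop :=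
  w ≠ [] ∧ FreeGroup.IsReduced w ∧ P.eval w = 1 ∧
  ∀ i j, i < j → j < w.length → P.eval (w.take i) ≠ P.eval (w.take j)

/-- `c(x)`: the length of a shortest simple circuit with an edge labelled `x`, and `0` if there is
none. -/
noncomputable def circuitLength (x : X) : ℕ :=
  sInf {m : ℕ | ∃ w, P.IsSimpleCircuit w ∧ (∃ b, (x, b) ∈ w) ∧ m = w.length}

/-- `c(α) = max_x c(x)`. -/
noncomputable def maxCircuitLength [Fintype X] : ℕ := Finset.univ.sup P.circuitLength

/-- `G` is the free product of a subgroup of order two, generated by some of the generators, and of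
a free group (possibly trivial) with basis the remaining generators. -/
def IsOrderTwoFreeProdFree : Prop :=
  ∃ Y : Set X, Nat.card (P.Gp Y) = 2 ∧
    Function.Bijective (Monoid.Coprod.lift (P.Gp Y).subtype
      (FreeGroup.lift fun z : (Yᶜ : Set X) => P.gen z))

end Quotients

/-- The kernel of the free group on the disjoint union of generators mapping to the free product
is the normal closure of the union of relators. -/
theorem ker_freeProd {ι : Type*} {X G : ι → Type*} [∀ i, Group (G i)]
    (P : ∀ i, GroupPresentation (X i) (G i)) :
    (FreeGroup.lift fun s : (Σ i, X i) =>
      (Monoid.CoprodI.of ((P s.1).gen s.2) : Monoid.CoprodI G)).ker =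
    Subgroup.normalClosure (⋃ i, FreeGroup.map (Sigma.mk i) '' (P i).rels) := by
  set N := Subgroup.normalClosure (⋃ i, FreeGroup.map (Sigma.mk i) '' (P i).rels) with hN
  set φ := FreeGroup.lift fun s : (Σ i, X i) =>
      (Monoid.CoprodI.of ((P s.1).gen s.2) : Monoid.CoprodI G) with hφ
  have hcomp : ∀ i, φ.comp (FreeGroup.map (Sigma.mk i)) =
      Monoid.CoprodI.of.comp (FreeGroup.lift (P i).gen) := by
    intro i
    ext x
    simp [hφ]
  apply le_antisymm
  · have hsurj : ∀ i, Function.Surjective (FreeGroup.lift (P i).gen) := by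
      intro i
      rw [← MonoidHom.range_eq_top, FreeGroup.range_lift_eq_closure, (P i).closure_gen]
    let f : ∀ i, FreeGroup (X i) →* FreeGroup (Σ i, X i) ⧸ N := fun i =>
      (QuotientGroup.mk' N).comp (FreeGroup.map (Sigma.mk i))
    have hf : ∀ i, (FreeGroup.lift (P i).gen).ker ≤ (f i).ker := by
      intro i
      rw [(P i).ker_eq]
      apply Subgroup.normalClosure_le_normal
      intro w hw
      have : FreeGroup.map (Sigma.mk i) w ∈ N :=
        Subgroup.subset_normalClosure (Set.mem_iUnion.2 ⟨i, w, hw, rfl⟩)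
      simpa [f, MonoidHom.mem_ker] using this
    let g : ∀ i, G i →* FreeGroup (Σ i, X i) ⧸ N := fun i =>
      (FreeGroup.lift (P i).gen).liftOfSurjective (hsurj i) ⟨f i, hf i⟩
    have hg : ∀ i w, g i (FreeGroup.lift (P i).gen w) = f i w := by
      intro i w
      exact MonoidHom.liftOfRightInverse_comp_apply _ _ _ ⟨f i, hf i⟩ w
    have key : (Monoid.CoprodI.lift g).comp φ = QuotientGroup.mk' N := by
      ext ⟨i, x⟩
      have := hg i (FreeGroup.of x)
      simp only [FreeGroup.lift_apply_of] at this
      simp [hφ, this, f]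
    intro w hw
    have h1 : QuotientGroup.mk' N w = 1 := by
      rw [← key, MonoidHom.comp_apply, MonoidHom.mem_ker.1 hw, map_one]
    simpa using h1
  · apply Subgroup.normalClosure_le_normal
    intro w hw
    obtain ⟨i, v, hv, rfl⟩ := Set.mem_iUnion.1 hw
    have hv' : v ∈ (FreeGroup.lift (P i).gen).ker := by
      rw [(P i).ker_eq]
      exact Subgroup.subset_normalClosure hv
    have := DFunLike.congr_fun (hcomp i) v
    simp only [MonoidHom.comp_apply] at this
    rw [SetLike.mem_coe, MonoidHom.mem_ker, this, MonoidHom.mem_ker.1 hv', map_one]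

/-- The induced presentation of the free product of the groups `G i`: the generators are the
disjoint union of the generators, the relators the union of the relators. -/
def freeProd {ι : Type*} {X G : ι → Type*} [∀ i, Group (G i)]
    (P : ∀ i, GroupPresentation (X i) (G i)) :
    GroupPresentation (Σ i, X i) (Monoid.CoprodI G) where
  gen s := Monoid.CoprodI.of ((P s.1).gen s.2)
  rels := ⋃ i, FreeGroup.map (Sigma.mk i) '' (P i).rels
  closure_gen := by
    rw [eq_top_iff]
    intro g _
    induction g using Monoid.CoprodI.induction_on with
    | one => exact one_mem _
    | of i m =>
      have hm : m ∈ Subgroup.closure (Set.range (P i).gen) := by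
        rw [(P i).closure_gen]; trivial
      have hle : Subgroup.closure (Set.range (P i).gen) ≤
          (Subgroup.closure (Set.range fun s : (Σ i, X i) =>
            (Monoid.CoprodI.of ((P s.1).gen s.2) : Monoid.CoprodI G))).comap
              Monoid.CoprodI.of := by
        rw [Subgroup.closure_le]
        rintro _ ⟨x, rfl⟩
        exact Subgroup.subset_closure ⟨⟨i, x⟩, rfl⟩
      exact hle hm
    | mul a b ha hb => exact mul_mem (ha trivial) (hb trivial)
  ker_eq := ker_freeProd P

end GroupPresentation

open scoped ENNReal in
/-- `G` is amenable: there is an invariant mean on the space `B(G)` of bounded complex-valued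
functions on `G` with the supremum norm, that is, a linear functional `m` with `‖m‖ = m(1) = 1`
which is invariant under translations. -/
def IsAmenableGroup (G : Type*) [Group G] : Prop :=
  ∃ m : lp (fun _ : G => ℂ) ∞ →L[ℂ] ℂ, ‖m‖ = 1 ∧ m 1 = 1 ∧
    ∀ (g : G) (f f' : lp (fun _ : G => ℂ) ∞), (∀ h, f' h = f (g * h)) → m f' = m f

/-! For a finite vertex set `T` let e(T) be the number of edges with both ends in `T` (`edgeCount`).
Summing over components reduces arbitrary subgraphs to such sets. Thus `Ξ + 1` turns out to be the
least `s` with e(T) + 1 ≤ s #T for all non-empty `T`, and `Ψ + 1` is governed in the same way by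
e(T) ≤ s (#T - 1). That the supremum over exhausting chains is one over all finite sets
(`edgeCount_add_one_le_Xi`) holds because near-optimal sets can be taken connected and either large,
hence cheap to glue onto a given set, or equal to the whole group.

The function e is supermodular and invariant under left translation. Hence, if a bound e(T) + k ≤ s
#T is attained, two attaining sets that meet have an attaining union; if attaining sets have bounded
size, a largest one through 1 is a finite subgroup (`exists_subgroup_of_attained`). In particular Ψ
> Ξ happens only because of a finite subgroup. For minimal presentations a subgroup has fewer
generators than elements, which leaves explicit arithmetic (`subgroup_value_le`).

In a free product the cosets of the factors form a tree of blocks (`isForestFamily_range_of`).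
Adding the bounds of the blocks gives `Ψ(G) = Ψ(G₁)` and an upper bound for `Ξ(G)`; trees of
translated combs, a near-optimal set of one factor with copies of a set of another attached, give
the matching lower bound. Together (`Xi_freeProd_le`, `edgeCount_add_Psi_le_Xi_freeProd`) `Ξ(G) + 1
= sup_T (e(T) + 1 + Ψ(G₂)) / #T`, with `T` running over the non-empty finite subsets of `G₁`.

The remaining claims evaluate this supremum. It equals `Ξ(G₁) + 1` once 1 + Ψ(G₂) can be
accommodated in the inequality that defines `Ξ(G₁)`: in (c) by adding translates along short
circuits, in (d) by an extremal argument with the complementary generators. Amenability enters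
through Hall's theorem and expansion. Part (iii) rests on `Ψ ≤ 2Ξ`, where equality with Ψ > 0 needs
a subgroup of order two; edge counts that make the remaining edges a forest of cosets then yield the
free product structure, because reduced walks in a forest do not return. -/

namespace CayleyGraph

open Finset Pointwise GroupPresentation
open scoped Classical

/-! ### Connected finite vertex sets -/

section Connectedness

variable {X G : Type*} [Group G] {γ : X → G}

/-- There is an edge between `g` and `h`. -/
def Linked (γ : X → G) (g h : G) : Prop := ∃ x, h = g * γ x ∨ g = h * γ x

theorem Linked.symm {g h : G} (H : Linked γ g h) : Linked γ h g := by
  obtain ⟨x, hx⟩ := H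
  exact ⟨x, hx.symm⟩

theorem Linked.smul {g h : G} (a : G) (H : Linked γ g h) : Linked γ (a * g) (a * h) := by
  obtain ⟨x, rfl | rfl⟩ := H
  · exact ⟨x, Or.inl (by rw [mul_assoc])⟩
  · exact ⟨x, Or.inr (by rw [mul_assoc])⟩

/-- Connectedness of the subgraph induced on a non-empty finite set of vertices. -/
def Conn (γ : X → G) (S : Finset G) : Prop :=
  S.Nonempty ∧ ∀ A ⊆ S, A.Nonempty → A ≠ S → ∃ a ∈ A, ∃ b ∈ S, b ∉ A ∧ Linked γ a b

theorem Conn.singleton (g : G) : Conn γ {g} := by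
  refine ⟨singleton_nonempty g, fun A hA hne hne' => ?_⟩
  rcases subset_singleton_iff.1 hA with h | h
  · exact (hne.ne_empty h).elim
  · exact (hne' h).elim

/-- A subset that no edge leaves swallows each connected piece it touches, and it passes from one
piece to the other through the common vertex. -/
theorem Conn.union {S T : Finset G} (hS : Conn γ S) (hT : Conn γ T)
    (h : (S ∩ T).Nonempty) : Conn γ (S ∪ T) := by
  refine ⟨hS.1.mono subset_union_left, fun A hA hne hne' => ?_⟩
  by_contra hcon
  push Not at hcon
  have aux : ∀ U : Finset G, Conn γ U → U ⊆ S ∪ T → (A ∩ U).Nonempty → U ⊆ A := by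
    intro U hU hUS hAU
    by_contra hUA
    obtain ⟨a, ha, b, hb, hbA, hl⟩ := hU.2 (A ∩ U) inter_subset_right hAU
      (fun h => hUA (h ▸ inter_subset_left))
    rw [mem_inter] at ha hbA
    exact hcon a ha.1 b (hUS hb) (fun h => hbA ⟨h, hb⟩) hl
  obtain ⟨p, hp⟩ := h
  rw [mem_inter] at hp
  obtain ⟨a, ha⟩ := hne
  have hpA : p ∈ A := by
    rcases mem_union.1 (hA ha) with h | h
    · exact aux S hS subset_union_left ⟨a, mem_inter.2 ⟨ha, h⟩⟩ hp.1
    · exact aux T hT subset_union_right ⟨a, mem_inter.2 ⟨ha, h⟩⟩ hp.2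
  exact hne' (subset_antisymm hA (union_subset
    (aux S hS subset_union_left ⟨p, mem_inter.2 ⟨hpA, hp.1⟩⟩)
    (aux T hT subset_union_right ⟨p, mem_inter.2 ⟨hpA, hp.2⟩⟩)))

theorem Conn.pair {g h : G} (hl : Linked γ g h) : Conn γ {g, h} := by
  refine ⟨⟨g, by simp⟩, fun A hA hne hne' => ?_⟩
  by_cases hg : g ∈ A
  · refine ⟨g, hg, h, by simp, fun hh => hne' (subset_antisymm hA ?_), hl⟩
    intro x hx
    rcases mem_insert.1 hx with rfl | hx
    · exact hg
    · rw [mem_singleton.1 hx]; exact hh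
  · obtain ⟨a, ha⟩ := hne
    have : a = h := by
      rcases mem_insert.1 (hA ha) with rfl | hx
      · exact (hg ha).elim
      · exact mem_singleton.1 hx
    subst this
    exact ⟨a, ha, g, by simp, hg, hl.symm⟩

theorem Conn.smul {S : Finset G} (hS : Conn γ S) (g : G) : Conn γ (g • S) := by
  refine ⟨hS.1.smul_finset, fun A hA hne hne' => ?_⟩
  obtain ⟨a, ha, b, hb, hbA, hl⟩ := hS.2 (g⁻¹ • A)
    (by rw [← subset_smul_finset_iff] ; exact hA) hne.smul_finset
    (fun h => hne' (by rw [← h, smul_inv_smul]))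
  refine ⟨g * a, ?_, g * b, smul_mem_smul_finset hb, ?_, hl.smul g⟩
  · have := smul_mem_smul_finset (a := g) ha
    rwa [smul_inv_smul] at this
  · intro h
    apply hbA
    have := smul_mem_smul_finset (a := g⁻¹) h
    simpa using this

theorem exists_conn_of_mem_closure {g : G} (hg : g ∈ Subgroup.closure (Set.range γ)) :
    ∃ S, Conn γ S ∧ 1 ∈ S ∧ g ∈ S := by
  induction hg using Subgroup.closure_induction_right with
  | one => exact ⟨{1}, Conn.singleton 1, by simp, by simp⟩
  | mul_right a ha b hb ih =>
    obtain ⟨S, hS, h1, h2⟩ := ih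
    obtain ⟨x, rfl⟩ := hb
    exact ⟨S ∪ {a, a * γ x}, hS.union (Conn.pair ⟨x, Or.inl rfl⟩) ⟨a, by simp [h2]⟩, by simp [h1],
      by simp⟩
  | mul_inv_cancel a ha b hb ih =>
    obtain ⟨S, hS, h1, h2⟩ := ih
    obtain ⟨x, rfl⟩ := hb
    exact ⟨S ∪ {a, a * (γ x)⁻¹}, hS.union (Conn.pair ⟨x, Or.inr (by simp)⟩) ⟨a, by simp [h2]⟩,
      by simp [h1], by simp⟩

/-- A finite set of vertices of a connected Cayley graph lies in a connected one. -/
theorem exists_conn_superset (hγ : Subgroup.closure (Set.range γ) = ⊤) (T : Finset G) :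
    ∃ S, Conn γ S ∧ 1 ∈ S ∧ T ⊆ S := by
  induction T using Finset.induction_on with
  | empty => exact ⟨{1}, Conn.singleton 1, by simp, by simp⟩
  | insert a T _ ih =>
    obtain ⟨S, hS, h1, h2⟩ := ih
    obtain ⟨S', hS', h1', h2'⟩ := exists_conn_of_mem_closure (γ := γ) (g := a) (by rw [hγ]; trivial)
    refine ⟨S ∪ S', hS.union hS' ⟨1, by simp [h1, h1']⟩, by simp [h1], ?_⟩
    intro x hx
    rcases mem_insert.1 hx with rfl | hx
    · simp [h2']
    · simp [h2 hx]

/-- A set of vertices which no edge leaves is closed under the group generated by the labels. -/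
theorem mul_mem_of_closed {T : Finset G} {s : Set X} (h : ∀ g ∈ T, ∀ x ∈ s, g * γ x ∈ T)
    {g c : G} (hg : g ∈ T) (hc : c ∈ Subgroup.closure (γ '' s)) : g * c ∈ T := by
  have h' : ∀ g ∈ T, ∀ x ∈ s, g * (γ x)⁻¹ ∈ T := by
    intro g hg x hx
    -- Right multiplication by `γ x` injects the finite set `T` into itself, so it is onto and
    -- inverse generators preserve `T` too.
    have himg : T.image (· * γ x) = T := by
      refine eq_of_subset_of_card_le ?_ (card_image_of_injective _ (mul_left_injective _)).ge
      intro y hy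
      obtain ⟨z, hz, rfl⟩ := mem_image.1 hy
      exact h z hz x hx
    rw [← himg] at hg
    obtain ⟨z, hz, rfl⟩ := mem_image.1 hg
    simpa using hz
  induction hc using Subgroup.closure_induction_right with
  | one => simpa using hg
  | mul_right a ha b hb ih =>
    obtain ⟨x, hx, rfl⟩ := hb
    rw [← mul_assoc]
    exact h _ ih x hx
  | mul_inv_cancel a ha b hb ih =>
    obtain ⟨x, hx, rfl⟩ := hb
    rw [← mul_assoc]
    exact h' _ ih x hx

/-- A finite set which no edge leaves is everything. -/
theorem eq_univ_of_closed (hγ : Subgroup.closure (Set.range γ) = ⊤) {T : Finset G}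
    (hne : T.Nonempty) (h : ∀ g ∈ T, ∀ x, g * γ x ∈ T) (g : G) : g ∈ T := by
  obtain ⟨t, ht⟩ := hne
  have := mul_mem_of_closed (γ := γ) (s := Set.univ) (fun g hg x _ => h g hg x) ht
    (c := t⁻¹ * g) (by rw [Set.image_univ, hγ]; trivial)
  simpa using this

end Connectedness

/-! ### Counting edges: supermodularity and translation invariance -/

section EdgeCount

variable {X G : Type*} [Group G] [Fintype X] {γ : X → G}

/-- The edges `(g, x)`, from `g` to `g * γ x`, with both ends in `T`. -/
noncomputable def edgeSet (γ : X → G) (T : Finset G) : Finset (G × X) :=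
  {e ∈ T ×ˢ univ | e.1 * γ e.2 ∈ T}

/-- The number of edges with both ends in `T`. -/
noncomputable def edgeCount (γ : X → G) (T : Finset G) : ℕ := (edgeSet γ T).card

theorem mem_edgeSet {T : Finset G} {e : G × X} :
    e ∈ edgeSet γ T ↔ e.1 ∈ T ∧ e.1 * γ e.2 ∈ T := by
  simp [edgeSet]

theorem edgeSet_mono {S T : Finset G} (h : S ⊆ T) : edgeSet γ S ⊆ edgeSet γ T := by
  intro e he
  rw [mem_edgeSet] at he ⊢
  exact ⟨h he.1, h he.2⟩

theorem edgeCount_mono {S T : Finset G} (h : S ⊆ T) : edgeCount γ S ≤ edgeCount γ T :=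
  card_le_card (edgeSet_mono h)

theorem edgeCount_eq_sum (T : Finset G) :
    edgeCount γ T = ∑ x, #{g ∈ T | g * γ x ∈ T} := by
  rw [edgeCount, card_eq_sum_card_fiberwise (f := Prod.snd) (t := univ) (by simp)]
  refine sum_congr rfl fun x _ => ?_
  refine card_bij (fun e _ => e.1) ?_ ?_ ?_
  · rintro ⟨g, y⟩ h
    simp only [mem_filter, mem_edgeSet] at h ⊢
    obtain ⟨h, rfl⟩ := h
    exact h
  · rintro ⟨g, y⟩ h ⟨g', y'⟩ h' hg
    simp only [mem_filter] at h h'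
    exact Prod.ext hg (h.2.trans h'.2.symm)
  · intro g hg
    exact ⟨(g, x), by simpa [mem_edgeSet] using hg, rfl⟩

/-- The edges of `A ∩ B` are those common to `A` and `B`, so inclusion-exclusion accounts for
everything except the edges between `A \ B` and `B \ A`. The set `D` credits some of these
explicitly. -/
theorem edgeCount_add_le_of_crossing (A B : Finset G) (D : Finset (G × X))
    (hD : ∀ e ∈ D, e ∈ edgeSet γ (A ∪ B) ∧ e ∉ edgeSet γ A ∧ e ∉ edgeSet γ B) :
    edgeCount γ A + edgeCount γ B + #D ≤ edgeCount γ (A ∪ B) + edgeCount γ (A ∩ B) := by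
  have hint : edgeSet γ (A ∩ B) = edgeSet γ A ∩ edgeSet γ B := by
    ext e
    simp only [mem_edgeSet, mem_inter]
    tauto
  have hdisj : Disjoint (edgeSet γ A ∪ edgeSet γ B) D := by
    rw [disjoint_left]
    intro e he heD
    have := hD e heD
    rw [mem_union] at he
    tauto
  have hsub : edgeSet γ A ∪ edgeSet γ B ∪ D ⊆ edgeSet γ (A ∪ B) := by
    refine union_subset (union_subset (edgeSet_mono subset_union_left)
      (edgeSet_mono subset_union_right)) fun e he => (hD e he).1
  have h1 := card_le_card hsub
  rw [card_union_of_disjoint hdisj] at h1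
  have h2 := card_union_add_card_inter (edgeSet γ A) (edgeSet γ B)
  unfold edgeCount
  rw [hint]
  omega

theorem edgeCount_supermodular (A B : Finset G) :
    edgeCount γ A + edgeCount γ B ≤ edgeCount γ (A ∪ B) + edgeCount γ (A ∩ B) := by
  simpa using edgeCount_add_le_of_crossing (γ := γ) A B ∅ (by simp)

theorem edgeCount_empty : edgeCount γ ∅ = 0 := by
  simp [edgeCount, edgeSet]

theorem edgeCount_singleton (hγ : ∀ x, γ x ≠ 1) (g : G) : edgeCount γ {g} = 0 := by
  rw [edgeCount, card_eq_zero, eq_empty_iff_forall_notMem]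
  rintro ⟨h, x⟩ he
  rw [mem_edgeSet] at he
  simp only [mem_singleton] at he
  obtain ⟨rfl, h2⟩ := he
  exact hγ x (by simpa using h2)

theorem edgeCount_smul [DecidableEq G] (g : G) (T : Finset G) :
    edgeCount γ (g • T) = edgeCount γ T := by
  symm
  refine card_bij (fun e _ => (g * e.1, e.2)) ?_ ?_ ?_
  · intro e he
    simp only [mem_edgeSet] at he ⊢
    refine ⟨smul_mem_smul_finset he.1, ?_⟩
    rw [mul_assoc]
    exact smul_mem_smul_finset he.2
  · rintro ⟨a, x⟩ _ ⟨b, y⟩ _ h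
    simpa using h
  · rintro ⟨a, x⟩ h
    rw [mem_edgeSet] at h
    refine ⟨(g⁻¹ * a, x), ?_, by simp⟩
    rw [mem_edgeSet]
    simpa [← inv_smul_mem_iff, mul_assoc] using h

theorem edgeCount_le (T : Finset G) : edgeCount γ T ≤ Fintype.card X * #T := by
  refine (card_filter_le _ _).trans ?_
  rw [card_product, card_univ, mul_comm]

/-- If some generator moves a vertex out of `T`, then `T` misses an edge. -/
theorem edgeCount_add_one_le {T : Finset G} {g : G} {x : X} (hg : g ∈ T) (hx : g * γ x ∉ T) :
    edgeCount γ T + 1 ≤ Fintype.card X * #T := by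
  have hlt : edgeCount γ T < #(T ×ˢ (univ : Finset X)) := by
    refine card_lt_card ?_
    refine ⟨filter_subset _ _, fun h => ?_⟩
    have := h (show (g, x) ∈ T ×ˢ (univ : Finset X) by simp [hg])
    exact hx (mem_edgeSet.1 this).2
  rw [card_product, card_univ, mul_comm] at hlt
  exact hlt

theorem edgeCount_subgroup (H : Subgroup G) (T : Finset G) (hT : (T : Set G) = H) :
    edgeCount γ T = #{x | γ x ∈ H} * #T := by
  have hmem : ∀ g, g ∈ T ↔ g ∈ H := fun g => by rw [← mem_coe, hT, SetLike.mem_coe]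
  have : edgeSet γ T = T ×ˢ ({x | γ x ∈ H} : Finset X) := by
    ext ⟨g, x⟩
    simp only [mem_edgeSet, mem_product, mem_filter, mem_univ, true_and, hmem]
    constructor
    · rintro ⟨h1, h2⟩
      exact ⟨h1, (H.mul_mem_cancel_left h1).1 h2⟩
    · rintro ⟨h1, h2⟩
      exact ⟨h1, H.mul_mem h1 h2⟩
  rw [edgeCount, this, card_product, mul_comm]

/-- Two sets which meet in one vertex. -/
theorem edgeCount_union_of_inter_singleton [d : DecidableEq G] (hγ : ∀ x, γ x ≠ 1)
    {A B : Finset G} {g : G} (h : A ∩ B = {g}) :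
    edgeCount γ A + edgeCount γ B ≤ edgeCount γ (A ∪ B) := by
  obtain rfl : d = fun a b => Classical.propDecidable (a = b) := Subsingleton.elim _ _
  have := edgeCount_supermodular (γ := γ) A B
  rwa [h, edgeCount_singleton hγ, add_zero] at this

theorem edgeCount_union_of_linked {A B : Finset G} (hAB : Disjoint A B) {a b : G} (ha : a ∈ A)
    (hb : b ∈ B) (hl : Linked γ a b) :
    edgeCount γ A + edgeCount γ B + 1 ≤ edgeCount γ (A ∪ B) := by
  have key : ∀ e : G × X, e ∈ edgeSet γ (A ∪ B) ∧ e ∉ edgeSet γ A ∧ e ∉ edgeSet γ B →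
      edgeCount γ A + edgeCount γ B + 1 ≤ edgeCount γ (A ∪ B) := by
    intro e he
    have := edgeCount_add_le_of_crossing (γ := γ) A B {e} (by simpa using he)
    rwa [disjoint_iff_inter_eq_empty.1 hAB, edgeCount_empty, card_singleton, add_zero] at this
  have ha' : a ∉ B := disjoint_left.1 hAB ha
  have hb' : b ∉ A := disjoint_right.1 hAB hb
  obtain ⟨x, rfl | rfl⟩ := hl
  · exact key (a, x) (by simp [mem_edgeSet, ha, hb, ha', hb'])
  · exact key (b, x) (by simp [mem_edgeSet, ha, hb, ha', hb'])

theorem edgeCount_union_of_not_linked {A B : Finset G} (hAB : Disjoint A B)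
    (hl : ∀ a ∈ A, ∀ b ∈ B, ¬ Linked γ a b) :
    edgeCount γ (A ∪ B) = edgeCount γ A + edgeCount γ B := by
  refine le_antisymm ?_ ?_
  · have : edgeSet γ (A ∪ B) ⊆ edgeSet γ A ∪ edgeSet γ B := by
      rintro ⟨g, x⟩ h
      simp only [mem_union, mem_edgeSet] at h ⊢
      obtain ⟨h1 | h1, h2 | h2⟩ := h
      · exact Or.inl ⟨h1, h2⟩
      · exact (hl _ h1 _ h2 ⟨x, Or.inl rfl⟩).elim
      · exact (hl _ h2 _ h1 ⟨x, Or.inr rfl⟩).elim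
      · exact Or.inr ⟨h1, h2⟩
    exact (card_le_card this).trans (card_union_le _ _)
  · have := edgeCount_supermodular (γ := γ) A B
    rwa [disjoint_iff_inter_eq_empty.1 hAB, edgeCount_empty, add_zero] at this

/-- A disconnected set splits into two non-empty parts without edges between them. -/
theorem exists_split_of_not_conn {S : Finset G} (hne : S.Nonempty) (hS : ¬ Conn γ S) :
    ∃ A B : Finset G, A.Nonempty ∧ B.Nonempty ∧ Disjoint A B ∧ A ∪ B = S ∧
      edgeCount γ S = edgeCount γ A + edgeCount γ B := by
  have : ∃ A ⊆ S, A.Nonempty ∧ A ≠ S ∧ ∀ a ∈ A, ∀ b ∈ S, b ∉ A → ¬ Linked γ a b := by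
    by_contra h
    push Not at h
    exact hS ⟨hne, h⟩
  obtain ⟨A, hA, hAne, hAS, hl⟩ := this
  have hu : A ∪ S \ A = S := union_sdiff_of_subset hA
  refine ⟨A, S \ A, hAne, sdiff_nonempty.2 fun h => hAS (subset_antisymm hA h),
    disjoint_sdiff, hu, ?_⟩
  conv_lhs => rw [← hu]
  refine edgeCount_union_of_not_linked disjoint_sdiff fun a ha b hb => ?_
  rw [mem_sdiff] at hb
  exact hl a ha b hb.1 hb.2

end EdgeCount

/-! ### Components of a subgraph -/

section Components

variable {X G : Type*} [Group G] {P : GroupPresentation X G}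

instance (K : P.FinSubgraph) : Finite K.toSimpleGraph.ConnectedComponent :=
  Finite.of_surjective _ Quot.mk_surjective

theorem one_le_numComponents {K : P.FinSubgraph} (h : K.verts.Nonempty) :
    1 ≤ K.numComponents := by
  obtain ⟨v, hv⟩ := h
  have : Nonempty K.toSimpleGraph.ConnectedComponent :=
    ⟨K.toSimpleGraph.connectedComponentMk ⟨v, hv⟩⟩
  exact Nat.card_pos
end Components

/-! ### From subgraphs to vertex sets -/

section Subgraphs

variable {X G : Type*} [Group G] [Fintype X] (P : GroupPresentation X G)

/-- The subgraph induced on a finite set of vertices. -/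
noncomputable def induced (T : Finset G) : P.FinSubgraph where
  verts := T
  edges := edgeSet P.gen T
  source_mem _ he := (mem_edgeSet.1 he).1
  target_mem _ he := (mem_edgeSet.1 he).2

variable {P}

theorem Conn.induced_isConnected {T : Finset G} (hT : Conn P.gen T) :
    (induced P T).IsConnected := by
  obtain ⟨v, hv⟩ := hT.1
  have key : ∀ w : T, (induced P T).toSimpleGraph.Reachable ⟨v, hv⟩ w := by
    set A : Finset G := T.filter fun g =>
      ∃ h : g ∈ T, (induced P T).toSimpleGraph.Reachable ⟨v, hv⟩ ⟨g, h⟩ with hA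
    have hAT : A = T := by
      by_contra hne
      obtain ⟨a, ha, b, hb, hbA, hl⟩ := hT.2 A (filter_subset _ _)
        ⟨v, mem_filter.2 ⟨hv, hv, SimpleGraph.Reachable.refl _⟩⟩ hne
      obtain ⟨haT, _, hr⟩ := mem_filter.1 ha
      apply hbA
      refine mem_filter.2 ⟨hb, hb, hr.trans (SimpleGraph.Adj.reachable ?_)⟩
      refine (SimpleGraph.fromRel_adj _ _ _).2 ⟨?_, ?_⟩
      · intro h
        have : a = b := congrArg Subtype.val h
        exact hbA (this ▸ ha)
      · obtain ⟨x, hx | hx⟩ := hl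
        · exact Or.inl ⟨x, mem_edgeSet.2 ⟨haT, by simpa [← hx] using hb⟩, hx.symm⟩
        · exact Or.inr ⟨x, mem_edgeSet.2 ⟨hb, by simpa [← hx] using haT⟩, hx.symm⟩
    rintro ⟨w, hw⟩
    have hwA : w ∈ A := hAT.symm ▸ hw
    exact (mem_filter.1 hwA).2.2
  have : Nonempty (induced P T).verts := ⟨⟨v, hv⟩⟩
  exact ⟨fun a b => (key a).symm.trans (key b)⟩

/-- Each component has at most the edges spanned by its vertices, so the bound is applied to each
component and summed. Taking a = 1 controls `ξ`, and a = s controls `ψ`. -/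
theorem beta1_add_mul_numComponents_le (K : P.FinSubgraph) {a s : ℝ}
    (h : ∀ T : Finset G, T.Nonempty → (edgeCount P.gen T : ℝ) + a ≤ s * #T) :
    (K.beta1 : ℝ) + a * K.numComponents ≤ s * K.beta0 := by
  let C := K.toSimpleGraph.ConnectedComponent
  have : Fintype C := Fintype.ofFinite C
  let V : C → Finset G := fun c =>
    (K.verts.attach.filter fun v => K.toSimpleGraph.connectedComponentMk v = c).map
      (Function.Embedding.subtype _)
  have hmem : ∀ c g, g ∈ V c ↔
      ∃ h : g ∈ K.verts, K.toSimpleGraph.connectedComponentMk ⟨g, h⟩ = c := by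
    intro c g
    simp [V]
  have hVcard : K.beta0 = ∑ c, #(V c) := by
    rw [GroupPresentation.FinSubgraph.beta0, ← card_attach,
      card_eq_sum_card_fiberwise (f := K.toSimpleGraph.connectedComponentMk) (t := univ) (by simp)]
    simp only [V, card_map]
    rfl
  have hVne : ∀ c, (V c).Nonempty := by
    intro c
    induction c using SimpleGraph.ConnectedComponent.ind with
    | h v => exact ⟨v, (hmem _ _).2 ⟨v.2, rfl⟩⟩
  have hE : K.beta1 ≤ ∑ c, edgeCount P.gen (V c) := by
    rw [GroupPresentation.FinSubgraph.beta1, ← card_attach,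
      card_eq_sum_card_fiberwise (t := univ)
        (f := fun e => K.toSimpleGraph.connectedComponentMk ⟨e.1.1, K.source_mem e.1 e.2⟩)
        (by simp)]
    refine sum_le_sum fun c _ => ?_
    refine card_le_card_of_injOn (fun e => e.1) ?_ (Subtype.val_injective.injOn)
    rintro ⟨e, he⟩ hc
    simp only [coe_filter, mem_attach, true_and, Set.mem_ofPred_eq] at hc
    rw [mem_coe, mem_edgeSet, hmem, hmem]
    refine ⟨⟨_, hc⟩, K.target_mem e he, ?_⟩
    rw [← hc]
    refine SimpleGraph.ConnectedComponent.sound ?_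
    by_cases heq : e.1 * P.gen e.2 = e.1
    · simp only [heq]
      exact SimpleGraph.Reachable.refl _
    · refine (SimpleGraph.Adj.reachable ((SimpleGraph.fromRel_adj _ _ _).2 ⟨?_, ?_⟩)).symm
      · exact fun h => heq (congrArg Subtype.val h).symm
      · exact Or.inl ⟨e.2, he, rfl⟩
  have hcomp : K.numComponents = Fintype.card C := Nat.card_eq_fintype_card
  calc (K.beta1 : ℝ) + a * K.numComponents
      ≤ ∑ c, (edgeCount P.gen (V c) : ℝ) + a * K.numComponents := by
        gcongr
        exact_mod_cast hE
    _ = ∑ c, ((edgeCount P.gen (V c) : ℝ) + a) := by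
        rw [sum_add_distrib, sum_const, card_univ, hcomp, nsmul_eq_mul, mul_comm a]
    _ ≤ ∑ c, s * #(V c) := sum_le_sum fun c _ => h _ (hVne c)
    _ = s * K.beta0 := by rw [hVcard, ← mul_sum]; push_cast; rfl

theorem xi_le (K : P.FinSubgraph) (hK : K.verts.Nonempty) {s : ℝ}
    (h : ∀ T : Finset G, T.Nonempty → (edgeCount P.gen T : ℝ) + 1 ≤ s * #T) : K.xi ≤ s - 1 := by
  have h1 := beta1_add_mul_numComponents_le K h
  have h0 : (0 : ℝ) < K.beta0 := by exact_mod_cast hK.card_pos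
  rw [GroupPresentation.FinSubgraph.xi, div_le_iff₀ h0, GroupPresentation.FinSubgraph.beta2]
  push_cast
  linarith

theorem beta2_induced_ge {T : Finset G} (hT : T.Nonempty) :
    (edgeCount P.gen T : ℝ) + 1 - #T ≤ (induced P T).beta2 := by
  have h1 : (1 : ℝ) ≤ (induced P T).numComponents := by
    exact_mod_cast one_le_numComponents (K := induced P T) hT
  rw [GroupPresentation.FinSubgraph.beta2]
  have h2 : ((induced P T).beta0 : ℝ) = #T := rfl
  have h3 : ((induced P T).beta1 : ℝ) = edgeCount P.gen T := rfl
  push_cast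
  linarith

theorem xi_induced_ge {T : Finset G} (hT : T.Nonempty) {s : ℝ}
    (h : s * #T ≤ (edgeCount P.gen T : ℝ) + 1) : s - 1 ≤ (induced P T).xi := by
  have h0 : (0 : ℝ) < (induced P T).beta0 := by exact_mod_cast hT.card_pos
  rw [GroupPresentation.FinSubgraph.xi, le_div_iff₀ h0]
  have h1 := beta2_induced_ge (P := P) hT
  have h2 : ((induced P T).beta0 : ℝ) = #T := rfl
  rw [h2]
  linarith

theorem edgeCount_add_one_le_card_add_one (T : Finset G) (hT : T.Nonempty) :
    (edgeCount P.gen T : ℝ) + 1 ≤ ((Fintype.card X : ℝ) + 1) * #T := by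
  have h1 : (edgeCount P.gen T : ℝ) ≤ Fintype.card X * #T := by
    exact_mod_cast edgeCount_le T
  have h2 : (1 : ℝ) ≤ #T := by exact_mod_cast hT.card_pos
  linarith

theorem psi_le (K : P.FinSubgraph) (hK : 1 < K.beta0) {c : ℝ} (hc : 0 ≤ c)
    (h : ∀ T : Finset G, T.Nonempty → (edgeCount P.gen T : ℝ) ≤ (c + 1) * (#T - 1)) :
    K.psi ≤ c := by
  have h1 := beta1_add_mul_numComponents_le K (a := c + 1) (s := c + 1)
    fun T hT => by linarith [h T hT]
  have h0 : (1 : ℝ) < K.beta0 := by exact_mod_cast hK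
  have h2 : (1 : ℝ) ≤ K.numComponents := by
    exact_mod_cast one_le_numComponents (K := K) (card_pos.1 (zero_lt_one.trans hK))
  rw [GroupPresentation.FinSubgraph.psi, div_le_iff₀ (by linarith),
    GroupPresentation.FinSubgraph.beta2]
  push_cast
  -- There is at least one component, so c ≥ 0 absorbs the excess c (components - 1).
  nlinarith

theorem Psi_le {c : ℝ} (hc : 0 ≤ c)
    (h : ∀ T : Finset G, T.Nonempty → (edgeCount P.gen T : ℝ) ≤ (c + 1) * (#T - 1)) :
    P.Psi ≤ c := by
  refine Real.sSup_le ?_ hc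
  rintro _ ⟨H, hH, rfl⟩
  exact psi_le H hH hc h

/-- Since β₀ ≤ 2(β₀ - 1) when β₀ ≥ 2, the crude bound `ξ ≤ n` doubles to one for `ψ`. -/
theorem bddAbove_psi (P : GroupPresentation X G) :
    BddAbove {t : ℝ | ∃ H : P.FinSubgraph, 1 < H.beta0 ∧ t = H.psi} := by
  refine ⟨2 * Fintype.card X, ?_⟩
  rintro _ ⟨K, hK, rfl⟩
  have h0 : (2 : ℝ) ≤ K.beta0 := by exact_mod_cast hK
  have hx := xi_le K (card_pos.1 (zero_lt_one.trans hK)) edgeCount_add_one_le_card_add_one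
  rw [GroupPresentation.FinSubgraph.xi, div_le_iff₀ (by linarith)] at hx
  rw [GroupPresentation.FinSubgraph.psi, div_le_iff₀ (by linarith)]
  have : (0 : ℝ) ≤ Fintype.card X := by positivity
  nlinarith

theorem Psi_nonneg (hred : P.IsReduced) : 0 ≤ P.Psi := by
  rcases isEmpty_or_nonempty X with hX | ⟨⟨x⟩⟩
  · have hG : ∀ g : G, g = 1 := by
      intro g
      have := P.closure_gen
      rw [Set.range_eq_empty, Subgroup.closure_empty] at this
      have hg : g ∈ (⊤ : Subgroup G) := trivial
      rwa [← this, Subgroup.mem_bot] at hg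
    -- The group is trivial, so no subgraph has two vertices and the supremum of the empty set is 0.
    refine Real.sSup_nonneg ?_
    rintro _ ⟨K, hK, rfl⟩
    have : K.beta0 ≤ 1 := card_le_one.2 fun a _ b _ => (hG a).trans (hG b).symm
    omega
  · have hne : (1 : G) ≠ P.gen x := (hred x).symm
    have hcard : #({1, P.gen x} : Finset G) = 2 := card_pair hne
    have he : 1 ≤ edgeCount P.gen {1, P.gen x} :=
      card_pos.2 ⟨(1, x), by simp [mem_edgeSet]⟩
    have he' : (1 : ℝ) ≤ edgeCount P.gen {1, P.gen x} := by exact_mod_cast he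
    refine le_trans ?_ (le_csSup (bddAbove_psi P)
      ⟨induced P {1, P.gen x}, hcard.ge, rfl⟩)
    have h5 := beta2_induced_ge (P := P) (T := {1, P.gen x}) (by simp)
    have h4 : ((induced P {1, P.gen x}).beta0 : ℝ) = 2 := by exact_mod_cast hcard
    rw [hcard] at h5
    rw [GroupPresentation.FinSubgraph.psi, h4]
    push_cast at h5
    exact div_nonneg (by linarith) (by norm_num)

/-- This is `ψ ≤ Ψ` for the induced subgraph. Reducedness extends it to single vertices, which then
carry no loops and give 0 on both sides. -/
theorem edgeCount_le_Psi (hred : P.IsReduced) {T : Finset G} (hT : T.Nonempty) :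
    (edgeCount P.gen T : ℝ) ≤ (P.Psi + 1) * (#T - 1) := by
  rcases (Nat.one_le_iff_ne_zero.2 hT.card_pos.ne').eq_or_lt with h1 | h1
  · obtain ⟨g, rfl⟩ := card_eq_one.1 h1.symm
    simp [edgeCount_singleton hred]
  · have h2 : (induced P T).psi ≤ P.Psi :=
      le_csSup (bddAbove_psi P) ⟨induced P T, h1, rfl⟩
    have h3 : (1 : ℝ) < #T := by exact_mod_cast h1
    have h4 : ((induced P T).beta0 : ℝ) = #T := rfl
    rw [GroupPresentation.FinSubgraph.psi, h4, div_le_iff₀ (by linarith)] at h2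
    have h5 := beta2_induced_ge (P := P) hT
    linarith

theorem exists_lt_edgeCount_of_lt_Psi {c : ℝ} (hc : 0 ≤ c) (h : c < P.Psi) :
    ∃ T : Finset G, T.Nonempty ∧ (c + 1) * (#T - 1) < (edgeCount P.gen T : ℝ) := by
  by_contra hcon
  push Not at hcon
  exact h.not_ge (Psi_le hc hcon)

end Subgraphs

/-! ### The suprema and where they are attained -/

section CyclomaticQuotient

/-- A uniform lower bound is needed for upper bounds on the real-valued limsup to make sense. -/
theorem neg_one_le_xi {X G : Type*} [Group G] {P : GroupPresentation X G}
    (K : P.FinSubgraph) : -1 ≤ K.xi := by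
  rcases Nat.eq_zero_or_pos K.beta0 with h | h
  · simp [GroupPresentation.FinSubgraph.xi, h]
  · have h0 : (0 : ℝ) < K.beta0 := by exact_mod_cast h
    rw [GroupPresentation.FinSubgraph.xi, le_div_iff₀ h0, GroupPresentation.FinSubgraph.beta2]
    push_cast
    have h1 : (0 : ℝ) ≤ K.numComponents := by positivity
    have h2 : (0 : ℝ) ≤ K.beta1 := by positivity
    linarith

variable {X G : Type*} [Group G] [Fintype X] {P : GroupPresentation X G}

theorem limsup_xi_le {C : ℕ → P.FinSubgraph} (hC : P.IsExhaustingChain C) {s : ℝ}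
    (h : ∀ T : Finset G, T.Nonempty → (edgeCount P.gen T : ℝ) + 1 ≤ s * #T) :
    Filter.limsup (fun i => (C i).xi) Filter.atTop ≤ s - 1 := by
  refine Filter.limsup_le_of_le ?_ (Filter.Eventually.of_forall fun i => ?_)
  · exact Filter.IsBoundedUnder.isCoboundedUnder_le
      ⟨-1, Filter.eventually_map.2 (Filter.Eventually.of_forall fun i => neg_one_le_xi _)⟩
  · obtain ⟨v⟩ := (hC.1 i).nonempty
    exact xi_le (C i) ⟨v, v.2⟩ h

theorem Xi_le {s : ℝ}
    (h : ∀ T : Finset G, T.Nonempty → (edgeCount P.gen T : ℝ) + 1 ≤ s * #T) : P.Xi ≤ s - 1 := by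
  have hs : 0 ≤ s - 1 := by
    have := h {1} (singleton_nonempty 1)
    simp only [card_singleton, Nat.cast_one, mul_one] at this
    have h2 : (0 : ℝ) ≤ edgeCount P.gen {1} := by positivity
    linarith
  refine Real.sSup_le ?_ hs
  rintro _ ⟨C, hC, rfl⟩
  exact limsup_xi_le hC h

/-- The group is countable, so a chain can absorb its elements one at a time, each step extending
the previous set to one of ratio at least s - 1/(i+1). -/
theorem le_Xi_of_exists_superset {s : ℝ} (h : ∀ ε : ℝ, 0 < ε → ∀ S : Finset G,
    ∃ S', S ⊆ S' ∧ Conn P.gen S' ∧ (s - ε) * #S' ≤ (edgeCount P.gen S' : ℝ) + 1) :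
    s - 1 ≤ P.Xi := by
  have hsurj : Function.Surjective (FreeGroup.lift P.gen) := by
    rw [← MonoidHom.range_eq_top, FreeGroup.range_lift_eq_closure, P.closure_gen]
  have : Countable G := hsurj.countable
  obtain ⟨f, hf⟩ := exists_surjective_nat G
  have h' : ∀ (i : ℕ) (S : Finset G), ∃ S', insert (f i) S ⊆ S' ∧ Conn P.gen S' ∧
      (s - 1 / ((i : ℝ) + 1)) * #S' ≤ (edgeCount P.gen S' : ℝ) + 1 := fun i S =>
    h _ Nat.one_div_pos_of_nat _
  choose N hN1 hN2 hN3 using h'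
  let S : ℕ → Finset G := fun i => Nat.rec ∅ (fun i T => N i T) i
  have hS : ∀ i, S (i + 1) = N i (S i) := fun i => rfl
  have hmono : Monotone S := monotone_nat_of_le_succ fun i =>
    (subset_insert _ _).trans (hN1 i (S i))
  let C : ℕ → P.FinSubgraph := fun i => induced P (S (i + 1))
  have hmem : ∀ g, ∃ i, g ∈ S (i + 1) := by
    intro g
    obtain ⟨i, rfl⟩ := hf g
    exact ⟨i, hN1 i (S i) (mem_insert_self _ _)⟩
  have hC : P.IsExhaustingChain C := by
    refine ⟨fun i => (hN2 i (S i)).induced_isConnected, fun i => ⟨hmono (Nat.le_succ (i + 1)),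
      edgeSet_mono (hmono (Nat.le_succ (i + 1)))⟩, hmem, ?_⟩
    rintro ⟨g, x⟩
    obtain ⟨i, hi⟩ := hmem g
    obtain ⟨j, hj⟩ := hmem (g * P.gen x)
    have hi' : g ∈ S (max i j + 1) := hmono (show i + 1 ≤ max i j + 1 by omega) hi
    have hj' : g * P.gen x ∈ S (max i j + 1) := hmono (show j + 1 ≤ max i j + 1 by omega) hj
    exact ⟨max i j, mem_edgeSet.2 ⟨hi', hj'⟩⟩
  have hbdd : BddAbove {η : ℝ | ∃ C : ℕ → P.FinSubgraph, P.IsExhaustingChain C ∧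
      η = Filter.limsup (fun i => (C i).xi) Filter.atTop} := by
    refine ⟨(Fintype.card X : ℝ) + 1 - 1, ?_⟩
    rintro _ ⟨C, hC, rfl⟩
    exact limsup_xi_le hC edgeCount_add_one_le_card_add_one
  refine le_trans ?_ (le_csSup hbdd ⟨C, hC, rfl⟩)
  have hlim : Filter.Tendsto (fun i : ℕ => s - 1 / ((i : ℝ) + 1) - 1) Filter.atTop
      (nhds (s - 0 - 1)) :=
    (tendsto_const_nhds.sub tendsto_one_div_add_atTop_nhds_zero_nat).sub tendsto_const_nhds
  rw [sub_zero] at hlim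
  rw [← hlim.limsup_eq]
  refine Filter.limsup_le_limsup (Filter.Eventually.of_forall fun i => ?_) ?_ ?_
  · exact xi_induced_ge (hN2 i (S i)).1 (hN3 i (S i))
  · exact hlim.isBoundedUnder_ge.isCoboundedUnder_le
  · refine ⟨(Fintype.card X : ℝ) + 1 - 1, Filter.eventually_map.2
      (Filter.Eventually.of_forall fun i => ?_)⟩
    exact xi_le (C i) (hN2 i (S i)).1 edgeCount_add_one_le_card_add_one

/-- Among the sets `T` in a non-empty family of bounded size there is one which maximizes a
function of `edgeCount γ T` and `#T`. -/
theorem exists_max_of_card_le {γ : X → G} (p : Finset G → Prop) (N : ℕ) (hp : ∀ T, p T → #T ≤ N)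
    (hne : ∃ T, p T) (f : ℕ → ℕ → ℝ) :
    ∃ T, p T ∧ ∀ S, p S → f (edgeCount γ S) #S ≤ f (edgeCount γ T) #T := by
  let V : Set ℝ := {t | ∃ T, p T ∧ t = f (edgeCount γ T) #T}
  have hfin : V.Finite := by
    refine Set.Finite.subset (Finset.finite_toSet
      ((range (Fintype.card X * N + 1) ×ˢ range (N + 1)).image fun q => f q.1 q.2)) ?_
    rintro _ ⟨T, hT, rfl⟩
    rw [mem_coe, mem_image]
    refine ⟨(edgeCount γ T, #T), ?_, rfl⟩
    have h1 := hp T hT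
    have h2 := (edgeCount_le (γ := γ) T).trans (Nat.mul_le_mul_left _ h1)
    rw [mem_product, mem_range, mem_range]
    exact ⟨by dsimp; omega, by dsimp; omega⟩
  obtain ⟨T₀, hT₀⟩ := hne
  obtain ⟨_, ⟨T, hT, rfl⟩, hmax⟩ := hfin.exists_maximal ⟨_, T₀, hT₀, rfl⟩
  refine ⟨T, hT, fun S hS => ?_⟩
  by_contra hlt
  push Not at hlt
  exact absurd (hmax ⟨S, hS, rfl⟩ hlt.le) (not_le.2 hlt)

/-- Equality sets of a supermodular bound: the union of two which meet is one. -/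
theorem edgeCount_union_eq {γ : X → G} {k s : ℝ}
    (hB : ∀ T : Finset G, T.Nonempty → (edgeCount γ T : ℝ) + k ≤ s * #T) {S T : Finset G}
    (hS : (edgeCount γ S : ℝ) + k = s * #S) (hT : (edgeCount γ T : ℝ) + k = s * #T)
    (hST : (S ∩ T).Nonempty) : (edgeCount γ (S ∪ T) : ℝ) + k = s * #(S ∪ T) := by
  have h1 : (edgeCount γ S : ℝ) + edgeCount γ T ≤ edgeCount γ (S ∪ T) + edgeCount γ (S ∩ T) := by
    exact_mod_cast edgeCount_supermodular S T
  have h2 : (#(S ∪ T) : ℝ) + #(S ∩ T) = #S + #T := by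
    exact_mod_cast card_union_add_card_inter S T
  have h3 := hB _ hST
  have h4 := hB _ (hST.mono inter_subset_union)
  have h5 : s * #(S ∪ T) + s * #(S ∩ T) = s * #S + s * #T := by
    rw [← mul_add, h2, mul_add]
  linarith

/-- An attaining set is connected, since two separate parts would gain 1 each. It grows by a
translate containing a vertex just outside: an overlapping translate is handled by supermodularity,
a disjoint one by the edge joining it to the set. -/
theorem exists_conn_of_attained {s : ℝ}
    (hB : ∀ T : Finset G, T.Nonempty → (edgeCount P.gen T : ℝ) + 1 ≤ s * #T) {T : Finset G}
    (hT : T.Nonempty) (hTs : (edgeCount P.gen T : ℝ) + 1 = s * #T) (N : ℕ) :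
    ∃ W, Conn P.gen W ∧ (edgeCount P.gen W : ℝ) + 1 = s * #W ∧ (N ≤ #W ∨ ∀ g, g ∈ W) := by
  have hconn : ∀ S : Finset G, S.Nonempty → (edgeCount P.gen S : ℝ) + 1 = s * #S →
      Conn P.gen S := by
    intro S hS hSs
    by_contra hcon
    obtain ⟨A, B, hA, hB', hAB, rfl, he⟩ := exists_split_of_not_conn hS hcon
    have h1 := hB A hA
    have h2 := hB B hB'
    rw [he, card_union_of_disjoint hAB] at hSs
    push_cast at hSs
    linarith
  induction N with
  | zero => exact ⟨T, hconn T hT hTs, hTs, Or.inl (Nat.zero_le _)⟩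
  | succ N ih =>
    obtain ⟨W, hW, hWs, hN | hN⟩ := ih
    swap
    · exact ⟨W, hW, hWs, Or.inr hN⟩
    by_cases hcl : ∀ g ∈ W, ∀ x, g * P.gen x ∈ W
    · exact ⟨W, hW, hWs, Or.inr (eq_univ_of_closed P.closure_gen hW.1 hcl)⟩
    push Not at hcl
    obtain ⟨g, hg, x, hx⟩ := hcl
    -- Left translation by `b` carries `g` to the outside vertex `g * P.gen x`.
    set b := g * P.gen x * g⁻¹ with hb
    have hgb : g * P.gen x ∈ b • W := by
      have : b • g = g * P.gen x := by simp [hb]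
      rw [← this]
      exact smul_mem_smul_finset hg
    have hlt : #W < #(W ∪ b • W) := card_lt_card
      ⟨subset_union_left, fun h => hx (h (mem_union_right _ hgb))⟩
    have hbs : (edgeCount P.gen (b • W) : ℝ) + 1 = s * #(b • W) := by
      rw [edgeCount_smul, card_smul_finset, hWs]
    have hus : (edgeCount P.gen (W ∪ b • W) : ℝ) + 1 = s * #(W ∪ b • W) := by
      rcases (W ∩ b • W).eq_empty_or_nonempty with hd | hne
      · rw [← disjoint_iff_inter_eq_empty] at hd
        refine le_antisymm (hB _ (hW.1.mono subset_union_left)) ?_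
        have h1 : (edgeCount P.gen W : ℝ) + edgeCount P.gen (b • W) + 1 ≤
            edgeCount P.gen (W ∪ b • W) := by
          exact_mod_cast edgeCount_union_of_linked hd hg hgb ⟨x, Or.inl rfl⟩
        rw [card_union_of_disjoint hd]
        push_cast
        linarith
      · exact edgeCount_union_eq hB hWs hbs hne
    exact ⟨_, hconn _ (hW.1.mono subset_union_left) hus, hus, Or.inl (by omega)⟩

/-- `Ξ + 1` bounds `(edgeCount T + 1) / #T` for all non-empty finite sets of vertices. -/
theorem edgeCount_add_one_le_Xi (P : GroupPresentation X G) {T : Finset G} (hT : T.Nonempty) :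
    (edgeCount P.gen T : ℝ) + 1 ≤ (P.Xi + 1) * #T := by
  let V : Set ℝ := {t | ∃ T : Finset G, T.Nonempty ∧ t = ((edgeCount P.gen T : ℝ) + 1) / #T}
  have hpos : ∀ T : Finset G, T.Nonempty → (0 : ℝ) < #T := fun T hT => by
    exact_mod_cast hT.card_pos
  have hbdd : BddAbove V := by
    refine ⟨(Fintype.card X : ℝ) + 1, ?_⟩
    rintro _ ⟨T, hT, rfl⟩
    rw [div_le_iff₀ (hpos T hT)]
    exact edgeCount_add_one_le_card_add_one T hT
  set s := sSup V with hs
  have hB : ∀ T : Finset G, T.Nonempty → (edgeCount P.gen T : ℝ) + 1 ≤ s * #T := by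
    intro T hT
    rw [← div_le_iff₀ (hpos T hT)]
    exact le_csSup hbdd ⟨T, hT, rfl⟩
  have hs1 : 1 ≤ s := by
    have := hB {1} (singleton_nonempty 1)
    simp only [card_singleton, Nat.cast_one, mul_one] at this
    have h2 : (0 : ℝ) ≤ edgeCount P.gen {1} := by positivity
    linarith
  have key : ∀ ε : ℝ, 0 < ε → ∀ N : ℕ, ∃ W, Conn P.gen W ∧
      (s - ε) * #W ≤ (edgeCount P.gen W : ℝ) + 1 ∧ (N ≤ #W ∨ ∀ g, g ∈ W) := by
    intro ε hε N
    by_cases hatt : ∃ T : Finset G, T.Nonempty ∧ (edgeCount P.gen T : ℝ) + 1 = s * #T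
    · obtain ⟨T, hT, hTs⟩ := hatt
      obtain ⟨W, h1, h2, h3⟩ := exists_conn_of_attained hB hT hTs N
      refine ⟨W, h1, ?_, h3⟩
      rw [h2]
      gcongr
      linarith
    -- When the supremum is not attained, sets of bounded size stay below it by a fixed margin, as
    -- they give finitely many ratios. A threshold `c` above all those ratios is exceeded only by
    -- large sets, and a smallest set exceeding it is connected.
    · push Not at hatt
      obtain ⟨T₀, ⟨hT₀, -⟩, hmax⟩ := exists_max_of_card_le (γ := P.gen)
        (fun T : Finset G => T.Nonempty ∧ #T ≤ N + 1) (N + 1) (fun T h => h.2)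
        ⟨{1}, singleton_nonempty 1, by simp⟩ (fun e m => ((e : ℝ) + 1) / m)
      have hlt : ((edgeCount P.gen T₀ : ℝ) + 1) / #T₀ < s := by
        rw [div_lt_iff₀ (hpos _ hT₀)]
        exact lt_of_le_of_ne (hB _ hT₀) (hatt _ hT₀)
      obtain ⟨c, hc1, hc2⟩ := exists_between (max_lt hlt (sub_lt_self s hε))
      rw [max_lt_iff] at hc1
      have hex : ∃ m, ∃ T : Finset G, T.Nonempty ∧ #T = m ∧
          c * #T < (edgeCount P.gen T : ℝ) + 1 := by
        obtain ⟨_, ⟨T, hT, rfl⟩, hlt⟩ :=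
          exists_lt_of_lt_csSup (s := V) ⟨_, {1}, singleton_nonempty 1, rfl⟩
          hc2
        exact ⟨_, T, hT, rfl, (lt_div_iff₀ (hpos T hT)).1 hlt⟩
      obtain ⟨W, hW, hWm, hWc⟩ := Nat.find_spec hex
      have hmin := fun m => Nat.find_min hex (m := m)
      rw [← hWm] at hmin
      refine ⟨W, ?_, ?_, Or.inl ?_⟩
      · by_contra hcon
        obtain ⟨A, B, hA, hB', hAB, rfl, he⟩ := exists_split_of_not_conn hW hcon
        rw [card_union_of_disjoint hAB] at hWc hmin
        have h1 := hmin _ (by have := hB'.card_pos; omega) ⟨A, hA, rfl, ?_⟩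
        · exact h1
        by_contra h1
        have h2 := hmin _ (by have := hA.card_pos; omega) ⟨B, hB', rfl, ?_⟩
        · exact h2
        rw [he] at hWc
        push_cast at hWc
        linarith
      · refine le_trans ?_ hWc.le
        gcongr
        exact hc1.2.le
      · by_contra hlt
        have := hmax W ⟨hW, by omega⟩
        rw [div_le_iff₀ (hpos W hW)] at this
        have h3 : ((edgeCount P.gen T₀ : ℝ) + 1) / #T₀ * #W ≤ c * #W := by
          gcongr
          exact hc1.1.le
        linarith
  -- A translate of a near-optimal `W` is glued at 1 to a connected set containing `S`. If `W` is
  -- large, the extra vertices cost at most another ε/2.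
  have hfin : s - 1 ≤ P.Xi := by
    refine le_Xi_of_exists_superset fun ε hε S => ?_
    obtain ⟨C, hC, hC1, hSC⟩ := exists_conn_superset P.closure_gen S
    obtain ⟨N, hN⟩ := exists_nat_gt (s * #C / (ε / 2))
    obtain ⟨W, hW, hWe, hWN⟩ := key (ε / 2) (half_pos hε) N
    rcases hWN with hWN | hWN
    · obtain ⟨w, hw⟩ := hW.1
      have hw' : (1 : G) ∈ w⁻¹ • W := by
        have := smul_mem_smul_finset (a := w⁻¹) hw
        simpa using this
      refine ⟨C ∪ w⁻¹ • W, hSC.trans subset_union_left,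
        hC.union (hW.smul _) ⟨1, mem_inter.2 ⟨hC1, hw'⟩⟩, ?_⟩
      have h1 : (edgeCount P.gen W : ℝ) ≤ edgeCount P.gen (C ∪ w⁻¹ • W) := by
        rw [← edgeCount_smul w⁻¹ W]
        exact_mod_cast edgeCount_mono subset_union_right
      have h2 : (#(C ∪ w⁻¹ • W) : ℝ) ≤ #C + #W := by
        rw [← card_smul_finset w⁻¹ W]
        exact_mod_cast card_union_le _ _
      have h2' : (#W : ℝ) ≤ #(C ∪ w⁻¹ • W) := by
        rw [← card_smul_finset w⁻¹ W]
        exact_mod_cast card_le_card subset_union_right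
      have h3 : s * #C < ε / 2 * #W := by
        rw [div_lt_iff₀ (half_pos hε)] at hN
        have : (N : ℝ) ≤ #W := by exact_mod_cast hWN
        nlinarith
      nlinarith
    · refine ⟨W, fun g _ => hWN g, hW, le_trans ?_ hWe⟩
      gcongr
      linarith
  have := hB T hT
  have h4 : s * #T ≤ (P.Xi + 1) * #T := by
    gcongr
    linarith
  linarith

theorem Xi_nonneg (hred : P.IsReduced) : 0 ≤ P.Xi := by
  have := edgeCount_add_one_le_Xi P (singleton_nonempty (1 : G))
  rw [edgeCount_singleton hred] at this
  simpa using this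

theorem Xi_le_Psi (hred : P.IsReduced) : P.Xi ≤ P.Psi := by
  have := Xi_le (P := P) (s := P.Psi + 1) fun T hT => by
    have h1 := edgeCount_le_Psi hred hT
    have h2 := Psi_nonneg hred
    linarith
  linarith

theorem xi_le_Xi (K : P.FinSubgraph) (hK : K.verts.Nonempty) : K.xi ≤ P.Xi := by
  have := xi_le K hK (s := P.Xi + 1) fun T hT => edgeCount_add_one_le_Xi P hT
  linarith

/-- If a supermodular bound is attained, but not on arbitrarily large sets, then it is attained
on a finite subgroup. -/
theorem exists_subgroup_of_attained {γ : X → G} {k s : ℝ}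
    (hB : ∀ T : Finset G, T.Nonempty → (edgeCount γ T : ℝ) + k ≤ s * #T) {T : Finset G}
    (hT : T.Nonempty) (hTs : (edgeCount γ T : ℝ) + k = s * #T) (N : ℕ)
    (hN : ∀ S : Finset G, S.Nonempty → (edgeCount γ S : ℝ) + k = s * #S → #S ≤ N) :
    ∃ (H : Subgroup G) (S : Finset G), (S : Set G) = H ∧ #T ≤ #S ∧
      (edgeCount γ S : ℝ) + k = s * #S := by
  obtain ⟨W, ⟨hW, hWs, hWT⟩, hmax⟩ := exists_max_of_card_le (γ := γ)
    (fun S : Finset G => S.Nonempty ∧ (edgeCount γ S : ℝ) + k = s * #S ∧ #T ≤ #S) N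
    (fun S h => hN S h.1 h.2.1) ⟨T, hT, hTs, le_rfl⟩ (fun _ m => (m : ℝ))
  obtain ⟨w, hw⟩ := hW
  set S := w⁻¹ • W with hS
  have h1 : (1 : G) ∈ S := by
    have := smul_mem_smul_finset (a := w⁻¹) hw
    simpa using this
  have hcard : #S = #W := card_smul_finset _ _
  have hSs : (edgeCount γ S : ℝ) + k = s * #S := by rw [hcard, hS, edgeCount_smul, hWs]
  -- As `1 ∈ S`, the translate `g • S` meets `S` in `g`, so the union attains the bound; maximality
  -- of the size gives equality.
  have hmul : ∀ g ∈ S, g • S = S := by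
    intro g hg
    have hg' : g ∈ g • S := by
      have := smul_mem_smul_finset (a := g) h1
      simpa using this
    have hu : (edgeCount γ (S ∪ g • S) : ℝ) + k = s * #(S ∪ g • S) :=
      edgeCount_union_eq hB hSs (by rw [edgeCount_smul, card_smul_finset, hSs])
        ⟨g, mem_inter.2 ⟨hg, hg'⟩⟩
    have hle : #(S ∪ g • S) ≤ #S := by
      have := hmax (S ∪ g • S) ⟨⟨1, mem_union_left _ h1⟩, hu,
        (hWT.trans hcard.ge).trans (card_le_card subset_union_left)⟩
      rw [hcard]
      exact_mod_cast this
    have h2 : S ∪ g • S = S := (eq_of_subset_of_card_le subset_union_left hle).symm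
    refine eq_of_subset_of_card_le (union_eq_left.1 h2) (card_smul_finset _ _).ge
  refine ⟨{ carrier := S, mul_mem' := ?_, one_mem' := h1, inv_mem' := ?_ }, S, rfl,
    hWT.trans hcard.ge, hSs⟩
  · intro a b ha hb
    have := smul_mem_smul_finset (a := a) (mem_coe.1 hb)
    rw [hmul a ha] at this
    exact this
  · intro a ha
    have h1' := h1
    rw [← hmul a ha] at h1'
    obtain ⟨b, hb, hab⟩ := mem_smul_finset.1 h1'
    have : a⁻¹ = b := inv_eq_of_mul_eq_one_right hab
    rw [mem_coe] at *
    rw [this]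
    exact hb

/-- A violating ratio v > s ≥ Ξ + 1 can be reached only by sets with at most k/(v - s) vertices.
Hence a largest ratio exists, and it is attained on a finite subgroup, where the bound was assumed.
-/
theorem edgeCount_add_le_of_subgroups {k s : ℝ} (hs : P.Xi + 1 ≤ s)
    (hH : ∀ (H : Subgroup G) (S : Finset G), (S : Set G) = H → (edgeCount P.gen S : ℝ) + k ≤ s * #S)
    {T : Finset G} (hT : T.Nonempty) : (edgeCount P.gen T : ℝ) + k ≤ s * #T := by
  have hpos : ∀ T : Finset G, T.Nonempty → (0 : ℝ) < #T := fun T hT => by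
    exact_mod_cast hT.card_pos
  by_contra hcon
  push Not at hcon
  set v := ((edgeCount P.gen T : ℝ) + k) / #T with hv
  have hvs : s < v := (lt_div_iff₀ (hpos T hT)).2 hcon
  obtain ⟨N, hN⟩ := exists_nat_gt (k / (v - s))
  have hbound : ∀ S : Finset G, S.Nonempty → v * #S ≤ (edgeCount P.gen S : ℝ) + k → #S ≤ N := by
    intro S hS hSv
    have h1 := edgeCount_add_one_le_Xi P hS
    have h2 : (P.Xi + 1) * #S ≤ s * #S := by gcongr
    have h3 : (v - s) * #S ≤ k := by nlinarith
    have h4 : (#S : ℝ) ≤ k / (v - s) := by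
      rw [le_div_iff₀ (by linarith)]; linarith
    exact_mod_cast (h4.trans hN.le)
  obtain ⟨W, ⟨hW, hWv⟩, hmax⟩ := exists_max_of_card_le (γ := P.gen)
    (fun S : Finset G => S.Nonempty ∧ v * #S ≤ (edgeCount P.gen S : ℝ) + k) N
    (fun S h => hbound S h.1 h.2) ⟨T, hT, by rw [hv, div_mul_cancel₀ _ (hpos T hT).ne']⟩
    (fun e m => ((e : ℝ) + k) / m)
  set m := ((edgeCount P.gen W : ℝ) + k) / #W with hm
  have hvm : v ≤ m := (le_div_iff₀ (hpos W hW)).2 hWv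
  have hB : ∀ S : Finset G, S.Nonempty → (edgeCount P.gen S : ℝ) + k ≤ m * #S := by
    intro S hS
    by_cases hSv : v * #S ≤ (edgeCount P.gen S : ℝ) + k
    · have := hmax S ⟨hS, hSv⟩
      rwa [div_le_iff₀ (hpos S hS)] at this
    · push Not at hSv
      refine hSv.le.trans ?_
      gcongr
  obtain ⟨H, S, hSH, hWS, hSm⟩ := exists_subgroup_of_attained hB hW
    (by rw [hm, div_mul_cancel₀ _ (hpos W hW).ne']) N (fun S hS hSm => hbound S hS (by
      rw [hSm]; gcongr))
  have h1 := hH H S hSH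
  have h2 : (0 : ℝ) < #S := by
    have : 0 < #S := hW.card_pos.trans_le hWS
    exact_mod_cast this
  nlinarith

/-- For c strictly between Ξ and Ψ, a set with e(T) ≥ (c + 1)(#T - 1) has at most c/(c - Ξ)
vertices. So `Ψ` is attained, and `exists_subgroup_of_attained` applies with k = s = Ψ + 1. -/
theorem exists_subgroup_of_Xi_lt_Psi (hred : P.IsReduced) (h : P.Xi < P.Psi) :
    ∃ (H : Subgroup G) (S : Finset G), (S : Set G) = H ∧ 2 ≤ #S ∧
      (edgeCount P.gen S : ℝ) = (P.Psi + 1) * (#S - 1) := by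
  have hXi := Xi_nonneg hred
  obtain ⟨c, hc1, hc2⟩ := exists_between h
  have hc0 : 0 ≤ c := hXi.trans hc1.le
  have htwo : ∀ T : Finset G, T.Nonempty → #T ≠ 1 → 2 ≤ #T := by
    intro T hT h1
    have := hT.card_pos
    omega
  obtain ⟨T, hT, hTc⟩ := exists_lt_edgeCount_of_lt_Psi hc0 hc2
  have hT1 : #T ≠ 1 := by
    intro h1
    obtain ⟨g, rfl⟩ := card_eq_one.1 h1
    rw [edgeCount_singleton hred] at hTc
    simp at hTc
  obtain ⟨N, hN⟩ := exists_nat_gt (c / (c - P.Xi))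
  have hbound : ∀ S : Finset G, S.Nonempty → (c + 1) * (#S - 1) ≤ (edgeCount P.gen S : ℝ) →
      #S ≤ N := by
    intro S hS hSc
    have h1 := edgeCount_add_one_le_Xi P hS
    have h4 : (#S : ℝ) ≤ c / (c - P.Xi) := by
      rw [le_div_iff₀ (by linarith)]; linarith
    exact_mod_cast (h4.trans hN.le)
  have hpos : ∀ T : Finset G, 2 ≤ #T → (0 : ℝ) < #T - 1 := fun T hT => by
    have : (2 : ℝ) ≤ #T := by exact_mod_cast hT
    linarith
  obtain ⟨W, ⟨hW, hWc⟩, hmax⟩ := exists_max_of_card_le (γ := P.gen)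
    (fun S : Finset G => 2 ≤ #S ∧ (c + 1) * (#S - 1) ≤ (edgeCount P.gen S : ℝ)) N
    (fun S h => hbound S (card_pos.1 (by omega)) h.2) ⟨T, htwo T hT hT1, hTc.le⟩
    (fun e m => (e : ℝ) / (m - 1))
  have hWne : W.Nonempty := card_pos.1 (by omega)
  have hWPsi : (edgeCount P.gen W : ℝ) = (P.Psi + 1) * (#W - 1) := by
    refine le_antisymm (edgeCount_le_Psi hred hWne) ?_
    rw [← le_div_iff₀ (hpos W hW)]
    have : P.Psi ≤ (edgeCount P.gen W : ℝ) / (#W - 1) - 1 := by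
      refine Psi_le ?_ fun S hS => ?_
      · have := (le_div_iff₀ (hpos W hW)).2 hWc
        linarith
      · rw [sub_add_cancel]
        by_cases hS1 : #S = 1
        · obtain ⟨g, rfl⟩ := card_eq_one.1 hS1
          simp [edgeCount_singleton hred]
        · have hS2 := htwo S hS hS1
          by_cases hSc : (c + 1) * (#S - 1) ≤ (edgeCount P.gen S : ℝ)
          · have := hmax S ⟨hS2, hSc⟩
            rwa [div_le_iff₀ (hpos S hS2)] at this
          · push Not at hSc
            refine hSc.le.trans ?_
            have := hpos S hS2
            gcongr
            exact (le_div_iff₀ (hpos W hW)).2 hWc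
    linarith
  obtain ⟨H, S, hSH, hWS, hSm⟩ := exists_subgroup_of_attained (γ := P.gen) (k := P.Psi + 1)
    (s := P.Psi + 1) (fun S hS => by linarith [edgeCount_le_Psi hred hS]) hWne
    (by rw [hWPsi]; ring) N (fun S hS hSm => hbound S hS (by
      have h1 : (1 : ℝ) ≤ #S := by exact_mod_cast hS.card_pos
      nlinarith))
  exact ⟨H, S, hSH, hW.trans hWS, by linarith⟩

end CyclomaticQuotient

/-! ### Minimal presentations, finite and infinite groups -/

section Minimal

variable {X G : Type*} [Group G] {P : GroupPresentation X G}

theorem gen_notMem_Gp (hmin : P.IsMinimal) {Y : Set X} {x : X} (hx : x ∉ Y) :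
    P.gen x ∉ P.Gp Y := by
  intro hmem
  have : ({x}ᶜ : Set X) = Set.univ := by
    apply hmin
    rw [eq_top_iff, ← P.closure_gen, Subgroup.closure_le]
    rintro _ ⟨y, rfl⟩
    by_cases hy : y = x
    · subst hy
      refine Subgroup.closure_mono ?_ hmem
      refine Set.image_mono fun z hz => ?_
      rintro rfl
      exact hx hz
    · exact Subgroup.subset_closure ⟨y, hy, rfl⟩
  have hmem' : x ∈ ({x}ᶜ : Set X) := this ▸ Set.mem_univ x
  exact hmem' rfl

theorem gen_injective (hmin : P.IsMinimal) : Function.Injective P.gen := by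
  intro x y hxy
  by_contra hne
  have hx : x ∉ ({y} : Set X) := hne
  apply gen_notMem_Gp hmin hx
  rw [hxy]
  exact Subgroup.subset_closure ⟨y, rfl, rfl⟩

theorem isMinimal_sub (hmin : P.IsMinimal) (Y : Set X) : (P.sub Y).IsMinimal := by
  intro W hW
  refine Set.eq_univ_of_forall fun y => ?_
  by_contra hy
  have hy' : (y : X) ∉ ((↑) '' W : Set X) := by
    rintro ⟨z, hz, hzy⟩
    exact hy (Subtype.ext hzy ▸ hz)
  apply gen_notMem_Gp hmin hy'
  have h1 : (P.sub Y).gen y ∈ Subgroup.closure ((P.sub Y).gen '' W) := by rw [hW]; trivial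
  have h2 := Subgroup.mem_map_of_mem (P.Gp Y).subtype h1
  rw [MonoidHom.map_closure, ← Set.image_comp] at h2
  rw [GroupPresentation.Gp, ← Set.image_comp]
  exact h2

theorem isReduced_sub (hred : P.IsReduced) (Y : Set X) : (P.sub Y).IsReduced := fun y h =>
  hred y (congrArg Subtype.val h)

theorem infinite_Gp_of_torsionFree (hred : P.IsReduced)
    (h : ∀ g : G, g ≠ 1 → ¬ IsOfFinOrder g) (Y : Set X) (hY : Y.Nonempty) :
    Infinite (P.Gp Y) := by
  obtain ⟨y, hy⟩ := hY
  by_contra hfin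
  rw [not_infinite_iff_finite] at hfin
  have h1 : P.gen y ∈ P.Gp Y := Subgroup.subset_closure ⟨y, hy, rfl⟩
  have h2 := isOfFinOrder_of_finite (⟨P.gen y, h1⟩ : P.Gp Y)
  exact h _ (hred y) ((Submonoid.isOfFinOrder_coe (H := (P.Gp Y).toSubmonoid)).2 h2)

variable [Fintype X]

/-- Minimality makes the generators distinct, and reducedness keeps them off the identity. -/
theorem card_gen_mem_add_one_le (hred : P.IsReduced) (hmin : P.IsMinimal) {H : Subgroup G}
    {S : Finset G} (hS : (S : Set G) = H) : #{x | P.gen x ∈ H} + 1 ≤ #S := by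
  have h1 : (1 : G) ∈ S := by
    rw [← mem_coe, hS]
    exact H.one_mem
  rw [← card_erase_add_one h1]
  refine Nat.add_le_add_right (card_le_card_of_injOn P.gen ?_ (gen_injective hmin).injOn) 1
  intro x hx
  rw [mem_coe, mem_filter] at hx
  rw [mem_coe, mem_erase]
  refine ⟨hred x, ?_⟩
  rw [← mem_coe, hS]
  exact hx.2

theorem exists_gen_notMem {H : Subgroup G} (hH : H ≠ ⊤) : ∃ x, P.gen x ∉ H := by
  by_contra hcon
  push Not at hcon
  apply hH
  rw [eq_top_iff, ← P.closure_gen, Subgroup.closure_le]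
  rintro _ ⟨x, rfl⟩
  exact hcon x

theorem card_gen_mem_lt {H : Subgroup G} (hH : H ≠ ⊤) :
    #{x | P.gen x ∈ H} < Fintype.card X := by
  obtain ⟨x, hx⟩ := exists_gen_notMem (P := P) hH
  exact card_lt_card (filter_ssubset.2 ⟨x, mem_univ x, hx⟩)

theorem edgeCount_univ [Fintype G] :
    edgeCount P.gen univ = Fintype.card X * Fintype.card G := by
  rw [edgeCount_subgroup (⊤ : Subgroup G) univ (by simp)]
  simp

/-- Every proper non-empty subset lacks an edge, so e(T) + 1 ≤ n #T; only the whole group reaches e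
= n #T. -/
theorem Xi_of_finite [Finite G] :
    (P.Xi + 1) * Nat.card G = Fintype.card X * Nat.card G + 1 := by
  have := Fintype.ofFinite G
  rw [Nat.card_eq_fintype_card]
  have hG : (0 : ℝ) < Fintype.card G := by exact_mod_cast Fintype.card_pos
  refine le_antisymm ?_ ?_
  · have h1 : P.Xi ≤ ((Fintype.card X : ℝ) + 1 / Fintype.card G) - 1 := by
      refine Xi_le fun T hT => ?_
      by_cases hcl : ∀ g ∈ T, ∀ x, g * P.gen x ∈ T
      · have : T = univ := eq_univ_of_forall fun g => eq_univ_of_closed P.closure_gen hT hcl g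
        subst this
        rw [edgeCount_univ, card_univ]
        push_cast
        field_simp
        rfl
      · push Not at hcl
        obtain ⟨g, hg, x, hx⟩ := hcl
        have h2 : (edgeCount P.gen T : ℝ) + 1 ≤ Fintype.card X * #T := by
          exact_mod_cast edgeCount_add_one_le hg hx
        have h3 : (0 : ℝ) ≤ 1 / Fintype.card G * #T := by positivity
        linarith
    calc (P.Xi + 1) * Fintype.card G ≤ ((Fintype.card X : ℝ) + 1 / Fintype.card G) *
          Fintype.card G := mul_le_mul_of_nonneg_right (by linarith) hG.le
      _ = _ := by field_simp
  · have := edgeCount_add_one_le_Xi P (T := univ) univ_nonempty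
    rw [edgeCount_univ, card_univ] at this
    exact_mod_cast this

theorem Xi_le_of_infinite [Infinite G] (P : GroupPresentation X G) :
    P.Xi ≤ (Fintype.card X : ℝ) - 1 := by
  refine Xi_le fun T hT => ?_
  have : ∃ g ∈ T, ∃ x, g * P.gen x ∉ T := by
    by_contra hcl
    push Not at hcl
    exact (Infinite.exists_notMem_finset T).elim fun g hg =>
      hg (eq_univ_of_closed P.closure_gen hT hcl g)
  obtain ⟨g, hg, x, hx⟩ := this
  exact_mod_cast edgeCount_add_one_le hg hx

/-- For a minimal presentation `Ψ` exceeds both `Ξ` and `n - 1` only if the group is finite. -/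
theorem Psi_le_of_minimal (hred : P.IsReduced) (hmin : P.IsMinimal) {c : ℝ} (hc : P.Xi ≤ c)
    (hn : (Fintype.card X : ℝ) - 1 ≤ c)
    (hG : ∀ _ : Fintype G, 2 ≤ Fintype.card G →
      (Fintype.card X * Fintype.card G : ℝ) ≤ (c + 1) * (Fintype.card G - 1)) :
    P.Psi ≤ c := by
  by_contra hlt
  push Not at hlt
  obtain ⟨H, S, hSH, hS2, hSe⟩ := exists_subgroup_of_Xi_lt_Psi hred (hc.trans_lt hlt)
  have hS2' : (2 : ℝ) ≤ #S := by exact_mod_cast hS2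
  by_cases hH : H = ⊤
  · subst hH
    have hSu : ∀ g, g ∈ S := fun g => by rw [← mem_coe, hSH]; trivial
    let _ : Fintype G := ⟨S, hSu⟩
    have hcard : #S = Fintype.card G := congrArg card (eq_univ_of_forall hSu)
    rw [eq_univ_of_forall hSu, edgeCount_univ, card_univ] at hSe
    have := hG inferInstance (hcard ▸ hS2)
    rw [hcard] at hS2'
    push_cast at hSe
    nlinarith
  -- A proper subgroup of order h containing k generators has k ≤ h - 1 and k ≤ n - 1, so Ψ + 1 =
  -- kh/(h - 1) ≤ k + 1 ≤ n.
  · have h1 := card_gen_mem_add_one_le hred hmin hSH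
    have h2 := card_gen_mem_lt (P := P) hH
    rw [edgeCount_subgroup H S hSH] at hSe
    push_cast at hSe
    have h1' : ((#{x | P.gen x ∈ H} : ℕ) : ℝ) + 1 ≤ #S := by exact_mod_cast h1
    have h2' : ((#{x | P.gen x ∈ H} : ℕ) : ℝ) + 1 ≤ Fintype.card X := by exact_mod_cast h2
    nlinarith

theorem Psi_le_of_infinite_minimal [Infinite G] (hred : P.IsReduced) (hmin : P.IsMinimal) :
    P.Psi ≤ (Fintype.card X : ℝ) - 1 :=
  Psi_le_of_minimal hred hmin (Xi_le_of_infinite P) le_rfl fun _ _ =>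
    (not_finite G).elim

theorem Psi_of_finite_minimal [Finite G] [Nontrivial G] (hred : P.IsReduced)
    (hmin : P.IsMinimal) :
    (P.Psi + 1) * (Nat.card G - 1) = Fintype.card X * Nat.card G := by
  have hFG := Fintype.ofFinite G
  have hXi := Xi_of_finite (P := P)
  rw [Nat.card_eq_fintype_card] at hXi ⊢
  have hG : (2 : ℝ) ≤ Fintype.card G := by exact_mod_cast Fintype.one_lt_card (α := G)
  have hX : (1 : ℝ) ≤ Fintype.card X := by
    obtain ⟨x, -⟩ := exists_gen_notMem (P := P) (bot_ne_top (α := Subgroup G))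
    exact_mod_cast Fintype.card_pos_iff.2 ⟨x⟩
  refine le_antisymm ?_ ?_
  · rw [← le_div_iff₀ (by linarith)]
    have hc : (Fintype.card X : ℝ) ≤ Fintype.card X * Fintype.card G / (Fintype.card G - 1) := by
      rw [le_div_iff₀ (by linarith)]
      nlinarith
    have := Psi_le_of_minimal hred hmin
      (c := (Fintype.card X * Fintype.card G : ℝ) / (Fintype.card G - 1) - 1) ?_ (by linarith) ?_
    · linarith
    · rw [le_sub_iff_add_le, le_div_iff₀ (by linarith)]
      nlinarith [Xi_nonneg hred]
    · intro hF _
      obtain rfl : hF = hFG := Subsingleton.elim _ _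
      rw [sub_add_cancel, div_mul_cancel₀ _ (by linarith)]
  · have := edgeCount_le_Psi hred (T := univ) univ_nonempty
    rw [edgeCount_univ, card_univ] at this
    exact_mod_cast this

/-- Here k, h are the number of generators in a finite subgroup and its order, with p = Ψ + 1
realized by it; k', h' belong to a competitor. The claim is k' + c/h' ≤ k + c/h. If k' = k, the
bound by p forces h ≤ h'. If k' > k, then p ≤ k + 1 ≤ k' contradicts that bound. If k' < k, the case
h' < h is the only delicate one, and c ≤ p reduces it to c = p. -/
theorem subgroup_value_le {k h k' h' : ℕ} {p c : ℝ} (hp : 1 ≤ p) (hc0 : 0 ≤ c) (hcp : c ≤ p)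
    (hh : 2 ≤ h) (hk : k + 1 ≤ h) (hkh : (k : ℝ) * h = p * (h - 1)) (hk' : k' + 1 ≤ h')
    (hkh' : (k' : ℝ) * h' ≤ p * (h' - 1)) :
    ((k' : ℝ) * h' + c) * h ≤ (k * h + c) * h' := by
  have hh_r : (2 : ℝ) ≤ h := by exact_mod_cast hh
  have hk_r : (k : ℝ) + 1 ≤ h := by exact_mod_cast hk
  have hk'_r : (k' : ℝ) + 1 ≤ h' := by exact_mod_cast hk'
  have hk0 : (0 : ℝ) ≤ k := by positivity
  have hk'0 : (0 : ℝ) ≤ k' := by positivity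
  rcases lt_trichotomy k' k with hlt | heq | hgt
  · have hlt_r : (k' : ℝ) + 1 ≤ k := by exact_mod_cast hlt
    suffices hs : c * (h - h') ≤ (k - k') * h * h' by nlinarith
    rcases le_or_gt (h : ℝ) h' with hle | hgt
    · have h1 : c * (h - h') ≤ 0 := mul_nonpos_of_nonneg_of_nonpos hc0 (by linarith)
      have h2 : 0 ≤ ((k : ℝ) - k') * h * h' :=
        mul_nonneg (mul_nonneg (by linarith) (by linarith)) (by linarith)
      linarith
    · have h1 : c * (h - h') ≤ p * (h - h') := by
        gcongr
      refine h1.trans ?_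
      have h2 : (k : ℝ) * (h - h') ≤ (k - k') * h' * (h - 1) := by
        have h3 : (k' : ℝ) * h ≤ (k - k') * (h' - 1) * h := by
          gcongr
          nlinarith
        nlinarith [mul_nonneg hk'0 (by linarith : (0 : ℝ) ≤ h')]
      have h4 : (0 : ℝ) < h - 1 := by linarith
      refine le_of_mul_le_mul_right ?_ h4
      calc p * (h - h') * (h - 1) = (k * (h - h')) * h := by linear_combination -(h - h' : ℝ) * hkh
        _ ≤ ((k - k') * h' * (h - 1)) * h := by gcongr
        _ = (k - k') * h * h' * (h - 1) := by ring
  · subst heq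
    have hkpos : (0 : ℝ) < k' := by
      by_contra hcon
      have : (k' : ℝ) = 0 := le_antisymm (not_lt.1 hcon) hk'0
      rw [this] at hkh
      nlinarith
    have h1 : (k' : ℝ) * h ≤ k' * h' := by
      have h2 : (k' : ℝ) * h' * (h - 1) ≤ p * (h' - 1) * (h - 1) := by
        gcongr
        linarith
      nlinarith
    have h3 : (h : ℝ) ≤ h' := le_of_mul_le_mul_left h1 hkpos
    nlinarith
  · have hgt_r : (k : ℝ) + 1 ≤ k' := by exact_mod_cast hgt
    have h1 : p ≤ k + 1 := by
      by_contra hcon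
      push Not at hcon
      nlinarith
    nlinarith

/-- For a minimal presentation, a finite subgroup which realizes `Ψ` also maximizes
`(edgeCount T + c) / #T` when `c ≤ Ψ + 1`, unless this is bounded by `Ξ + 1`. -/
theorem edgeCount_add_le_of_minimal (hred : P.IsReduced) (hmin : P.IsMinimal) {H : Subgroup G}
    {S : Finset G} (hSH : (S : Set G) = H) (hS2 : 2 ≤ #S)
    (hSe : (edgeCount P.gen S : ℝ) = (P.Psi + 1) * (#S - 1)) {c s : ℝ} (hc0 : 0 ≤ c)
    (hc : c ≤ P.Psi + 1) (hs : P.Xi + 1 ≤ s) (hSs : (edgeCount P.gen S : ℝ) + c ≤ s * #S)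
    {T : Finset G} (hT : T.Nonempty) : (edgeCount P.gen T : ℝ) + c ≤ s * #T := by
  refine edgeCount_add_le_of_subgroups hs (fun H' S' hSH' => ?_) hT
  have hne : S'.Nonempty := ⟨1, by rw [← mem_coe, hSH']; exact H'.one_mem⟩
  have he' := edgeCount_le_Psi hred hne
  rw [edgeCount_subgroup H S hSH] at hSe hSs
  rw [edgeCount_subgroup H' S' hSH'] at he' ⊢
  push_cast at hSe hSs he' ⊢
  have h1 := subgroup_value_le (by linarith [Psi_nonneg hred]) hc0 hc hS2
    (card_gen_mem_add_one_le hred hmin hSH) hSe (card_gen_mem_add_one_le hred hmin hSH') he'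
  have h2 : (0 : ℝ) < #S := by
    have : (2 : ℝ) ≤ #S := by exact_mod_cast hS2
    linarith
  refine le_of_mul_le_mul_right (h1.trans ?_) h2
  calc _ ≤ s * #S * #S' := by gcongr
    _ = _ := by ring

/-- Otherwise a finite subgroup realizes `Ψ`. It has edges, hence contains generators, and these
generate a finite group. -/
theorem Psi_le_Xi_of_infinite_Gp (hred : P.IsReduced)
    (h : ∀ Y : Set X, Y.Nonempty → Infinite (P.Gp Y)) : P.Psi ≤ P.Xi := by
  by_contra hlt
  push Not at hlt
  obtain ⟨H, S, hSH, hS2, hSe⟩ := exists_subgroup_of_Xi_lt_Psi hred hlt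
  have hY : ({x | P.gen x ∈ H} : Set X).Nonempty := by
    by_contra hemp
    rw [Set.not_nonempty_iff_eq_empty, Set.eq_empty_iff_forall_notMem] at hemp
    have h0 : #{x | P.gen x ∈ H} = 0 := by
      rw [card_eq_zero, filter_eq_empty_iff]
      exact fun x _ => hemp x
    rw [edgeCount_subgroup H S hSH, h0] at hSe
    have h2 : (2 : ℝ) ≤ #S := by exact_mod_cast hS2
    have := Psi_nonneg hred
    push_cast at hSe
    nlinarith
  have hle : P.Gp {x | P.gen x ∈ H} ≤ H := by
    refine (Subgroup.closure_le _).2 ?_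
    rintro _ ⟨x, hx, rfl⟩
    exact hx
  have hfin : (H : Set G).Finite := hSH ▸ S.finite_toSet
  have hinf := h _ hY
  exact Set.infinite_coe_iff.1 hinf (hfin.subset hle)

end Minimal

/-! ### Forests of cosets -/

section Cosets

variable {G : Type*} [Group G]

/-- The number of left cosets of `A` which meet `S`. -/
noncomputable def cosetCount (A : Subgroup G) (S : Finset G) : ℕ :=
  #(S.image (QuotientGroup.mk : G → G ⧸ A))

/-- Every finite set of vertices is cut by the cosets of the subgroups `A i` like the vertex set of
a forest of blocks. -/
def IsForestFamily {ι : Type*} [Fintype ι] (A : ι → Subgroup G) : Prop :=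
  ∀ S : Finset G, S.Nonempty → ∑ i, ((#S : ℝ) - cosetCount (A i) S) ≤ #S - 1

/-- Remove a vertex `v` of maximal length. A second vertex of `S` in its coset of `A i` would be
longer than `v` unless `i` is the index `idx v`. So for every other index both #S and the coset
count drop by one, and only one summand can change, by at most 1. -/
theorem isForestFamily_of_length {ι : Type*} [Fintype ι] (A : ι → Subgroup G) (L : G → ℕ)
    (idx : G → Option ι)
    (h : ∀ g i, idx g ≠ some i → ∀ a ∈ A i, a ≠ 1 → L g < L (g * a)) : IsForestFamily A := by
  suffices H : ∀ n, ∀ S : Finset G, #S = n + 1 →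
      ∑ i, ((#S : ℝ) - cosetCount (A i) S) ≤ #S - 1 by
    intro S hS
    exact H (#S - 1) S (by have := hS.card_pos; omega)
  intro n
  induction n with
  | zero =>
    intro S hS
    obtain ⟨g, rfl⟩ := card_eq_one.1 hS
    simp [cosetCount]
  | succ n ih =>
    intro S hS
    obtain ⟨v, hv, hmax⟩ := exists_max_image S L (card_pos.1 (by omega))
    have hcard : #(S.erase v) = n + 1 := by rw [card_erase_of_mem hv]; omega
    have hcard' : (#S : ℝ) = #(S.erase v) + 1 := by rw [hcard, hS]; push_cast; ring
    have hih := ih _ hcard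
    have hins : insert v (S.erase v) = S := insert_erase hv
    have himg : ∀ i, cosetCount (A i) S =
        #(insert (QuotientGroup.mk v : G ⧸ A i) ((S.erase v).image
          (QuotientGroup.mk : G → G ⧸ A i))) := by
      intro i
      rw [cosetCount, ← hins, image_insert, hins]
    have hne : ∀ i, idx v ≠ some i →
        cosetCount (A i) S = cosetCount (A i) (S.erase v) + 1 := by
      intro i hi
      rw [himg, card_insert_of_notMem, cosetCount]
      intro hmem
      obtain ⟨u, hu, huv⟩ := mem_image.1 hmem
      rw [mem_erase] at hu
      have hm : v⁻¹ * u ∈ A i := QuotientGroup.eq.1 huv.symm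
      have h1 : v⁻¹ * u ≠ 1 := fun h1 => hu.1 (inv_mul_eq_one.1 h1).symm
      have h2 := h v i hi _ hm h1
      rw [mul_inv_cancel_left] at h2
      exact absurd (hmax u hu.2) (not_le.2 h2)
    have hge : ∀ i, cosetCount (A i) (S.erase v) ≤ cosetCount (A i) S := fun i =>
      card_le_card (image_subset_image (erase_subset _ _))
    have hle : ∀ i, ((#S : ℝ) - cosetCount (A i) S) ≤
        ((#(S.erase v) : ℝ) - cosetCount (A i) (S.erase v)) + if idx v = some i then 1 else 0 := by
      intro i
      rw [hcard']
      split_ifs with hi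
      · have : (cosetCount (A i) (S.erase v) : ℝ) ≤ cosetCount (A i) S := by exact_mod_cast hge i
        linarith
      · rw [hne i hi]
        push_cast
        linarith
    refine (sum_le_sum fun i _ => hle i).trans ?_
    rw [sum_add_distrib]
    have hlast : ∑ i, (if idx v = some i then (1 : ℝ) else 0) ≤ 1 := by
      rcases hidx : idx v with _ | j
      · simp
      · simp
    linarith

/-- A bound for the blocks of a set of vertices adds up. -/
theorem edgeCount_add_mul_cosetCount_le {A Y : Type*} [Group A] [Fintype Y] (φ : A →* G)
    (hφ : Function.Injective φ) (γ : Y → A) {k s : ℝ}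
    (h : ∀ T : Finset A, T.Nonempty → (edgeCount γ T : ℝ) + k ≤ s * #T) (S : Finset G) :
    (edgeCount (fun y => φ (γ y)) S : ℝ) + k * cosetCount φ.range S ≤ s * #S := by
  have h1 : edgeCount (fun y => φ (γ y)) S = ∑ q ∈ S.image (QuotientGroup.mk : G → G ⧸ φ.range),
      #{e ∈ edgeSet (fun y => φ (γ y)) S | (QuotientGroup.mk e.1 : G ⧸ φ.range) = q} :=
    card_eq_sum_card_fiberwise fun e he =>
      mem_image_of_mem _ (mem_edgeSet.1 he).1
  have h2 : #S = ∑ q ∈ S.image (QuotientGroup.mk : G → G ⧸ φ.range),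
      #{g ∈ S | (QuotientGroup.mk g : G ⧸ φ.range) = q} :=
    card_eq_sum_card_fiberwise fun g hg => mem_image_of_mem _ hg
  rw [h1, h2, cosetCount, mul_comm k, ← nsmul_eq_mul, ← sum_const]
  push_cast
  rw [← sum_add_distrib, mul_sum]
  refine sum_le_sum fun q hq => ?_
  obtain ⟨g₀, hg₀, rfl⟩ := mem_image.1 hq
  have hinj : Function.Injective fun a => g₀ * φ a := fun a b hab => hφ (mul_left_cancel hab)
  -- The block of `S` in the coset of `g₀`, pulled back to `A`.
  set T : Finset A := S.preimage (fun a => g₀ * φ a) hinj.injOn with hT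
  have hmem : ∀ a, a ∈ T ↔ g₀ * φ a ∈ S := fun a => by rw [hT, mem_preimage]
  have hex : ∀ g, (QuotientGroup.mk g : G ⧸ φ.range) = QuotientGroup.mk g₀ →
      ∃ a, g₀ * φ a = g := by
    intro g hg
    obtain ⟨a, ha⟩ := QuotientGroup.eq.1 hg.symm
    exact ⟨a, by rw [ha, mul_inv_cancel_left]⟩
  have hT1 : #T ≤ #{g ∈ S | (QuotientGroup.mk g : G ⧸ φ.range) = QuotientGroup.mk g₀} := by
    refine card_le_card_of_injOn (fun a => g₀ * φ a) ?_ hinj.injOn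
    intro a ha
    rw [mem_coe, mem_filter]
    refine ⟨(hmem a).1 ha, QuotientGroup.eq.2 ⟨a⁻¹, ?_⟩⟩
    simp
  have hT1' : #{g ∈ S | (QuotientGroup.mk g : G ⧸ φ.range) = QuotientGroup.mk g₀} ≤ #T := by
    have : ({g ∈ S | (QuotientGroup.mk g : G ⧸ φ.range) = QuotientGroup.mk g₀} : Finset G) ⊆
        T.image fun a => g₀ * φ a := by
      intro g hg
      rw [mem_filter] at hg
      obtain ⟨a, rfl⟩ := hex g hg.2
      exact mem_image_of_mem _ ((hmem a).2 hg.1)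
    exact (card_le_card this).trans card_image_le
  have hT2 : #{e ∈ edgeSet (fun y => φ (γ y)) S |
      (QuotientGroup.mk e.1 : G ⧸ φ.range) = QuotientGroup.mk g₀} ≤ edgeCount γ T := by
    have : ({e ∈ edgeSet (fun y => φ (γ y)) S |
        (QuotientGroup.mk e.1 : G ⧸ φ.range) = QuotientGroup.mk g₀} : Finset (G × Y)) ⊆
        (edgeSet γ T).image fun e => (g₀ * φ e.1, e.2) := by
      rintro ⟨g, y⟩ hg
      rw [mem_filter, mem_edgeSet] at hg
      obtain ⟨⟨hg1, hg2⟩, hg3⟩ := hg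
      obtain ⟨a, rfl⟩ := hex g hg3
      refine mem_image.2 ⟨(a, y), mem_edgeSet.2 ⟨(hmem a).2 hg1, (hmem _).2 ?_⟩, rfl⟩
      rw [map_mul, ← mul_assoc]
      exact hg2
    exact (card_le_card this).trans card_image_le
  have hTne : T.Nonempty := ⟨1, (hmem 1).2 (by simpa using hg₀)⟩
  have hh := h T hTne
  rw [le_antisymm hT1' hT1]
  have hT2' : (#{e ∈ edgeSet (fun y => φ (γ y)) S |
      (QuotientGroup.mk e.1 : G ⧸ φ.range) = QuotientGroup.mk g₀} : ℝ) ≤ edgeCount γ T := by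
    exact_mod_cast hT2
  linarith

end Cosets

/-! ### Normal forms in free products -/

section Words

variable {ι : Type*} {M : ι → Type*} [∀ i, Group (M i)]

open Monoid

/-- The number of syllables of the normal form. -/
noncomputable def syllables (g : CoprodI M) : ℕ := (CoprodI.Word.equiv g⁻¹).toList.length

/-- The index of the factor of the last syllable of the normal form. -/
noncomputable def lastIdx (g : CoprodI M) : Option ι := (CoprodI.Word.equiv g⁻¹).fstIdx

/-- Words grow at the head, so right multiplication is read off the word of the inverse. This is why
syllables are counted on `g⁻¹`. -/
theorem word_mul_of {g : CoprodI M} {i : ι} (h : (CoprodI.Word.equiv g⁻¹).fstIdx ≠ some i)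
    {a : M i} (ha : a ≠ 1) :
    CoprodI.Word.equiv (g * CoprodI.of a)⁻¹ =
      CoprodI.Word.cons a⁻¹ (CoprodI.Word.equiv g⁻¹) h (inv_ne_one.2 ha) := by
  refine Eq.trans ?_ CoprodI.Word.cons_eq_smul.symm
  rw [mul_inv_rev, ← map_inv]
  exact mul_smul (CoprodI.of a⁻¹) g⁻¹ (CoprodI.Word.empty : CoprodI.Word M)

theorem syllables_mul_of {g : CoprodI M} {i : ι} (h : lastIdx g ≠ some i) {a : M i} (ha : a ≠ 1) :
    syllables (g * CoprodI.of a) = syllables g + 1 := by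
  rw [lastIdx] at h
  rw [syllables, word_mul_of h ha]
  rfl

theorem lastIdx_mul_of {g : CoprodI M} {i : ι} (h : lastIdx g ≠ some i) {a : M i} (ha : a ≠ 1) :
    lastIdx (g * CoprodI.of a) = some i := by
  rw [lastIdx] at h
  rw [lastIdx, word_mul_of h ha, CoprodI.Word.fstIdx_cons]

theorem lastIdx_one : lastIdx (1 : CoprodI M) = none := by
  have : CoprodI.Word.equiv (1 : CoprodI M) = CoprodI.Word.empty :=
    one_smul (CoprodI M) CoprodI.Word.empty
  rw [lastIdx, inv_one, this]
  rfl

theorem isForestFamily_range_of [Fintype ι] :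
    IsForestFamily fun i => (CoprodI.of : M i →* CoprodI M).range := by
  refine isForestFamily_of_length _ syllables lastIdx ?_
  rintro g i hi _ ⟨a, rfl⟩ ha
  rw [syllables_mul_of hi (fun h => ha (by rw [h, map_one]))]
  exact Nat.lt_succ_self _

/-- Lengths are pulled back along an embedding into a free product; this serves free groups and free
products of a group with a free group. -/
theorem isForestFamily_of_leftInverse {G : Type*} [Group G] [Fintype ι] (A : ι → Subgroup G)
    (f : G →* CoprodI M) (hf : Function.Injective f)
    (hA : ∀ i, ∀ a ∈ A i, ∃ b : M i, f a = CoprodI.of b) : IsForestFamily A := by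
  refine isForestFamily_of_length _ (fun g => syllables (f g)) (fun g => lastIdx (f g)) ?_
  intro g i hi a ha ha1
  obtain ⟨b, hb⟩ := hA i a ha
  rw [map_mul, hb, syllables_mul_of hi]
  · exact Nat.lt_succ_self _
  · rintro rfl
    rw [map_one, ← map_one f] at hb
    exact ha1 (hf hb)

/-- The retraction onto one factor kills the other. -/
theorem of_eq_of_iff {i j : ι} (hij : i ≠ j) {a : M i} {b : M j}
    (h : (CoprodI.of a : CoprodI M) = CoprodI.of b) : a = 1 ∧ b = 1 := by
  have key : ∀ {i j : ι} (_ : i ≠ j) {a : M i} {b : M j}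
      (_ : (CoprodI.of a : CoprodI M) = CoprodI.of b), a = 1 := by
    intro i j hij a b h
    have := congrArg (CoprodI.lift (Pi.mulSingle i (MonoidHom.id (M i)))) h
    rw [CoprodI.of_leftInverse i a, CoprodI.lift_of, Pi.mulSingle_eq_of_ne hij.symm] at this
    exact this
  exact ⟨key hij h, key hij.symm h.symm⟩

end Words

/-! ### Combs and trees of combs -/

section Blocks

open Monoid

variable {ι : Type*} {M : ι → Type*} [∀ i, Group (M i)] {Y : Type*} [Fintype Y]
  {γ : Y → CoprodI M}

theorem edgeCount_map_le {A B Z : Type*} [Group A] [Group B] [DecidableEq B] [Fintype Z]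
    {γ : Y → A} {γ' : Z → B} (f : A →* B) (hf : Function.Injective f) (e : Y → Z)
    (he : Function.Injective e)
    (h : ∀ y, f (γ y) = γ' (e y)) (T : Finset A) :
    edgeCount γ T ≤ edgeCount γ' (T.image f) := by
  refine card_le_card_of_injOn (fun q => (f q.1, e q.2)) ?_ ?_
  · rintro ⟨a, y⟩ hq
    rw [mem_coe, mem_edgeSet] at hq ⊢
    refine ⟨mem_image_of_mem _ hq.1, ?_⟩
    dsimp only
    rw [← h, ← map_mul]
    exact mem_image_of_mem _ hq.2
  · rintro ⟨a, y⟩ _ ⟨b, z⟩ _ hab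
    rw [Prod.mk.injEq] at hab
    exact Prod.ext (hf hab.1) (he hab.2)

/-- A copy of `U` in the factor `M j`, with a copy of `T` in the factor `M i` attached at each
vertex of `A`. -/
noncomputable def comb {i j : ι} (U : Finset (M j)) (T : Finset (M i)) (A : Finset (M j)) :
    Finset (CoprodI M) :=
  U.image CoprodI.of ∪ A.biUnion fun u =>
    (CoprodI.of u : CoprodI M) • T.image (CoprodI.of : M i →* CoprodI M)

theorem mem_comb {i j : ι} {U : Finset (M j)} {T : Finset (M i)} {A : Finset (M j)}
    {g : CoprodI M} : g ∈ comb U T A ↔ (∃ u ∈ U, CoprodI.of u = g) ∨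
      ∃ u ∈ A, ∃ t ∈ T, CoprodI.of u * CoprodI.of t = g := by
  simp only [comb, mem_union, mem_image, mem_biUnion, mem_smul_finset, smul_eq_mul]
  constructor
  · rintro (h | ⟨u, hu, _, ⟨t, ht, rfl⟩, rfl⟩)
    · exact Or.inl h
    · exact Or.inr ⟨u, hu, t, ht, rfl⟩
  · rintro (h | ⟨u, hu, t, ht, rfl⟩)
    · exact Or.inl h
    · exact Or.inr ⟨u, hu, _, ⟨t, ht, rfl⟩, rfl⟩

/-- The copy of `T` attached at `u` meets everything built before only in `u`, so it adds #T - 1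
vertices and loses no edges. -/
theorem comb_card_edgeCount {i j : ι} (hij : i ≠ j) (hγ : ∀ y, γ y ≠ 1) {U : Finset (M j)}
    {T : Finset (M i)} (hT1 : 1 ∈ T) {A : Finset (M j)} (hA : A ⊆ U) :
    (#(comb U T A) = #U + #A * (#T - 1)) ∧
      edgeCount γ (U.image (CoprodI.of : M j →* CoprodI M)) +
        #A * edgeCount γ (T.image (CoprodI.of : M i →* CoprodI M)) ≤ edgeCount γ (comb U T A) := by
  induction A using Finset.induction_on with
  | empty =>
    have : comb U T ∅ = U.image (CoprodI.of : M j →* CoprodI M) := by simp [comb]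
    rw [this, card_image_of_injective _ (CoprodI.of_injective j)]
    simp
  | insert u A hu ih =>
    obtain ⟨ih1, ih2⟩ := ih ((subset_insert _ _).trans hA)
    have huU : u ∈ U := hA (mem_insert_self _ _)
    set B := (CoprodI.of u : CoprodI M) • T.image (CoprodI.of : M i →* CoprodI M) with hB
    have hun : comb U T (insert u A) = comb U T A ∪ B := by
      rw [comb, comb, biUnion_insert, union_assoc, union_comm B]
    have hint : comb U T A ∩ B = {(CoprodI.of u : CoprodI M)} := by
      ext g
      rw [mem_inter, mem_singleton]
      constructor
      · rintro ⟨h1, h2⟩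
        obtain ⟨g, hg, rfl⟩ := mem_smul_finset.1 h2
        obtain ⟨t, ht, rfl⟩ := mem_image.1 hg
        rw [smul_eq_mul] at h1 ⊢
        rcases mem_comb.1 h1 with ⟨u', hu', h⟩ | ⟨u', hu', t', ht', h⟩
        · have : (CoprodI.of t : CoprodI M) = CoprodI.of (u⁻¹ * u') := by
            rw [map_mul, h, map_inv, inv_mul_cancel_left]
          rw [(of_eq_of_iff hij this).1, map_one, mul_one]
        · have : (CoprodI.of (t * t'⁻¹) : CoprodI M) = CoprodI.of (u⁻¹ * u') := by
            rw [map_mul, map_mul, map_inv, map_inv, eq_inv_mul_iff_mul_eq, ← mul_assoc, ← h,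
              mul_inv_cancel_right]
          have huu : u = u' := inv_mul_eq_one.1 (of_eq_of_iff hij this).2
          exact (hu (huu ▸ hu')).elim
      · rintro rfl
        refine ⟨mem_comb.2 (Or.inl ⟨u, huU, rfl⟩), ?_⟩
        refine mem_smul_finset.2 ⟨1, mem_image.2 ⟨1, hT1, map_one _⟩, by simp⟩
    have hBc : #B = #T := by
      rw [hB, card_smul_finset, card_image_of_injective _ (CoprodI.of_injective i)]
    have h3 := edgeCount_union_of_inter_singleton hγ hint
    have h4 := card_union_add_card_inter (comb U T A) B
    rw [hint, card_singleton, ih1, hBc, ← hun] at h4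
    rw [hB, edgeCount_smul, ← hB, ← hun] at h3
    have hTpos := card_pos.2 ⟨1, hT1⟩
    rw [card_insert_of_notMem hu]
    constructor
    · have : (#A + 1) * (#T - 1) = #A * (#T - 1) + (#T - 1) := by ring
      omega
    · have : (#A + 1) * edgeCount γ (T.image (CoprodI.of : M i →* CoprodI M)) =
        #A * edgeCount γ (T.image (CoprodI.of : M i →* CoprodI M)) +
          edgeCount γ (T.image (CoprodI.of : M i →* CoprodI M)) := by ring
      omega

/-- Translates of a comb can be glued to each other in single vertices, as often as desired. -/
theorem exists_tree_of_combs {i j : ι} (hij : i ≠ j) (hγ : ∀ y, γ y ≠ 1) {U : Finset (M j)}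
    {T : Finset (M i)} (hU1 : 1 ∈ U) (hT : 2 ≤ #T) (hU : 2 ≤ #U) (n : ℕ) :
    ∃ S : Finset (CoprodI M), #S = 1 + n * (#(comb U T (U.erase 1)) - 1) ∧
      n * edgeCount γ (comb U T (U.erase 1)) ≤ edgeCount γ S ∧
      ∃ v ∈ S, lastIdx v = some i ∧ ∀ u ∈ S, syllables u ≤ syllables v := by
  obtain ⟨t₀, ht₀, ht₀1⟩ := exists_mem_ne hT 1
  obtain ⟨u₀, hu₀, hu₀1⟩ := exists_mem_ne hU 1
  have hone : ∀ k, lastIdx (1 : CoprodI M) ≠ some k := by simp [lastIdx_one]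
  induction n with
  | zero =>
    refine ⟨{CoprodI.of t₀}, by simp, by simp, CoprodI.of t₀, by simp, ?_, by simp⟩
    have := lastIdx_mul_of (hone i) ht₀1
    rwa [one_mul] at this
  | succ n ih =>
    obtain ⟨S, hS1, hS2, v, hv, hvi, hmax⟩ := ih
    set V := comb U T (U.erase 1) with hV
    have hvj : lastIdx v ≠ some j := by
      rw [hvi]
      simpa using hij
    -- The longest vertex `v` ends in factor `i`. No copy of `T` hangs at 1 in the comb, so every
    -- vertex of `v • V` except `v` is strictly longer than `v` and hence new.
    have hlen1 : ∀ u : M j, u ≠ 1 → syllables (v * CoprodI.of u) = syllables v + 1 := fun u hu =>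
      syllables_mul_of hvj hu
    have hidx1 : ∀ u : M j, u ≠ 1 → lastIdx (v * CoprodI.of u) ≠ some i := fun u hu => by
      rw [lastIdx_mul_of hvj hu]
      simpa using hij.symm
    have hlen2 : ∀ u : M j, u ≠ 1 → ∀ t : M i, t ≠ 1 →
        syllables (v * (CoprodI.of u * CoprodI.of t)) = syllables v + 2 := fun u hu t ht => by
      rw [← mul_assoc, syllables_mul_of (hidx1 u hu) ht, hlen1 u hu]
    have hVlen : ∀ g ∈ V, g = 1 ∨
        (syllables v < syllables (v * g) ∧ syllables (v * g) ≤ syllables v + 2) := by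
      intro g hg
      rcases mem_comb.1 hg with ⟨u, hu, rfl⟩ | ⟨u, hu, t, ht, rfl⟩
      · by_cases h1 : u = 1
        · left; rw [h1, map_one]
        · right; rw [hlen1 u h1]; omega
      · right
        have h1 := (mem_erase.1 hu).1
        by_cases h2 : t = 1
        · rw [h2, map_one, mul_one, hlen1 u h1]; omega
        · rw [hlen2 u h1 t h2]; omega
    have h1V : (1 : CoprodI M) ∈ V := mem_comb.2 (Or.inl ⟨1, hU1, map_one _⟩)
    have hint : S ∩ v • V = {v} := by
      ext g
      rw [mem_inter, mem_singleton]
      constructor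
      · rintro ⟨h1, h2⟩
        obtain ⟨g, hg, rfl⟩ := mem_smul_finset.1 h2
        rw [smul_eq_mul] at h1 ⊢
        rcases hVlen g hg with rfl | h
        · exact mul_one v
        · exact absurd (hmax _ h1) (not_le.2 h.1)
      · rintro rfl
        exact ⟨hv, mem_smul_finset.2 ⟨1, h1V, by simp⟩⟩
    have h3 := edgeCount_union_of_inter_singleton hγ hint
    have h4 := card_union_add_card_inter S (v • V)
    rw [hint, card_singleton, hS1, card_smul_finset] at h4
    rw [edgeCount_smul] at h3
    have hVpos := card_pos.2 ⟨1, h1V⟩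
    refine ⟨S ∪ v • V, ?_, ?_, v * (CoprodI.of u₀ * CoprodI.of t₀), ?_, ?_, ?_⟩
    · rw [add_mul, one_mul]
      omega
    · rw [add_mul, one_mul]
      omega
    · refine mem_union_right _ (mem_smul_finset.2 ⟨_, ?_, rfl⟩)
      exact mem_comb.2 (Or.inr ⟨u₀, mem_erase.2 ⟨hu₀1, hu₀⟩, t₀, ht₀, rfl⟩)
    · rw [← mul_assoc, lastIdx_mul_of (hidx1 u₀ hu₀1) ht₀1]
    · intro g hg
      rw [hlen2 u₀ hu₀1 t₀ ht₀1]
      rcases mem_union.1 hg with h | h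
      · exact (hmax g h).trans (by omega)
      · obtain ⟨g, hgV, rfl⟩ := mem_smul_finset.1 h
        rcases hVlen g hgV with rfl | h
        · simp
        · exact h.2

end Blocks

/-! ### The two bounds for a free product -/

section FreeProduct

open Monoid

variable {ι : Type*} {G X : ι → Type*} [∀ i, Group (G i)]
  {P : ∀ i, GroupPresentation (X i) (G i)}

theorem isReduced_freeProd (hred : ∀ i, (P i).IsReduced) : (freeProd P).IsReduced := by
  rintro ⟨i, x⟩ h
  refine hred i x (CoprodI.of_injective i ?_)
  rw [map_one]
  exact h

variable [∀ i, Fintype (X i)]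

theorem edgeCount_factor_add_le (hred : ∀ i, (P i).IsReduced) (i : ι) {p : ℝ}
    (hp : (P i).Psi ≤ p) (S : Finset (CoprodI G)) :
    (edgeCount (fun x => (CoprodI.of ((P i).gen x) : CoprodI G)) S : ℝ) ≤
      (p + 1) * (#S - cosetCount (CoprodI.of : G i →* CoprodI G).range S) := by
  have h := edgeCount_add_mul_cosetCount_le (CoprodI.of : G i →* CoprodI G)
    (CoprodI.of_injective i) (P i).gen (k := p + 1) (s := p + 1) (fun T hT => by
      have h1 := edgeCount_le_Psi (hred i) hT
      have h2 : (1 : ℝ) ≤ #T := by exact_mod_cast hT.card_pos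
      nlinarith) S
  linarith

variable [Fintype ι]

theorem edgeCount_freeProd (S : Finset (CoprodI G)) :
    edgeCount (freeProd P).gen S = ∑ i, edgeCount (fun x => CoprodI.of ((P i).gen x)) S := by
  simp only [edgeCount_eq_sum]
  rw [Fintype.sum_sigma]
  rfl

theorem edgeCount_factor_le (i : ι) (T : Finset (G i)) :
    edgeCount (P i).gen T ≤
      edgeCount (freeProd P).gen (T.image (CoprodI.of : G i →* CoprodI G)) :=
  edgeCount_map_le (γ := (P i).gen) (γ' := (freeProd P).gen) (CoprodI.of : G i →* CoprodI G)
    (CoprodI.of_injective i) (Sigma.mk i) sigma_mk_injective (fun _ => rfl) T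
theorem Psi_freeProd (hred : ∀ i, (P i).IsReduced) (i₁ : ι) (hmax : ∀ i, (P i).Psi ≤ (P i₁).Psi) :
    (freeProd P).Psi = (P i₁).Psi := by
  have h0 := Psi_nonneg (hred i₁)
  refine le_antisymm (Psi_le h0 fun S hS => ?_) ?_
  · rw [edgeCount_freeProd]
    push_cast
    calc ∑ i, (edgeCount (fun x => (CoprodI.of ((P i).gen x) : CoprodI G)) S : ℝ)
        ≤ ∑ i, ((P i₁).Psi + 1) * ((#S : ℝ) -
            cosetCount (CoprodI.of : G i →* CoprodI G).range S) :=
          sum_le_sum fun i _ => edgeCount_factor_add_le hred i (hmax i) S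
      _ ≤ _ := by
          rw [← mul_sum]
          exact mul_le_mul_of_nonneg_left (isForestFamily_range_of S hS) (by linarith)
  · refine Psi_le (Psi_nonneg (isReduced_freeProd hred)) fun T hT => ?_
    have h1 := edgeCount_le_Psi (isReduced_freeProd hred)
      (hT.image (CoprodI.of : G i₁ →* CoprodI G))
    rw [card_image_of_injective _ (CoprodI.of_injective i₁)] at h1
    refine le_trans ?_ h1
    exact_mod_cast edgeCount_factor_le i₁ T

/-- An upper bound for `Ξ` of a free product in terms of the first factor. -/
theorem Xi_freeProd_le (hred : ∀ i, (P i).IsReduced) {i₁ i₂ : ι}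
    (hmax : ∀ i, i ≠ i₁ → (P i).Psi ≤ (P i₂).Psi) {s : ℝ}
    (h : ∀ T : Finset (G i₁), T.Nonempty →
      (edgeCount (P i₁).gen T : ℝ) + (1 + (P i₂).Psi) ≤ s * #T) :
    (freeProd P).Xi ≤ s - 1 := by
  have h0 := Psi_nonneg (hred i₂)
  refine Xi_le fun S hS => ?_
  have h1 := edgeCount_add_mul_cosetCount_le (CoprodI.of : G i₁ →* CoprodI G)
    (CoprodI.of_injective i₁) (P i₁).gen h S
  have h2 := isForestFamily_range_of (M := G) S hS
  have h3 : ∑ i ∈ univ.erase i₁,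
      (edgeCount (fun x => (CoprodI.of ((P i).gen x) : CoprodI G)) S : ℝ) ≤
      ∑ i ∈ univ.erase i₁, ((P i₂).Psi + 1) * ((#S : ℝ) -
            cosetCount (CoprodI.of : G i →* CoprodI G).range S) :=
    sum_le_sum fun i hi => edgeCount_factor_add_le hred i (hmax i (ne_of_mem_erase hi)) S
  rw [edgeCount_freeProd]
  push_cast
  rw [← add_sum_erase _ _ (mem_univ i₁)]
  rw [← add_sum_erase _ _ (mem_univ i₁)] at h2
  rw [← mul_sum] at h3
  -- By the forest inequality the other factors contribute at most (Ψ(G₂) + 1)(N - 1) edges, with N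
  -- the number of cosets of `G₁`. Charging 1 + Ψ(G₂) to each of these cosets leaves one such charge
  -- over, which covers the required 1.
  have h4 : ((P i₂).Psi + 1) * ∑ i ∈ univ.erase i₁, ((#S : ℝ) -
            cosetCount (CoprodI.of : G i →* CoprodI G).range S) ≤ ((P i₂).Psi + 1) *
            (cosetCount (CoprodI.of : G i₁ →* CoprodI G).range S - 1) :=
    mul_le_mul_of_nonneg_left (by linarith) (by linarith)
  linarith

/-- For Ψ = 0 a single edge serves; otherwise a set close to the supremum is translated to contain
1. -/
theorem exists_edgeCount_ge {X G : Type*} [Group G] [Nontrivial G] [Fintype X]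
    {P : GroupPresentation X G} (hred : P.IsReduced) {ε : ℝ} (hε : 0 < ε) :
    ∃ T : Finset G, 1 ∈ T ∧ 2 ≤ #T ∧ (P.Psi + 1 - ε) * (#T - 1) ≤ (edgeCount P.gen T : ℝ) := by
  rcases (Psi_nonneg hred).eq_or_lt with h0 | h0
  · obtain ⟨x, -⟩ := exists_gen_notMem (P := P) (bot_ne_top (α := Subgroup G))
    have hcard : #({1, P.gen x} : Finset G) = 2 := card_pair (hred x).symm
    have he : 1 ≤ edgeCount P.gen {1, P.gen x} :=
      card_pos.2 ⟨(1, x), by simp [mem_edgeSet]⟩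
    have he' : (1 : ℝ) ≤ edgeCount P.gen {1, P.gen x} := by exact_mod_cast he
    refine ⟨{1, P.gen x}, by simp, hcard.ge, ?_⟩
    rw [hcard, ← h0]
    push_cast
    linarith
  · obtain ⟨T, hT, hTe⟩ := exists_lt_edgeCount_of_lt_Psi (P := P) (c := max 0 (P.Psi - ε))
      (le_max_left _ _) (max_lt h0 (by linarith))
    have h1 : (1 : ℝ) ≤ #T := by exact_mod_cast hT.card_pos
    obtain ⟨t, ht⟩ := hT
    refine ⟨t⁻¹ • T, ?_, ?_, ?_⟩
    · have := smul_mem_smul_finset (a := t⁻¹) ht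
      simpa using this
    · rw [card_smul_finset]
      by_contra hlt
      have : #T = 1 := by have := card_pos.2 ⟨t, ht⟩; omega
      obtain ⟨g, rfl⟩ := card_eq_one.1 this
      rw [edgeCount_singleton hred] at hTe
      simp at hTe
    · rw [card_smul_finset, edgeCount_smul]
      refine le_trans ?_ hTe.le
      have := le_max_right 0 (P.Psi - ε)
      refine mul_le_mul_of_nonneg_right ?_ ?_ <;> linarith

/-- A tree of n combs `V` has 1 + n(#V - 1) vertices and at least n e(V) edges. Letting n grow gives
e(V) ≤ (Ξ + 1)(#V - 1), and #V - 1 = (#U - 1) #T. -/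
theorem edgeCount_add_edgeCount_le_Xi (hred : ∀ i, (P i).IsReduced) {i j : ι} (hij : i ≠ j)
    {T : Finset (G i)} {U : Finset (G j)} (hT1 : 1 ∈ T) (hU1 : 1 ∈ U) (hT : 2 ≤ #T)
    (hU : 2 ≤ #U) :
    (edgeCount (P j).gen U : ℝ) + (#U - 1) * edgeCount (P i).gen T ≤
      ((freeProd P).Xi + 1) * ((#U - 1) * #T) := by
  set V := comb U T (U.erase 1) with hV
  set γ := (freeProd P).gen with hγ
  have hγ1 : ∀ y, γ y ≠ 1 := isReduced_freeProd hred
  have hT1' : (1 : ℝ) ≤ #T := by exact_mod_cast card_pos.2 ⟨1, hT1⟩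
  have hU1' : (1 : ℝ) ≤ #U := by exact_mod_cast card_pos.2 ⟨1, hU1⟩
  obtain ⟨hc, he⟩ := comb_card_edgeCount (γ := γ) hij hγ1 hT1 (erase_subset 1 U)
  have hc' : (#V : ℝ) - 1 = (#U - 1) * #T := by
    rw [hV, hc, card_erase_of_mem hU1]
    push_cast [Nat.cast_sub (card_pos.2 ⟨1, hT1⟩), Nat.cast_sub (card_pos.2 ⟨1, hU1⟩)]
    ring
  have he' : (edgeCount (P j).gen U : ℝ) + (#U - 1) * edgeCount (P i).gen T ≤ edgeCount γ V := by
    have h1 : (edgeCount (P j).gen U : ℝ) ≤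
        edgeCount γ (U.image (CoprodI.of : G j →* CoprodI G)) := by
      exact_mod_cast edgeCount_factor_le j U
    have h2 : (edgeCount (P i).gen T : ℝ) ≤
        edgeCount γ (T.image (CoprodI.of : G i →* CoprodI G)) := by
      exact_mod_cast edgeCount_factor_le i T
    have h3 : (edgeCount γ (U.image (CoprodI.of : G j →* CoprodI G)) : ℝ) + (#U - 1) *
        edgeCount γ (T.image (CoprodI.of : G i →* CoprodI G)) ≤ edgeCount γ V := by
      rw [card_erase_of_mem hU1] at he
      have he2 := (Nat.cast_le (α := ℝ)).2 he
      push_cast [Nat.cast_sub (card_pos.2 ⟨1, hU1⟩)] at he2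
      exact he2
    have h4 : ((#U : ℝ) - 1) * edgeCount (P i).gen T ≤ (#U - 1) *
        edgeCount γ (T.image (CoprodI.of : G i →* CoprodI G)) := by
      gcongr
    linarith
  refine he'.trans ?_
  rw [← hc']
  by_contra hlt
  push Not at hlt
  set s := (freeProd P).Xi + 1 with hs
  obtain ⟨n, hn⟩ := exists_nat_gt (s / (edgeCount γ V - s * (#V - 1)))
  rw [div_lt_iff₀ (by linarith)] at hn
  obtain ⟨S, hS1, hS2, v, hv, -⟩ := exists_tree_of_combs (γ := γ) hij hγ1 hU1 hT hU n
  have h5 := edgeCount_add_one_le_Xi (freeProd P) ⟨v, hv⟩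
  have hVpos : 1 ≤ #V := card_pos.2 ⟨1, mem_comb.2 (Or.inl ⟨1, hU1, map_one _⟩)⟩
  have h6 : (#S : ℝ) = 1 + n * (#V - 1) := by
    rw [hS1, ← hV]
    push_cast [Nat.cast_sub hVpos]
    ring
  have h7 : (n : ℝ) * edgeCount γ V ≤ edgeCount γ S := by exact_mod_cast hS2
  rw [h6] at h5
  change (edgeCount γ S : ℝ) + 1 ≤ s * _ at h5
  nlinarith

/-- The lower bound for `Ξ` of a free product in terms of two factors. -/
theorem edgeCount_add_Psi_le_Xi_freeProd [∀ i, Nontrivial (G i)] (hred : ∀ i, (P i).IsReduced)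
    {i j : ι} (hij : i ≠ j) (hPsi : (P j).Psi ≤ (P i).Psi) {T : Finset (G i)} (hT : T.Nonempty) :
    (edgeCount (P i).gen T : ℝ) + (1 + (P j).Psi) ≤ ((freeProd P).Xi + 1) * #T := by
  have key : ∀ T : Finset (G i), 1 ∈ T → 2 ≤ #T →
      (edgeCount (P i).gen T : ℝ) + (1 + (P j).Psi) ≤ ((freeProd P).Xi + 1) * #T := by
    intro T hT1 hT2
    refine le_of_forall_pos_le_add fun ε hε => ?_
    obtain ⟨U, hU1, hU2, hU⟩ := exists_edgeCount_ge (hred j) hε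
    have h := edgeCount_add_edgeCount_le_Xi hred hij hT1 hU1 hT2 hU2
    have h1 : (1 : ℝ) ≤ #U - 1 := by
      have : (2 : ℝ) ≤ #U := by exact_mod_cast hU2
      linarith
    -- Dividing by #U - 1 turns a near-optimal `U` into the summand 1 + Ψ(G_j), up to ε.
    have h2 : ((P j).Psi + 1 - ε + edgeCount (P i).gen T) * (#U - 1) ≤
        (((freeProd P).Xi + 1) * #T) * (#U - 1) := by linarith
    have h3 := le_of_mul_le_mul_right h2 (by linarith)
    linarith
  obtain ⟨t, ht⟩ := hT
  by_cases hT2 : 2 ≤ #T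
  · have := key (t⁻¹ • T) (by simpa using smul_mem_smul_finset (a := t⁻¹) ht)
      (by rwa [card_smul_finset])
    rwa [card_smul_finset, edgeCount_smul] at this
  · have h1 : #T = 1 := by have := card_pos.2 ⟨t, ht⟩; omega
    obtain ⟨g, rfl⟩ := card_eq_one.1 h1
    rw [edgeCount_singleton (hred i), card_singleton]
    -- A single vertex carries no comb. Here a near-optimal set `T'` of the larger factor gives Ξ ≥
    -- Ψ(G_j) directly.
    refine le_of_forall_pos_le_add fun ε hε => ?_
    obtain ⟨T', hT1', hT2', hT'⟩ := exists_edgeCount_ge (hred i) hε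
    have h := key T' hT1' hT2'
    have h2 : (2 : ℝ) ≤ #T' := by exact_mod_cast hT2'
    have h3 : ((P j).Psi + 1 - ε) * (#T' - 1) ≤ ((P i).Psi + 1 - ε) * (#T' - 1) := by
      gcongr
      linarith
    have h4 : ((P j).Psi + 1 - ε) * #T' ≤ ((freeProd P).Xi + 1) * #T' := by linarith
    have h5 := le_of_mul_le_mul_right h4 (by linarith)
    push_cast
    linarith

end FreeProduct

/-! ### Amenable groups -/

section Amenable

theorem finitelyAdditive_biUnion {G : Type*} {μ : Set G → ℝ}
    (hadd : ∀ A B, Disjoint A B → μ (A ∪ B) = μ A + μ B) {κ : Type*} (s : Finset κ)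
    (A : κ → Set G) (hA : ∀ i ∈ s, ∀ j ∈ s, i ≠ j → Disjoint (A i) (A j)) :
    μ (⋃ i ∈ s, A i) = ∑ i ∈ s, μ (A i) := by
  have hempty : μ ∅ = 0 := by
    have := hadd ∅ ∅ (by simp)
    rw [Set.union_empty] at this
    linarith
  induction s using Finset.induction_on with
  | empty => simpa using hempty
  | insert i s hi ih =>
    rw [sum_insert hi, set_biUnion_insert, hadd, ih]
    · exact fun j hj k hk => hA j (mem_insert_of_mem hj) k (mem_insert_of_mem hk)
    · rw [Set.disjoint_iUnion₂_right]
      intro j hj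
      exact hA i (mem_insert_self _ _) j (mem_insert_of_mem hj) (by rintro rfl; exact hi hj)

variable {G : Type*} [Group G]

open scoped ENNReal in
/-- An amenable group has an invariant finitely additive probability measure on all subsets. -/
theorem exists_finitelyAdditive_of_amenable (h : IsAmenableGroup G) : ∃ μ : Set G → ℝ,
    (∀ A, 0 ≤ μ A) ∧ μ Set.univ = 1 ∧ (∀ A B, Disjoint A B → μ (A ∪ B) = μ A + μ B) ∧
      ∀ (g : G) (A : Set G), μ ((fun a => g * a) ⁻¹' A) = μ A := by
  obtain ⟨m, hm, hm1, hinv⟩ := h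
  have hmem : ∀ A : Set G, Memℓp (fun g => if g ∈ A then (1 : ℂ) else 0) ∞ := fun A => by
    refine memℓp_infty ⟨1, ?_⟩
    rintro _ ⟨g, rfl⟩
    dsimp only
    split_ifs <;> simp
  let χ : Set G → lp (fun _ : G => ℂ) ∞ := fun A => ⟨fun g => if g ∈ A then 1 else 0, hmem A⟩
  have hχ : ∀ A g, χ A g = if g ∈ A then (1 : ℂ) else 0 := fun A g => rfl
  have hχ1 : χ Set.univ = 1 := by
    ext g
    rw [hχ, lp.infty_coeFn_one]
    simp
  refine ⟨fun A => (m (χ A)).re, fun A => ?_, ?_, fun A B hAB => ?_, fun g A => ?_⟩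
  -- Positivity of the mean follows from ‖m‖ = m(1) = 1: the real part of m(1 - χ A) is at most 1.
  · have h1 : ‖(1 : lp (fun _ : G => ℂ) ∞) - χ A‖ ≤ 1 := by
      refine lp.norm_le_of_forall_le zero_le_one fun g => ?_
      rw [lp.coeFn_sub, Pi.sub_apply, hχ, lp.infty_coeFn_one, Pi.one_apply]
      split_ifs <;> simp
    have h2 : ‖m (1 - χ A)‖ ≤ 1 := by
      have := m.le_opNorm (1 - χ A)
      rw [hm, one_mul] at this
      exact this.trans h1
    have h3 := (Complex.re_le_norm _).trans h2
    rw [map_sub, hm1, Complex.sub_re, Complex.one_re] at h3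
    linarith
  · dsimp only
    rw [hχ1, hm1, Complex.one_re]
  · have : χ (A ∪ B) = χ A + χ B := by
      ext g
      rw [lp.coeFn_add, Pi.add_apply, hχ, hχ, hχ]
      by_cases hA : g ∈ A
      · simp [hA, Set.disjoint_left.1 hAB hA]
      · simp [hA]
    dsimp only
    rw [this, map_add, Complex.add_re]
  · exact congrArg Complex.re (hinv g _ _ fun a => rfl)

/-- An amenable group has no paradoxical decomposition with finitely many translations. -/
theorem not_injective_of_amenable (h : IsAmenableGroup G) (K : Finset G) (f : G × Bool → G)
    (hf : ∀ p, f p * p.1⁻¹ ∈ K) : ¬ Function.Injective f := by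
  intro hinj
  obtain ⟨μ, hpos, huniv, hadd, hinv⟩ := exists_finitelyAdditive_of_amenable h
  -- For each Boolean the sets `A (b, k)` partition the group. By injectivity of `f` all the
  -- translates k A(b, k) are disjoint, and their total mass would be 2.
  let A : Bool × G → Set G := fun q => {g | f (g, q.1) * g⁻¹ = q.2}
  have h1 : ∀ b, ∑ k ∈ K, μ (A (b, k)) = 1 := by
    intro b
    rw [← finitelyAdditive_biUnion hadd K (fun k => A (b, k)), ← huniv]
    · congr 1
      refine Set.eq_univ_of_forall fun g => ?_
      simp only [Set.mem_iUnion]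
      exact ⟨_, hf (g, b), rfl⟩
    · intro k _ l _ hkl
      rw [Set.disjoint_left]
      intro g hg hg'
      exact hkl (hg.symm.trans hg')
  have h2 : ∑ q ∈ (univ : Finset Bool) ×ˢ K, μ ((fun a => q.2⁻¹ * a) ⁻¹' A q) = 2 := by
    simp only [hinv]
    rw [sum_product]
    simp only [h1]
    simp
  rw [← finitelyAdditive_biUnion hadd] at h2
  · set B := ⋃ q ∈ (univ : Finset Bool) ×ˢ K, (fun a => q.2⁻¹ * a) ⁻¹' A q
    have h3 := hadd B Bᶜ disjoint_compl_right
    rw [Set.union_compl_self, huniv, h2] at h3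
    linarith [hpos Bᶜ]
  · rintro ⟨b, k⟩ _ ⟨c, l⟩ _ hne
    rw [Set.disjoint_left]
    intro g hg hg'
    simp only [A, Set.mem_preimage, Set.mem_ofPred_eq] at hg hg'
    rw [mul_inv_eq_iff_eq_mul, mul_inv_cancel_left] at hg hg'
    have := hinj (hg.trans hg'.symm)
    rw [Prod.mk.injEq] at this
    have hkl : k = l := inv_injective (mul_right_cancel this.1)
    exact hne (by rw [this.2, hkl])

/-- If every `T` at least doubled under `K`, Hall's marriage theorem would supply the injection
excluded by `not_injective_of_amenable`. -/
theorem exists_card_mul_lt_of_amenable (h : IsAmenableGroup G) (K : Finset G) :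
    ∃ T : Finset G, T.Nonempty ∧ #(K * T) < 2 * #T := by
  by_contra hcon
  push Not at hcon
  have hall : ∀ s : Finset (G × Bool), #s ≤ #(s.biUnion fun p => K.image (· * p.1)) := by
    intro s
    rcases s.eq_empty_or_nonempty with rfl | hs
    · simp
    · have h1 : #s ≤ 2 * #(s.image Prod.fst) := by
        have : s ⊆ s.image Prod.fst ×ˢ univ := fun p hp => by
          rw [mem_product]
          exact ⟨mem_image_of_mem _ hp, mem_univ _⟩
        have := card_le_card this
        rw [card_product, card_univ, Fintype.card_bool] at this
        omega
      refine h1.trans ((hcon _ (hs.image _)).trans (card_le_card ?_))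
      intro g hg
      obtain ⟨k, hk, t, ht, rfl⟩ := mem_mul.1 hg
      obtain ⟨p, hp, rfl⟩ := mem_image.1 ht
      exact mem_biUnion.2 ⟨p, hp, mem_image.2 ⟨k, hk, rfl⟩⟩
  obtain ⟨f, hinj, hf⟩ := (all_card_le_biUnion_card_iff_exists_injective _).1 hall
  refine not_injective_of_amenable h K f (fun p => ?_) hinj
  obtain ⟨k, hk, hkp⟩ := mem_image.1 (hf p)
  rw [← hkp, mul_inv_cancel_right]
  exact hk

/-- In the Cayley graph of an amenable group there are finite sets with relatively few outgoing
edges. -/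
theorem le_Xi_of_amenable {X : Type*} [Fintype X] (P : GroupPresentation X G)
    (h : IsAmenableGroup G) : (Fintype.card X : ℝ) - 1 ≤ P.Xi := by
  by_contra hlt
  push Not at hlt
  set n : ℝ := (Fintype.card X : ℝ) with hn
  set d : ℝ := n - 1 - P.Xi with hd
  have hd0 : 0 < d := by linarith
  let B : Finset G := insert 1 (univ.image P.gen)
  -- An edge leaving `T` ends in `T * B \ T`, at most one per label and end point. With Ξ + 1 = n -
  -- d every set therefore expands by 1 + d/n; iteration exceeds the factor 2.
  have hgrow : ∀ T : Finset G, (n + d) * #T ≤ n * #(T * B) := by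
    intro T
    rcases T.eq_empty_or_nonempty with rfl | hT
    · simp
    have hTB : T ⊆ T * B := fun t ht => mem_mul.2 ⟨t, ht, 1, mem_insert_self _ _, mul_one t⟩
    have h1 : ∀ x, #{g ∈ T | g * P.gen x ∉ T} ≤ #(T * B) - #T := by
      intro x
      rw [← card_sdiff_of_subset hTB]
      refine card_le_card_of_injOn (· * P.gen x) ?_ (mul_left_injective _).injOn
      intro g hg
      rw [mem_coe, mem_filter] at hg
      rw [mem_coe, mem_sdiff]
      exact ⟨mul_mem_mul hg.1 (mem_insert_of_mem (mem_image_of_mem _ (mem_univ x))), hg.2⟩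
    have h2 : ∑ x, #{g ∈ T | g * P.gen x ∉ T} + edgeCount P.gen T = Fintype.card X * #T := by
      rw [edgeCount_eq_sum, ← sum_add_distrib]
      rw [sum_congr rfl fun x _ => show #{g ∈ T | g * P.gen x ∉ T} + #{g ∈ T | g * P.gen x ∈ T} = #T
        by rw [add_comm]; exact card_filter_add_card_filter_not _]
      rw [sum_const, card_univ, smul_eq_mul]
    have h3 : ∑ x, #{g ∈ T | g * P.gen x ∉ T} ≤ Fintype.card X * (#(T * B) - #T) := by
      refine (sum_le_sum fun x _ => h1 x).trans ?_
      rw [sum_const, card_univ, smul_eq_mul]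
    have h4 : (Fintype.card X : ℝ) * #T ≤ n * (#(T * B) - #T) + edgeCount P.gen T := by
      rw [← Nat.cast_sub (card_le_card hTB), hn]
      exact_mod_cast (h2 ▸ Nat.add_le_add_right h3 _)
    have h5 := edgeCount_add_one_le_Xi P hT
    rw [← hn] at h4
    have h6 : P.Xi + 1 = n - d := by rw [hd]; ring
    rw [h6] at h5
    linarith
  have hn0 : 0 < n := by
    have h1 := hgrow {1}
    have h2 : (0 : ℝ) ≤ n := by positivity
    rcases h2.eq_or_lt with h3 | h3
    · rw [← h3] at h1
      simp at h1
      linarith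
    · exact h3
  have hgrow' : ∀ (k : ℕ) (T : Finset G), (1 + d / n) ^ k * #T ≤ #(T * B ^ k) := by
    intro k
    induction k with
    | zero => intro T; simp
    | succ k ih =>
      intro T
      have h1 := ih (T * B)
      rw [mul_assoc, ← pow_succ'] at h1
      refine le_trans ?_ h1
      rw [pow_succ, mul_assoc]
      gcongr
      have h2 : 1 + d / n = (n + d) / n := by field_simp
      rw [h2, div_mul_eq_mul_div, div_le_iff₀ hn0, mul_comm (#(T * B) : ℝ)]
      exact hgrow T
  obtain ⟨k, hk⟩ := pow_unbounded_of_one_lt (2 : ℝ) (show 1 < 1 + d / n by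
    have : 0 < d / n := div_pos hd0 hn0
    linarith)
  -- Inversion exchanges growth on the right with multiplication on the left.
  obtain ⟨T, hT, hlt2⟩ := exists_card_mul_lt_of_amenable h (B ^ k)⁻¹
  have h1 := hgrow' k T⁻¹
  rw [← card_inv (T⁻¹ * B ^ k), mul_inv_rev, inv_inv, card_inv] at h1
  have h2 : (#((B ^ k)⁻¹ * T) : ℝ) < 2 * #T := by exact_mod_cast hlt2
  have h3 : (0 : ℝ) < #T := by exact_mod_cast hT.card_pos
  have h4 : (2 : ℝ) * #T ≤ (1 + d / n) ^ k * #T := by gcongr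
  linarith

end Amenable

/-! ### Reduced walks between cosets of a finite subgroup -/

section ReducedWalks

variable {G Z : Type*} [Group G] {H : Subgroup G} (γ : Z → G)

/-- The element of `G` named by a letter: an element of `H` followed by a generator or its
inverse. -/
def letter (p : H × Z × Bool) : G := p.1 * if p.2.2 then γ p.2.1 else (γ p.2.1)⁻¹

/-- No letter cancels against the one before it. -/
def IsReducedWalk (l : List (H × Z × Bool)) : Prop :=
  l.IsChain fun p q => ¬ (q.1 = 1 ∧ p.2.1 = q.2.1 ∧ p.2.2 ≠ q.2.2)

variable {γ} [Fintype Z]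

/-- If the edges between the cosets of a finite subgroup `H` form a forest, then a reduced walk
does not return to `H`. -/
theorem prod_notMem_of_isReducedWalk {T₀ : Finset G} (hT₀ : (T₀ : Set G) = H)
    (hforest : ∀ S : Finset G, S.Nonempty → (∀ g ∈ S, ∀ h ∈ H, g * h ∈ S) →
      #T₀ * (edgeCount γ S + 1) ≤ #S) :
    ∀ l : List (H × Z × Bool), l ≠ [] → IsReducedWalk l → (l.map (letter γ)).prod ∉ H := by
  have hmemT₀ : ∀ g, g ∈ T₀ ↔ g ∈ H := fun g => by rw [← mem_coe, hT₀, SetLike.mem_coe]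
  suffices hs : ∀ m, ∀ l : List (H × Z × Bool), l.length = m → l ≠ [] → IsReducedWalk l →
      (l.map (letter γ)).prod ∉ H from fun l => hs _ l rfl
  intro m
  induction m using Nat.strong_induction_on with
  | _ m ih =>
  intro l hlen hne hred hmem
  have hm0 : 0 < m := by
    rw [← hlen]
    exact List.length_pos_iff.2 hne
  let p : ℕ → G := fun i => ((l.take i).map (letter γ)).prod
  have hp0 : p 0 = 1 := by simp [p]
  have hpm : p m ∈ H := by
    change ((l.take m).map (letter γ)).prod ∈ H
    rwa [← hlen, List.take_length]
  -- By induction no proper subwalk closes up, so a closed reduced walk of length m visits m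
  -- distinct cosets. It also uses m distinct edges, one more than a forest on m cosets can have.
  have hinfix : ∀ i j, i < j → j ≤ m → (0 < i ∨ j < m) → (p i)⁻¹ * p j ∉ H := by
    intro i j hij hj hproper
    have hsplit : l.take j = l.take i ++ (l.take j).drop i := by
      conv_lhs => rw [← List.take_append_drop i (l.take j)]
      rw [List.take_take, min_eq_left hij.le]
    have hprod : p j = p i * (((l.take j).drop i).map (letter γ)).prod := by
      change ((l.take j).map (letter γ)).prod = _
      rw [hsplit, List.map_append, List.prod_append, ← hsplit]
    rw [hprod, inv_mul_cancel_left]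
    have hl : ((l.take j).drop i).length = j - i := by
      rw [List.length_drop, List.length_take]
      omega
    refine ih (j - i) (by omega) _ hl ?_ ((hred.take j).drop i)
    intro h
    rw [h, List.length_nil] at hl
    omega
  have hstep : ∀ i : Fin m, p (i + 1) = p i * letter γ (l[i.1]'(hlen ▸ i.2)) := by
    intro i
    have : l.take (i + 1) = l.take i ++ [l[i.1]'(hlen ▸ i.2)] := by
      rw [List.take_append_getElem]
    simp only [p, this, List.map_append, List.prod_append, List.map_cons, List.map_nil,
      List.prod_cons, List.prod_nil, mul_one]
  let S : Finset G := (range m).biUnion fun i => p i • T₀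
  have hS : ∀ i ≤ m, ∀ h ∈ H, p i * h ∈ S := by
    intro i hi h hh
    rcases hi.eq_or_lt with rfl | hi
    · refine mem_biUnion.2 ⟨0, mem_range.2 hm0, mem_smul_finset.2 ⟨p i * h, ?_, ?_⟩⟩
      · exact (hmemT₀ _).2 (H.mul_mem hpm hh)
      · rw [hp0, one_smul]
    · exact mem_biUnion.2 ⟨i, mem_range.2 hi, mem_smul_finset.2 ⟨h, (hmemT₀ _).2 hh, rfl⟩⟩
  have hScl : ∀ g ∈ S, ∀ h ∈ H, g * h ∈ S := by
    intro g hg h hh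
    obtain ⟨i, hi, hg⟩ := mem_biUnion.1 hg
    obtain ⟨h', hh', rfl⟩ := mem_smul_finset.1 hg
    rw [smul_eq_mul, mul_assoc]
    exact hS i (mem_range.1 hi).le _ (H.mul_mem ((hmemT₀ _).1 hh') hh)
  have hScard : #S = m * #T₀ := by
    rw [card_biUnion]
    · simp [card_smul_finset]
    · have key : ∀ i j, i < j → j < m → Disjoint (p i • T₀) (p j • T₀) := by
        intro i j hij hj
        rw [disjoint_left]
        rintro g hg hg'
        obtain ⟨h, hh, rfl⟩ := mem_smul_finset.1 hg
        obtain ⟨h', hh', heq⟩ := mem_smul_finset.1 hg'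
        rw [smul_eq_mul, smul_eq_mul] at heq
        refine hinfix i j hij hj.le (Or.inr hj) ?_
        have : (p i)⁻¹ * p j = h * h'⁻¹ := by
          rw [inv_mul_eq_iff_eq_mul, ← mul_assoc, ← heq, mul_inv_cancel_right]
        rw [this]
        exact H.mul_mem ((hmemT₀ _).1 hh) (H.inv_mem ((hmemT₀ _).1 hh'))
      intro i hi j hj hij
      rcases lt_or_gt_of_ne hij with h | h
      · exact key i j h (mem_range.1 hj)
      · exact (key j i h (mem_range.1 hi)).symm
  have hSne : S.Nonempty := ⟨_, hS 0 (Nat.zero_le _) 1 H.one_mem⟩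
  let c : Fin m → H × Z × Bool := fun i => l[i.1]'(hlen ▸ i.2)
  let E : Fin m → G × Z := fun i =>
    (if (c i).2.2 then p i * (c i).1 else p (i + 1), (c i).2.1)
  have hstep_pos : ∀ i, (c i).2.2 = true → p (i + 1) = p i * (c i).1 * γ (c i).2.1 := by
    intro i hi
    have : letter γ (c i) = (c i).1 * γ (c i).2.1 := by rw [letter, if_pos hi]
    rw [hstep i, mul_assoc, ← this]
  have hstep_neg : ∀ i, (c i).2.2 = false → p (i + 1) * γ (c i).2.1 = p i * (c i).1 := by
    intro i hi
    have : letter γ (c i) = (c i).1 * (γ (c i).2.1)⁻¹ := by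
      rw [letter, if_neg (by simp [hi])]
    rw [hstep i]
    change p i * letter γ (c i) * _ = _
    rw [this, ← mul_assoc, inv_mul_cancel_right]
  have hEmem : ∀ i, E i ∈ edgeSet γ S := by
    intro i
    rw [mem_edgeSet]
    have h1 := hS i i.2.le (c i).1 (c i).1.2
    have h2 := hS (i + 1) i.2 1 H.one_mem
    rw [mul_one] at h2
    rcases hb : (c i).2.2
    · refine ⟨by simpa [E, hb] using h2, ?_⟩
      simp only [E, hb]
      rw [if_neg Bool.false_ne_true, hstep_neg i hb]
      exact h1
    · refine ⟨by simpa [E, hb] using h1, ?_⟩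
      simp only [E, hb, if_true]
      rw [← hstep_pos i hb]
      exact h2
  -- Traversing an edge backwards would happen in consecutive steps, and that is a cancellation.
  have hback : ∀ i j : Fin m, i < j → (c i).2.1 = (c j).2.1 → (c i).2.2 ≠ (c j).2.2 →
      p (i + 1) ≠ p j * (c j).1 := by
    intro i j hij hz hb heq
    have hmemH : (p (i + 1))⁻¹ * p j ∈ H := by
      rw [heq, mul_inv_rev, inv_mul_cancel_right]
      exact H.inv_mem (c j).1.2
    have hji : j.1 = i.1 + 1 := by
      by_contra hne'
      exact hinfix (i + 1) j (by have : i.1 < j.1 := hij; omega) j.2.le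
        (Or.inl (Nat.succ_pos _)) hmemH
    have h1 : (c j).1 = 1 := by
      rw [hji] at heq
      exact Subtype.ext (mul_eq_left.1 heq.symm)
    have hch := List.isChain_iff_getElem.1 hred i.1 (by rw [hlen, ← hji]; exact j.2)
    apply hch
    have hcj : c j = l[i.1 + 1]'(by rw [hlen, ← hji]; exact j.2) := by
      simp only [c, hji]
    rw [← hcj]
    exact ⟨h1, hz, hb⟩
  have hEinj : Function.Injective E := by
    have key : ∀ i j : Fin m, i < j → E i ≠ E j := by
      intro i j hij heq
      simp only [E, Prod.mk.injEq] at heq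
      obtain ⟨heq, hz⟩ := heq
      rcases hbi : (c i).2.2 <;> rcases hbj : (c j).2.2 <;> simp only [hbi, hbj, if_true,
        Bool.false_eq_true, if_false] at heq
      · refine hinfix (i + 1) (j + 1) (Nat.succ_lt_succ hij) j.2 (Or.inl (Nat.succ_pos _)) ?_
        rw [heq, inv_mul_cancel]
        exact H.one_mem
      · exact hback i j hij hz (by simp [hbi, hbj]) heq
      · refine hback i j hij hz (by simp [hbi, hbj]) ?_
        rw [hstep_pos i hbi, heq, hz, hstep_neg j hbj]
      · refine hinfix i j hij j.2.le (Or.inr j.2) ?_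
        have : (p i)⁻¹ * p j = (c i).1 * ((c j).1 : G)⁻¹ := by
          rw [inv_mul_eq_iff_eq_mul, ← mul_assoc, heq, mul_inv_cancel_right]
        rw [this]
        exact H.mul_mem (c i).1.2 (H.inv_mem (c j).1.2)
    intro i j hij
    by_contra hne'
    rcases lt_or_gt_of_ne hne' with h | h
    · exact key i j h hij
    · exact key j i h hij.symm
  have hcount : m ≤ edgeCount γ S := by
    have := card_le_card_of_injOn (s := (univ : Finset (Fin m))) (t := edgeSet γ S) E
      (fun i _ => hEmem i) hEinj.injOn
    rwa [card_univ, Fintype.card_fin] at this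
  have h1 := hforest S hSne hScl
  have h2 : 0 < #T₀ := card_pos.2 ⟨1, (hmemT₀ 1).2 H.one_mem⟩
  rw [hScard] at h1
  nlinarith

end ReducedWalks

/-! ### Ψ = 0 characterizes free groups -/

section Free

variable {X G : Type*} [Group G] {P : GroupPresentation X G} [Fintype X]

/-- Ψ = 0 says that the Cayley graph is a forest. With the trivial subgroup as `H`, a non-empty
reduced word does not return to 1. -/
theorem isFree_of_Psi_eq_zero (hred : P.IsReduced) (h : P.Psi = 0) : P.IsFree := by
  have hsurj : Function.Surjective (FreeGroup.lift P.gen) := by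
    rw [← MonoidHom.range_eq_top, FreeGroup.range_lift_eq_closure, P.closure_gen]
  refine ⟨(injective_iff_map_eq_one _).2 fun w hw => ?_, hsurj⟩
  by_contra hne
  have hwalk := prod_notMem_of_isReducedWalk (H := (⊥ : Subgroup G)) (γ := P.gen) (T₀ := {1})
    (by simp) (fun S hS _ => by
      have := edgeCount_le_Psi hred hS
      rw [h, zero_add, one_mul] at this
      rw [card_singleton, one_mul]
      have h2 : (edgeCount P.gen S : ℝ) + 1 ≤ #S := by linarith
      exact_mod_cast h2) (w.toWord.map fun p => (1, p.1, p.2)) (by simpa using hne) ?_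
  · apply hwalk
    rw [Subgroup.mem_bot, ← hw]
    conv_rhs => rw [← FreeGroup.mk_toWord (x := w), FreeGroup.lift_mk]
    rw [List.map_map]
    congr 1
    refine List.map_congr_left fun p _ => ?_
    rcases p with ⟨x, _ | _⟩ <;> simp [letter]
  · have := FreeGroup.isReduced_toWord (x := w)
    rw [IsReducedWalk, List.isChain_map]
    refine List.IsChain.imp ?_ this
    intro p q hpq hcon
    exact hcon.2.2 (hpq hcon.2.1)

theorem edgeCount_eq_add_compl (γ : X → G) (Y : Set X) (S : Finset G) :
    edgeCount γ S = edgeCount (fun y : Y => γ y) S +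
      edgeCount (fun z : (Yᶜ : Set X) => γ z) S := by
  simp only [edgeCount_eq_sum]
  rw [← Fintype.sum_subtype_add_sum_subtype (fun x => x ∈ Y)]
  rfl

theorem edgeCount_of_closed {Y : Type*} [Fintype Y] (γ : Y → G) {S : Finset G}
    (h : ∀ g ∈ S, ∀ y, g * γ y ∈ S) : edgeCount γ S = Fintype.card Y * #S := by
  rw [edgeCount_eq_sum, sum_congr rfl fun y _ => show #{g ∈ S | g * γ y ∈ S} = #S by
    rw [filter_true_of_mem fun g hg => h g hg y], sum_const, card_univ, smul_eq_mul]

/-- An element of infinite order moves every finite set of vertices. -/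
theorem edgeCount_unit_add_one_le {a : G} (ha : ¬ IsOfFinOrder a) {S : Finset G}
    (hS : S.Nonempty) : edgeCount (fun _ : Unit => a) S + 1 ≤ #S := by
  by_cases hcl : ∀ g ∈ S, ∀ _ : Unit, g * a ∈ S
  · exfalso
    obtain ⟨g, hg⟩ := hS
    have hmem : ∀ n : ℕ, g * a ^ n ∈ S := by
      intro n
      induction n with
      | zero => simpa using hg
      | succ n ih =>
        rw [pow_succ, ← mul_assoc]
        exact hcl _ ih ()
    have hinj : Function.Injective fun n : ℕ => g * a ^ n := fun m n hmn =>
      (injective_pow_iff_not_isOfFinOrder.2 ha) (mul_left_cancel hmn)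
    exact Set.infinite_of_injective_forall_mem hinj hmem S.finite_toSet
  · push Not at hcl
    obtain ⟨g, hg, u, hu⟩ := hcl
    simpa using edgeCount_add_one_le (γ := fun _ : Unit => a) (x := u) hg hu

theorem edgeCount_unit_add_cosetCount_le {a : G} (ha : ¬ IsOfFinOrder a) (S : Finset G) :
    (edgeCount (fun _ : Unit => a) S : ℝ) + cosetCount (Subgroup.zpowers a) S ≤ #S := by
  have hord : ¬ IsOfFinOrder (⟨a, Subgroup.mem_zpowers a⟩ : Subgroup.zpowers a) := fun h =>
    ha ((Subgroup.zpowers a).subtype.isOfFinOrder h)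
  have h1 := edgeCount_add_mul_cosetCount_le (Subgroup.zpowers a).subtype
    (Subgroup.zpowers a).subtype_injective
    (fun _ : Unit => (⟨a, Subgroup.mem_zpowers a⟩ : Subgroup.zpowers a)) (k := 1) (s := 1)
    (fun T hT => by
      rw [one_mul]
      exact_mod_cast edgeCount_unit_add_one_le hord hT) S
  rw [Subgroup.range_subtype, one_mul, one_mul] at h1
  exact h1

theorem edgeCount_eq_sum_unit {Y : Type*} [Fintype Y] (γ : Y → G) (S : Finset G) :
    edgeCount γ S = ∑ y, edgeCount (fun _ : Unit => γ y) S := by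
  simp [edgeCount_eq_sum]

/-- The cyclic groups generated by the basis form a forest family. A finite set loses at least one
edge in each coset of each of them, and summation gives e(S) ≤ #S - 1. -/
theorem Psi_eq_zero_of_isFree (hred : P.IsReduced) (h : P.IsFree) : P.Psi = 0 := by
  let e : FreeGroup X ≃* G := MulEquiv.ofBijective _ h
  have he : ∀ x, e (FreeGroup.of x) = P.gen x := fun x => FreeGroup.lift_apply_of
  have he' : ∀ x, e.symm (P.gen x) = FreeGroup.of x := fun x => by rw [← he, e.symm_apply_apply]
  let A : X → Subgroup G := fun x => Subgroup.zpowers (P.gen x)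
  let F : FreeGroup X →* Monoid.CoprodI fun x => A x :=
    FreeGroup.lift fun x => Monoid.CoprodI.of (M := fun x => A x) (i := x)
      ⟨P.gen x, Subgroup.mem_zpowers _⟩
  let f : G →* Monoid.CoprodI fun x => A x := F.comp e.symm.toMonoidHom
  have hf : ∀ x, f (P.gen x) = Monoid.CoprodI.of (M := fun x => A x) (i := x)
      ⟨P.gen x, Subgroup.mem_zpowers _⟩ := by
    intro x
    change F (e.symm (P.gen x)) = _
    rw [he']
    exact FreeGroup.lift_apply_of
  have hinv : ((Monoid.CoprodI.lift fun x => (A x).subtype).comp F) = e.toMonoidHom := by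
    ext x
    simp only [MonoidHom.comp_apply, F, FreeGroup.lift_apply_of, Monoid.CoprodI.lift_of]
    exact (he x).symm
  have hfinj : Function.Injective f := by
    have : Function.LeftInverse (Monoid.CoprodI.lift fun x => (A x).subtype) f := fun g => by
      have := DFunLike.congr_fun hinv (e.symm g)
      rw [MonoidHom.comp_apply] at this
      refine this.trans (e.apply_symm_apply g)
    exact this.injective
  have hforest : IsForestFamily A := isForestFamily_of_leftInverse A f hfinj <| by
    rintro x _ ⟨k, rfl⟩
    exact ⟨⟨P.gen x, Subgroup.mem_zpowers _⟩ ^ k, by simp only [map_zpow, hf]⟩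
  refine le_antisymm (Psi_le le_rfl fun S hS => ?_) (Psi_nonneg hred)
  have hord : ∀ x, ¬ IsOfFinOrder (P.gen x) := fun x hx => by
    have := e.symm.toMonoidHom.isOfFinOrder hx
    change IsOfFinOrder (e.symm (P.gen x)) at this
    rw [he'] at this
    exact not_isOfFinOrder_of_isMulTorsionFree (FreeGroup.of_ne_one x) this
  rw [zero_add, one_mul, edgeCount_eq_sum_unit]
  push_cast
  refine (sum_le_sum fun x _ => ?_).trans (hforest S hS)
  have : (edgeCount (fun _ : Unit => P.gen x) S : ℝ) + cosetCount (A x) S ≤ #S :=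
    edgeCount_unit_add_cosetCount_le (hord x) S
  linarith

end Free

/-! ### The group C₂ * F and the inequality Ψ ≤ 2Ξ -/

section OrderTwo

open Monoid

variable {X G : Type*} [Group G] {P : GroupPresentation X G}

/-- Left multiplication by an element of `H` or by one letter preserves this shape, after at most
one cancellation. Uniqueness is not needed. -/
theorem exists_reducedWalk {G : Type*} [Group G] (H : Subgroup G) (Z : Type*)
    (w : Coprod H (FreeGroup Z)) :
    ∃ (l : List (H × Z × Bool)) (h : H), IsReducedWalk l ∧
      w = (l.map fun p => Coprod.inl p.1 * Coprod.inr (FreeGroup.mk [p.2])).prod *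
        Coprod.inl h := by
  let F : List (H × Z × Bool) → Coprod H (FreeGroup Z) := fun l =>
    (l.map fun p => Coprod.inl p.1 * Coprod.inr (FreeGroup.mk [p.2])).prod
  have hcons : ∀ p l, F (p :: l) = Coprod.inl p.1 * Coprod.inr (FreeGroup.mk [p.2]) * F l :=
    fun p l => by simp [F]
  let Q : Coprod H (FreeGroup Z) → Prop := fun x => ∀ (l : List (H × Z × Bool)) (h : H),
    IsReducedWalk l → ∃ (l' : List (H × Z × Bool)) (h' : H), IsReducedWalk l' ∧
      x * (F l * Coprod.inl h) = F l' * Coprod.inl h'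
  have hmul : ∀ x y, Q x → Q y → Q (x * y) := by
    intro x y hx hy l h hl
    obtain ⟨l', h', hl', he'⟩ := hy l h hl
    obtain ⟨l'', h'', hl'', he''⟩ := hx l' h' hl'
    exact ⟨l'', h'', hl'', by rw [mul_assoc, he', he'']⟩
  have hinl : ∀ a : H, Q (Coprod.inl a) := by
    intro a l h hl
    cases l with
    | nil => exact ⟨[], a * h, List.isChain_nil, by simp [F]⟩
    | cons p l =>
      refine ⟨(a * p.1, p.2) :: l, h, ?_, by simp only [hcons, map_mul, mul_assoc]⟩
      rw [IsReducedWalk, List.isChain_cons] at hl ⊢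
      exact hl
  have hletter : ∀ z b, Q (Coprod.inr (FreeGroup.mk [(z, b)])) := by
    intro z b l h hl
    by_cases hcase : IsReducedWalk ((1, z, b) :: l)
    · exact ⟨_, h, hcase, by simp [hcons, mul_assoc]⟩
    · cases l with
      | nil => exact (hcase (List.isChain_singleton _)).elim
      | cons p l =>
        rw [IsReducedWalk, List.isChain_cons_cons] at hcase
        have hp : p.1 = 1 ∧ z = p.2.1 ∧ b ≠ p.2.2 := by
          by_contra hcon
          exact hcase ⟨hcon, hl⟩
        obtain ⟨a, z', b'⟩ := p
        obtain ⟨h1, h2, h3⟩ := hp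
        dsimp only at h1 h2 h3
        subst h1 h2
        have hb : b' = !b := by cases b <;> cases b' <;> simp_all
        subst hb
        refine ⟨l, h, hl.tail, ?_⟩
        have hcancel : (Coprod.inr (FreeGroup.mk [(z, b)]) : Coprod H (FreeGroup Z)) *
            Coprod.inr (FreeGroup.mk [(z, !b)]) = 1 := by
          rw [← map_mul]
          have : FreeGroup.mk [(z, !b)] = (FreeGroup.mk [(z, b)])⁻¹ := by
            simp [FreeGroup.inv_mk, FreeGroup.invRev]
          rw [this, mul_inv_cancel, map_one]
        rw [hcons, map_one, one_mul, mul_assoc, ← mul_assoc (Coprod.inr _) (Coprod.inr _), hcancel,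
          one_mul]
  have hinr : ∀ u : FreeGroup Z, Q (Coprod.inr u) := by
    intro u
    have : Q (Coprod.inr (FreeGroup.mk u.toWord)) := by
      induction u.toWord with
      | nil =>
        intro l h hl
        exact ⟨l, h, hl, by rw [← FreeGroup.one_eq_mk, map_one, one_mul]⟩
      | cons p L ih =>
        have hp : FreeGroup.mk (p :: L) = FreeGroup.mk [p] * FreeGroup.mk L := by
          simp [FreeGroup.mul_mk]
        rw [hp, map_mul]
        exact hmul _ _ (hletter p.1 p.2) ih
    rwa [FreeGroup.mk_toWord] at this
  have hQ : Q w := by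
    induction w using Coprod.induction_on with
    | inl a => exact hinl a
    | inr u => exact hinr u
    | mul x y hx hy => exact hmul x y hx hy
  obtain ⟨l, h, hl, he⟩ := hQ [] 1 List.isChain_nil
  exact ⟨l, h, hl, by simpa [F] using he⟩

variable [Fintype X]

/-- On a union of cosets of `H` the generators in `H` take up all their possible edges. The bound
leaves 2(e + 1) ≤ #S for the other generators, so their edges form a forest on the cosets. -/
theorem isOrderTwoFreeProdFree_of_bound (hred : P.IsReduced) {H : Subgroup G} {S₀ : Finset G}
    (hSH : (S₀ : Set G) = H) (hcard : #S₀ = 2) (hpos : 0 < #{x | P.gen x ∈ H})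
    (hbound : ∀ T : Finset G, T.Nonempty →
      (edgeCount P.gen T : ℝ) + 1 ≤ (#{x | P.gen x ∈ H} + 1 / 2) * #T) :
    P.IsOrderTwoFreeProdFree := by
  set Y : Set X := {x | P.gen x ∈ H} with hY
  have hmem : ∀ g, g ∈ S₀ ↔ g ∈ H := fun g => by rw [← mem_coe, hSH, SetLike.mem_coe]
  have hle : P.Gp Y ≤ H := by
    refine (Subgroup.closure_le _).2 ?_
    rintro _ ⟨x, hx, rfl⟩
    exact hx
  obtain ⟨x₀, hx₀⟩ := card_pos.1 hpos
  have hx₀' : P.gen x₀ ∈ H := (mem_filter.1 hx₀).2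
  have hS₀ : S₀ = {1, P.gen x₀} := by
    symm
    refine eq_of_subset_of_card_le ?_ ?_
    · intro g hg
      rcases mem_insert.1 hg with rfl | hg
      · exact (hmem _).2 H.one_mem
      · rw [mem_singleton.1 hg]
        exact (hmem _).2 hx₀'
    · rw [hcard, card_pair (hred x₀).symm]
  have hGp : P.Gp Y = H := by
    refine le_antisymm hle fun g hg => ?_
    rw [← hmem, hS₀, mem_insert, mem_singleton] at hg
    rcases hg with rfl | rfl
    · exact one_mem _
    · exact Subgroup.subset_closure ⟨x₀, hx₀', rfl⟩
  refine ⟨Y, ?_, ?_⟩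
  · rw [hGp, ← hcard]
    have : Nat.card H = Nat.card ((S₀ : Set G) : Type _) := by rw [hSH]; rfl
    rw [this]
    simp
  · have hYcard : Fintype.card Y = #{x | P.gen x ∈ H} := by
      rw [Fintype.card_subtype]
      rfl
    have hwalk := prod_notMem_of_isReducedWalk (H := P.Gp Y)
      (γ := fun z : (Yᶜ : Set X) => P.gen z) (T₀ := S₀) (by rw [hSH, hGp]) (fun S hS hcl => by
        have h1 := hbound S hS
        rw [edgeCount_eq_add_compl P.gen Y, edgeCount_of_closed (fun y : Y => P.gen y)
          (fun g hg y => hcl g hg _ (Subgroup.subset_closure ⟨y, y.2, rfl⟩)), hYcard] at h1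
        push_cast at h1
        rw [hcard]
        have h2 : (2 : ℝ) * (edgeCount (fun z : (Yᶜ : Set X) => P.gen z) S + 1) ≤ #S := by
          linarith
        exact_mod_cast h2)
    have hval : ∀ l : List (P.Gp Y × (Yᶜ : Set X) × Bool),
        Coprod.lift (P.Gp Y).subtype (FreeGroup.lift fun z : (Yᶜ : Set X) => P.gen z)
          (l.map fun p => Coprod.inl p.1 * Coprod.inr (FreeGroup.mk [p.2])).prod =
        (l.map (letter fun z : (Yᶜ : Set X) => P.gen z)).prod := by
      intro l
      rw [map_list_prod, List.map_map]
      congr 1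
      refine List.map_congr_left fun p _ => ?_
      rcases p with ⟨a, z, _ | _⟩ <;> simp [letter]
    constructor
    · rw [injective_iff_map_eq_one]
      intro w hw
      obtain ⟨l, h, hl, rfl⟩ := exists_reducedWalk (P.Gp Y) (Yᶜ : Set X) w
      rw [map_mul, hval, Coprod.lift_apply_inl] at hw
      have hlH : (l.map (letter fun z : (Yᶜ : Set X) => P.gen z)).prod ∈ P.Gp Y := by
        rw [eq_inv_of_mul_eq_one_left hw]
        exact inv_mem h.2
      have hnil : l = [] := by
        by_contra hne
        exact hwalk l hne hl hlH
      subst hnil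
      have h1 : h = 1 := by
        rw [List.map_nil, List.prod_nil, one_mul] at hw
        exact Subtype.ext hw
      simp [h1]
    · rw [← MonoidHom.range_eq_top, eq_top_iff, ← P.closure_gen, Subgroup.closure_le]
      rintro _ ⟨x, rfl⟩
      by_cases hx : x ∈ Y
      · exact ⟨Coprod.inl ⟨P.gen x, Subgroup.subset_closure ⟨x, hx, rfl⟩⟩, by simp⟩
      · exact ⟨Coprod.inr (FreeGroup.of ⟨x, hx⟩), by simp⟩

theorem edgeCount_le_of_isOrderTwoFreeProdFree (hred : P.IsReduced)
    (h : P.IsOrderTwoFreeProdFree) :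
    ∃ k : ℕ, (∀ T : Finset G, T.Nonempty →
        (edgeCount P.gen T : ℝ) + 1 ≤ ((k : ℝ) + 1 / 2) * #T) ∧
      ∃ T : Finset G, #T = 2 ∧ 2 * k ≤ edgeCount P.gen T := by
  obtain ⟨Y, hY2, hbij⟩ := h
  have hfin : Finite (P.Gp Y) := Nat.finite_of_card_ne_zero (by omega)
  let e := MulEquiv.ofBijective _ hbij
  have he1 : ∀ a : P.Gp Y, e.symm a = Coprod.inl a := fun a => by
    rw [MulEquiv.symm_apply_eq]
    simp [e]
  have he2 : ∀ z : (Yᶜ : Set X), e.symm (P.gen z) = Coprod.inr (FreeGroup.of z) := fun z => by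
    rw [MulEquiv.symm_apply_eq]
    simp [e]
  let A : Option (Yᶜ : Set X) → Subgroup G := fun o =>
    o.elim (P.Gp Y) fun z => Subgroup.zpowers (P.gen z)
  let F : Coprod (P.Gp Y) (FreeGroup (Yᶜ : Set X)) →* CoprodI fun o => A o :=
    Coprod.lift (CoprodI.of (M := fun o => A o) (i := none))
      (FreeGroup.lift fun z => CoprodI.of (M := fun o => A o) (i := some z)
        ⟨P.gen z, Subgroup.mem_zpowers _⟩)
  have hF1 : ∀ a : P.Gp Y,
      F (Coprod.inl a) = CoprodI.of (M := fun o => A o) (i := none) a := fun a =>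
    Coprod.lift_apply_inl _ _ _
  have hF2 : ∀ z : (Yᶜ : Set X), F (Coprod.inr (FreeGroup.of z)) =
      CoprodI.of (M := fun o => A o) (i := some z) ⟨P.gen z, Subgroup.mem_zpowers _⟩ := fun z =>
    (Coprod.lift_apply_inr _ _ _).trans FreeGroup.lift_apply_of
  let f : G →* CoprodI fun o => A o := F.comp e.symm.toMonoidHom
  have hf1 : ∀ a : P.Gp Y, f a = CoprodI.of (M := fun o => A o) (i := none) a := fun a => by
    change F (e.symm a) = _
    rw [he1]
    exact hF1 a
  have hf2 : ∀ z : (Yᶜ : Set X), f (P.gen z) = CoprodI.of (M := fun o => A o) (i := some z)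
      ⟨P.gen z, Subgroup.mem_zpowers _⟩ := fun z => by
    change F (e.symm (P.gen z)) = _
    rw [he2]
    exact hF2 z
  have hinv : ((CoprodI.lift fun o => (A o).subtype).comp F) = e.toMonoidHom := by
    refine Coprod.hom_ext ?_ ?_
    · ext a
      change (CoprodI.lift fun o => (A o).subtype) (F (Coprod.inl a)) = e (Coprod.inl a)
      rw [hF1, ← he1, e.apply_symm_apply]
      exact CoprodI.lift_of _ _
    · ext z
      change (CoprodI.lift fun o => (A o).subtype) (F (Coprod.inr (FreeGroup.of z))) =
        e (Coprod.inr (FreeGroup.of z))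
      rw [hF2, ← he2, e.apply_symm_apply]
      exact CoprodI.lift_of _ _
  have hfinj : Function.Injective f := by
    have : Function.LeftInverse (CoprodI.lift fun o => (A o).subtype) f := fun g => by
      have := DFunLike.congr_fun hinv (e.symm g)
      rw [MonoidHom.comp_apply] at this
      exact this.trans (e.apply_symm_apply g)
    exact this.injective
  have hforest : IsForestFamily A := isForestFamily_of_leftInverse A f hfinj <| by
    rintro (_ | z) a ha
    · exact ⟨⟨a, ha⟩, hf1 ⟨a, ha⟩⟩
    · obtain ⟨k, rfl⟩ := ha
      exact ⟨⟨P.gen z, Subgroup.mem_zpowers _⟩ ^ k, by simp only [map_zpow, hf2]⟩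
  have hord : ∀ z : (Yᶜ : Set X), ¬ IsOfFinOrder (P.gen z) := fun z hz => by
    have h1 := e.symm.toMonoidHom.isOfFinOrder hz
    change IsOfFinOrder (e.symm (P.gen z)) at h1
    rw [he2] at h1
    have h2 := (Coprod.snd : Coprod (P.Gp Y) (FreeGroup (Yᶜ : Set X)) →* _).isOfFinOrder h1
    rw [Coprod.snd_apply_inr] at h2
    exact not_isOfFinOrder_of_isMulTorsionFree (FreeGroup.of_ne_one z) h2
  set k := Fintype.card Y with hk
  let γ : Y → P.Gp Y := fun y => ⟨P.gen y, Subgroup.subset_closure ⟨y, y.2, rfl⟩⟩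
  have hγ : ∀ y, γ y ≠ 1 := fun y hy => hred y (congrArg Subtype.val hy)
  have hcard2 : ∀ T : Finset (P.Gp Y), #T ≤ 2 := fun T => by
    have := Fintype.ofFinite (P.Gp Y)
    rw [← hY2, Nat.card_eq_fintype_card]
    exact card_le_univ T
  refine ⟨k, fun S hS => ?_, ?_⟩
  -- A block has one vertex and no edge, or two vertices and at most 2k edges.
  · have h1 := edgeCount_add_mul_cosetCount_le (P.Gp Y).subtype (P.Gp Y).subtype_injective
      γ (k := 2 * k) (s := 2 * k) (fun T hT => by
        have hT0 := hT.card_pos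
        have hT2 := hcard2 T
        have hcases : #T = 1 ∨ #T = 2 := by omega
        rcases hcases with hT1 | hT2
        · obtain ⟨g, rfl⟩ := card_eq_one.1 hT1
          simp [edgeCount_singleton hγ]
        · have h2 : (edgeCount γ T : ℝ) ≤ k * #T := by exact_mod_cast edgeCount_le T
          rw [hT2] at h2 ⊢
          push_cast at h2 ⊢
          linarith) S
    -- With no generators at all, the block inequality reads #S ≤ 2 N for N the number of cosets.
    have h2 := edgeCount_add_mul_cosetCount_le (P.Gp Y).subtype (P.Gp Y).subtype_injective
      (fun y : Empty => y.elim) (k := -2) (s := -1) (fun T hT => by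
        have h3 : (#T : ℝ) ≤ 2 := by exact_mod_cast hcard2 T
        have h4 : edgeCount (fun y : Empty => (y.elim : P.Gp Y)) T = 0 := by
          simp [edgeCount_eq_sum]
        rw [h4]
        push_cast
        linarith) S
    rw [Subgroup.range_subtype] at h1 h2
    have h3 := hforest S hS
    rw [Fintype.sum_option] at h3
    have h4 : (edgeCount (fun z : (Yᶜ : Set X) => P.gen z) S : ℝ) ≤
        ∑ z : (Yᶜ : Set X), ((#S : ℝ) - cosetCount (A (some z)) S) := by
      rw [edgeCount_eq_sum_unit]
      push_cast
      refine sum_le_sum fun z _ => ?_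
      have : (edgeCount (fun _ : Unit => P.gen z) S : ℝ) + cosetCount (A (some z)) S ≤ #S :=
        edgeCount_unit_add_cosetCount_le (hord z) S
      linarith
    have h5 : (edgeCount P.gen S : ℝ) = edgeCount (fun y => (P.Gp Y).subtype (γ y)) S +
        edgeCount (fun z : (Yᶜ : Set X) => P.gen z) S := by
      exact_mod_cast edgeCount_eq_add_compl P.gen Y S
    change (#S : ℝ) - cosetCount (P.Gp Y) S + _ ≤ _ at h3
    rw [h5]
    have h6 : (0 : ℝ) ≤ k := by positivity
    have h7 : (0 : ℝ) ≤ edgeCount (fun y : Empty => (P.Gp Y).subtype y.elim) S := by positivity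
    set N : ℝ := (cosetCount (P.Gp Y) S : ℝ)
    rcases Nat.eq_zero_or_pos k with hk0 | hk1
    · exfalso
      have : IsEmpty Y := Fintype.card_eq_zero_iff.1 (hk ▸ hk0)
      have hb : P.Gp Y = ⊥ := by
        rw [GroupPresentation.Gp, Set.isEmpty_coe_sort.1 this, Set.image_empty,
          Subgroup.closure_empty]
      rw [hb, Subgroup.card_bot] at hY2
      omega
    · have h8 : (1 : ℝ) ≤ k := by exact_mod_cast hk1
      -- Altogether e + 1 ≤ 2k(#S - N) + N; since 2N ≥ #S and k ≥ 1 this is at most (k + 1/2) #S.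
      nlinarith
  · have := Fintype.ofFinite (P.Gp Y)
    have hc : Fintype.card (P.Gp Y) = 2 := by rw [← Nat.card_eq_fintype_card, hY2]
    refine ⟨univ.map ⟨(P.Gp Y).subtype, (P.Gp Y).subtype_injective⟩, ?_, ?_⟩
    · rw [card_map, card_univ, hc]
    · rw [edgeCount_eq_add_compl P.gen Y, edgeCount_of_closed (fun y : Y => P.gen y)]
      · rw [card_map, card_univ, hc]
        omega
      · intro g hg y
        obtain ⟨a, -, rfl⟩ := mem_map.1 hg
        exact mem_map.2 ⟨a * γ y, mem_univ _, rfl⟩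

/-- If Ψ > Ξ, a subgroup of order h ≥ 2 realizes `Ψ`, and there Ψ(h - 1) ≤ Ξ h. For Ξ > 0 equality
forces h = 2. -/
theorem Psi_le_two_mul_Xi (hred : P.IsReduced) : P.Psi ≤ 2 * P.Xi := by
  have h0 := Xi_nonneg hred
  rcases le_or_gt P.Psi P.Xi with h | h
  · linarith
  · obtain ⟨H, S, hSH, hS2, hSe⟩ := exists_subgroup_of_Xi_lt_Psi hred h
    have h1 := edgeCount_add_one_le_Xi P (T := S) (card_pos.1 (by omega))
    have h2 : (2 : ℝ) ≤ #S := by exact_mod_cast hS2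
    rw [hSe] at h1
    nlinarith

theorem isOrderTwoFreeProdFree_of_Xi_eq (hred : P.IsReduced) (hpos : 0 < P.Psi)
    {H : Subgroup G} {S : Finset G} (hSH : (S : Set G) = H) (hcard : #S = 2)
    (hS : (edgeCount P.gen S : ℝ) + 1 = 2 * (P.Xi + 1)) : P.IsOrderTwoFreeProdFree := by
  have hle := Psi_le_two_mul_Xi hred
  rw [edgeCount_subgroup H S hSH, hcard] at hS
  push_cast at hS
  refine isOrderTwoFreeProdFree_of_bound hred hSH hcard ?_ fun T hT => ?_
  · rw [Nat.pos_iff_ne_zero]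
    intro h0
    rw [h0] at hS
    push_cast at hS
    linarith
  · have h1 := edgeCount_add_one_le_Xi P hT
    have h2 : (#{x | P.gen x ∈ H} : ℝ) + 1 / 2 = P.Xi + 1 := by linarith
    rwa [h2]

theorem isOrderTwoFreeProdFree_of_Psi_eq (hred : P.IsReduced) (hpos : 0 < P.Psi)
    (h : P.Psi = 2 * P.Xi) : P.IsOrderTwoFreeProdFree := by
  obtain ⟨H, S, hSH, hS2, hSe⟩ := exists_subgroup_of_Xi_lt_Psi hred (by linarith)
  have h1 := edgeCount_add_one_le_Xi P (T := S) (card_pos.1 (by omega))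
  have h2 : (2 : ℝ) ≤ #S := by exact_mod_cast hS2
  have h3 : (#S : ℝ) ≤ 2 := by
    rw [hSe] at h1
    nlinarith
  have h4 : #S = 2 := le_antisymm (by exact_mod_cast h3) hS2
  refine isOrderTwoFreeProdFree_of_Xi_eq hred hpos hSH h4 ?_
  rw [hSe, h4]
  push_cast
  linarith

end OrderTwo

/-! ### Comparison with the sum of the quotients -/

section SumFormula

variable {ι : Type*} [Fintype ι] {G X : ι → Type*} [∀ i, Group (G i)] [∀ i, Fintype (X i)]
  {P : ∀ i, GroupPresentation (X i) (G i)}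

/-- For #T ≥ 2 one has Ψ(G₂) ≤ Ξ(G₂) #T. For one vertex, Ψ(G₂) is at most the mean of Ψ(G₁) and
Ψ(G₂), hence at most Ξ(G₁) + Ξ(G₂). -/
theorem Xi_freeProd_le_add (hred : ∀ i, (P i).IsReduced) {i₁ i₂ : ι}
    (hPsi : (P i₂).Psi ≤ (P i₁).Psi) (hmax : ∀ i, i ≠ i₁ → (P i).Psi ≤ (P i₂).Psi) :
    (freeProd P).Xi ≤ (P i₁).Xi + (P i₂).Xi := by
  have h := Xi_freeProd_le hred hmax (s := (P i₁).Xi + (P i₂).Xi + 1) fun T hT => by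
    have h1 := Psi_le_two_mul_Xi (hred i₁)
    have h2 := Psi_le_two_mul_Xi (hred i₂)
    have h3 := Xi_nonneg (hred i₂)
    by_cases hT1 : #T = 1
    · obtain ⟨g, rfl⟩ := card_eq_one.1 hT1
      rw [edgeCount_singleton (hred i₁), card_singleton]
      push_cast
      linarith
    · have h4 : (2 : ℝ) ≤ #T := by
        have := hT.card_pos
        exact_mod_cast (by omega : 2 ≤ #T)
      have h5 := edgeCount_add_one_le_Xi (P i₁) hT
      nlinarith
  linarith

/-- Sets with three or more vertices leave slack, since p/3 < p/2 ≤ Ξ(G₂). So equality is attained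
on at most two vertices, hence on a subgroup of order 1 or 2, and every inequality `Ψ ≤ 2Ξ` used
there is sharp. -/
theorem isOrderTwoFreeProdFree_of_Xi_freeProd_eq (hred : ∀ i, (P i).IsReduced) {i₁ i₂ : ι}
    (hPsi : (P i₂).Psi ≤ (P i₁).Psi) (hmax : ∀ i, i ≠ i₁ → (P i).Psi ≤ (P i₂).Psi)
    (hpos : 0 < (P i₂).Psi) (heq : (freeProd P).Xi = (P i₁).Xi + (P i₂).Xi) :
    (P i₁).IsOrderTwoFreeProdFree ∧ (P i₂).IsOrderTwoFreeProdFree := by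
  have h1 := Psi_le_two_mul_Xi (hred i₁)
  have h2 := Psi_le_two_mul_Xi (hred i₂)
  set p := (P i₂).Psi with hp
  set s := (P i₁).Xi + (P i₂).Xi + 1 with hs
  have hposc : ∀ T : Finset (G i₁), T.Nonempty → (0 : ℝ) < #T := fun T hT => by
    exact_mod_cast hT.card_pos
  have hbig : ∀ T : Finset (G i₁), 3 ≤ #T →
      (edgeCount (P i₁).gen T : ℝ) + (1 + p) ≤ ((P i₁).Xi + 1 + p / 3) * #T := fun T hT3 => by
    have h5 := edgeCount_add_one_le_Xi (P i₁) (T := T) (card_pos.1 (by omega))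
    have h4 : (3 : ℝ) ≤ #T := by exact_mod_cast hT3
    nlinarith
  obtain ⟨T, ⟨hT, hT2⟩, hTmax⟩ := exists_max_of_card_le (γ := (P i₁).gen)
    (fun T : Finset (G i₁) => T.Nonempty ∧ #T ≤ 2) 2 (fun T h => h.2)
    ⟨{1}, singleton_nonempty 1, by simp⟩ (fun e m => ((e : ℝ) + (1 + p)) / m)
  set m := ((edgeCount (P i₁).gen T : ℝ) + (1 + p)) / #T with hm
  have hle : ∀ S : Finset (G i₁), S.Nonempty →
      (edgeCount (P i₁).gen S : ℝ) + (1 + p) ≤ max m ((P i₁).Xi + 1 + p / 3) * #S := by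
    intro S hS
    by_cases hS2 : #S ≤ 2
    · have := hTmax S ⟨hS, hS2⟩
      rw [div_le_iff₀ (hposc S hS)] at this
      refine this.trans ?_
      gcongr
      exact le_max_left _ _
    · refine (hbig S (by omega)).trans ?_
      gcongr
      exact le_max_right _ _
  have hsm : s ≤ m := by
    have := Xi_freeProd_le hred hmax hle
    rw [heq] at this
    rcases max_cases m ((P i₁).Xi + 1 + p / 3) with h | h <;> rw [h.1] at this <;> linarith
  have hms : m ≤ s := by
    rw [hm, div_le_iff₀ (hposc T hT)]
    by_cases hT1 : #T = 1
    · obtain ⟨g, rfl⟩ := card_eq_one.1 hT1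
      rw [edgeCount_singleton (hred i₁), card_singleton]
      push_cast
      linarith
    · have h4 : #T = 2 := by
        have := hT.card_pos
        omega
      have h5 := edgeCount_add_one_le_Xi (P i₁) hT
      rw [h4] at h5 ⊢
      push_cast at h5 ⊢
      linarith
  have hmeq : m = s := le_antisymm hms hsm
  have hmax' : max m ((P i₁).Xi + 1 + p / 3) = s := by
    rw [max_eq_left (by linarith), hmeq]
  rw [hmax'] at hle
  obtain ⟨H, S, hSH, hTS, hSe⟩ := exists_subgroup_of_attained hle hT
    (by rw [← hmeq, hm, div_mul_cancel₀ _ (hposc T hT).ne']) 2 (fun S hS hSe => by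
      by_contra hlt
      have h3 := hbig S (by omega)
      rw [hSe] at h3
      have := hposc S hS
      have h4 := le_of_mul_le_mul_right h3 this
      linarith)
  have hS2 : #S ≤ 2 := by
    by_contra hlt
    have h3 := hbig S (by omega)
    rw [hSe] at h3
    have := hposc S (card_pos.1 (by omega))
    have h4 := le_of_mul_le_mul_right h3 this
    linarith
  have hScases : #S = 1 ∨ #S = 2 := by
    have := hT.card_pos
    omega
  rcases hScases with h1' | h2'
  · obtain ⟨g, rfl⟩ := card_eq_one.1 h1'
    rw [edgeCount_singleton (hred i₁), card_singleton] at hSe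
    push_cast at hSe
    exact ⟨isOrderTwoFreeProdFree_of_Psi_eq (hred i₁) (by linarith) (by linarith),
      isOrderTwoFreeProdFree_of_Psi_eq (hred i₂) hpos (by linarith)⟩
  · have h5 := edgeCount_add_one_le_Xi (P i₁) (T := S) (card_pos.1 (by omega))
    rw [h2'] at h5 hSe
    push_cast at h5 hSe
    exact ⟨isOrderTwoFreeProdFree_of_Xi_eq (hred i₁) (by linarith) hSH h2' (by linarith),
      isOrderTwoFreeProdFree_of_Psi_eq (hred i₂) hpos (by linarith)⟩

/-- With kᵢ generators in the subgroups of order two, Ξ(Gᵢ) ≤ kᵢ - 1/2 and Ψ(G₂) ≥ 2k₂ - 1. A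
two-element set with 2k₁ edges then gives Ξ(G) ≥ k₁ + k₂ - 1. -/
theorem add_le_Xi_freeProd_of_orderTwo [∀ i, Nontrivial (G i)] (hred : ∀ i, (P i).IsReduced)
    {i₁ i₂ : ι} (hne : i₁ ≠ i₂) (hPsi : (P i₂).Psi ≤ (P i₁).Psi)
    (h₁ : (P i₁).IsOrderTwoFreeProdFree) (h₂ : (P i₂).IsOrderTwoFreeProdFree) :
    (P i₁).Xi + (P i₂).Xi ≤ (freeProd P).Xi := by
  obtain ⟨k₁, hk₁, T₁, hT₁, hT₁e⟩ := edgeCount_le_of_isOrderTwoFreeProdFree (hred i₁) h₁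
  obtain ⟨k₂, hk₂, T₂, hT₂, hT₂e⟩ := edgeCount_le_of_isOrderTwoFreeProdFree (hred i₂) h₂
  have a1 := Xi_le hk₁
  have a2 := Xi_le hk₂
  have a3 := edgeCount_add_Psi_le_Xi_freeProd hred hne hPsi (T := T₁) (card_pos.1 (by omega))
  have a4 := edgeCount_le_Psi (hred i₂) (T := T₂) (card_pos.1 (by omega))
  have b1 : (2 : ℝ) * k₁ ≤ edgeCount (P i₁).gen T₁ := by exact_mod_cast hT₁e
  have b2 : (2 : ℝ) * k₂ ≤ edgeCount (P i₂).gen T₂ := by exact_mod_cast hT₂e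
  rw [hT₁] at a3
  rw [hT₂] at a4
  push_cast at a3 a4
  linarith

end SumFormula

/-! ### A finite subgroup realizing Ψ and its complementary generators -/

section Complement

variable {X G : Type*} [Group G] {P : GroupPresentation X G} [Fintype X]

theorem card_gen_mem_Gp (hmin : P.IsMinimal) (Y : Set X) :
    #{x | P.gen x ∈ P.Gp Y} = Fintype.card Y := by
  rw [← Set.toFinset_card]
  congr 1
  ext x
  rw [mem_filter, Set.mem_toFinset]
  refine ⟨fun h => ?_, fun h => ⟨mem_univ _, Subgroup.subset_closure ⟨x, h, rfl⟩⟩⟩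
  by_contra hx
  exact gen_notMem_Gp hmin hx h.2

theorem edgeCount_sub_le (Y : Set X) (T : Finset (P.Gp Y)) :
    edgeCount (P.sub Y).gen T ≤ edgeCount P.gen (T.image (P.Gp Y).subtype) :=
  edgeCount_map_le (P.Gp Y).subtype (P.Gp Y).subtype_injective (fun y : Y => (y : X))
    Subtype.val_injective (fun _ => rfl) T

theorem Psi_sub_le (hred : P.IsReduced) (Y : Set X) : (P.sub Y).Psi ≤ P.Psi := by
  refine Psi_le (Psi_nonneg hred) fun T hT => ?_
  have h1 := edgeCount_le_Psi hred (hT.image (P.Gp Y).subtype)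
  rw [card_image_of_injective _ (P.Gp Y).subtype_injective] at h1
  have h2 : (edgeCount (P.sub Y).gen T : ℝ) ≤ edgeCount P.gen (T.image (P.Gp Y).subtype) := by
    exact_mod_cast edgeCount_sub_le Y T
  linarith

/-- If a finite subgroup generated by the generators in `Y` realizes `Ψ`, then it leaves room for
`1 + Ψ` of the subgroup generated by the remaining ones. -/
theorem card_mul_add_Psi_compl_le (hred : P.IsReduced) (hmin : P.IsMinimal) {Y : Set X}
    {S₀ : Finset G} (hS₀ : (S₀ : Set G) = P.Gp Y) (hS₀2 : 2 ≤ #S₀)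
    (hΨ : (Fintype.card Y : ℝ) * #S₀ = (P.Psi + 1) * (#S₀ - 1)) :
    (Fintype.card Y : ℝ) * #S₀ + (1 + (P.sub Yᶜ).Psi) ≤ (P.Xi + 1) * #S₀ := by
  have hmem : ∀ g, g ∈ S₀ ↔ g ∈ P.Gp Y := fun g => by rw [← mem_coe, hS₀, SetLike.mem_coe]
  set k : ℝ := (Fintype.card Y : ℝ) with hk
  set p : ℝ := P.Xi + 1 - k with hp
  have hS₀ne : S₀.Nonempty := ⟨1, (hmem 1).2 (one_mem _)⟩
  have hh : (0 : ℝ) < #S₀ := by exact_mod_cast hS₀ne.card_pos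
  have hk1 : k + 1 ≤ #S₀ := by
    have := card_gen_mem_add_one_le hred hmin hS₀
    rw [card_gen_mem_Gp hmin] at this
    rw [hk]
    exact_mod_cast this
  have hclosed : ∀ S : Finset G, S.Nonempty → (∀ v ∈ S, ∀ y ∈ Y, v * P.gen y ∈ S) →
      (edgeCount (fun z : (Yᶜ : Set X) => P.gen z) S : ℝ) + 1 ≤ p * #S := fun S hS hSY => by
    have h1 := edgeCount_add_one_le_Xi P hS
    rw [edgeCount_eq_add_compl P.gen Y, edgeCount_of_closed (fun y : Y => P.gen y)
      fun g hg y => hSY g hg y y.2] at h1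
    push_cast at h1
    rw [hp]
    linarith
  by_contra! hlt
  set K : ℝ := p * #S₀ with hK
  have hK1 : 1 ≤ K := by
    have := hclosed S₀ hS₀ne fun v hv y hy =>
      (hmem _).2 (mul_mem ((hmem v).1 hv) (Subgroup.subset_closure ⟨y, hy, rfl⟩))
    have h0 : (0 : ℝ) ≤ edgeCount (fun z : (Yᶜ : Set X) => P.gen z) S₀ := by positivity
    linarith
  have hp0 : 0 ≤ p := by
    by_contra! h
    nlinarith
  -- If the claim fails, K < 1 + Ψ for the complementary generators, so some set has more than K(#U
  -- - 1) of their edges. A smallest such `U` has excess δ > 0, and smaller sets have none.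
  obtain ⟨U, hUmax, hU⟩ : ∃ U : Finset G,
      (K * (#U - 1) < edgeCount (fun z : (Yᶜ : Set X) => P.gen z) U ∧ U.Nonempty) ∧
      ∀ A : Finset G, #A < #U → A.Nonempty →
        (edgeCount (fun z : (Yᶜ : Set X) => P.gen z) A : ℝ) ≤ K * (#A - 1) := by
    have hex : ∃ U : Finset G,
        K * (#U - 1) < edgeCount (fun z : (Yᶜ : Set X) => P.gen z) U ∧ U.Nonempty := by
      have hlt' : K - 1 < (P.sub Yᶜ).Psi := by
        rw [hK, hp]
        linarith
      obtain ⟨T, hT, hTe⟩ := exists_lt_edgeCount_of_lt_Psi (by linarith) hlt'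
      refine ⟨T.image (P.Gp Yᶜ).subtype, lt_of_lt_of_le ?_ (Nat.cast_le.2
        (edgeCount_map_le (γ := (P.sub Yᶜ).gen) (γ' := fun z : (Yᶜ : Set X) => P.gen z)
          (P.Gp Yᶜ).subtype (P.Gp Yᶜ).subtype_injective id Function.injective_id (fun _ => rfl) T)),
        hT.image _⟩
      rw [card_image_of_injective _ (P.Gp Yᶜ).subtype_injective]
      rwa [sub_add_cancel] at hTe
    obtain ⟨U, hU, hmin⟩ := exists_minimalFor_of_wellFoundedLT _ (fun U : Finset G => #U) hex
    refine ⟨U, hU, fun A hA hAne => ?_⟩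
    by_contra! h
    exact absurd (hmin ⟨h, hAne⟩ hA.le) (not_le.2 hA)
  set eZ : Finset G → ℕ := edgeCount (fun z : (Yᶜ : Set X) => P.gen z) with heZ
  set δ : ℝ := eZ U - K * (#U - 1) with hδ
  have hδ0 : 0 < δ := by rw [hδ]; linarith [hUmax.1]
  let V : Set ℝ := {t | ∃ S : Finset G, S.Nonempty ∧ (∀ v ∈ S, ∀ y ∈ Y, v * P.gen y ∈ S) ∧
    t = p * #S - eZ S}
  have hVne : V.Nonempty := ⟨_, S₀, hS₀ne, fun v hv y hy =>
      (hmem _).2 (mul_mem ((hmem v).1 hv) (Subgroup.subset_closure ⟨y, hy, rfl⟩)), rfl⟩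
  have hVbdd : BddBelow V := ⟨1, by
    rintro _ ⟨S, hS, hSY, rfl⟩
    linarith [hclosed S hS hSY]⟩
  -- The set `S`, closed under `Y`, minimizes p #S - eZ(S) up to less than δ.
  obtain ⟨_, ⟨S, hS, hSY, rfl⟩, hSlt⟩ := exists_lt_of_csInf_lt hVne (lt_add_of_pos_right _ hδ0)
  -- Otherwise adjoining `W * S₀` costs at most K for each vertex of `W \ S`, while the minimality
  -- of `U` gains at least K #(W \ S) + δ edges. That would fall below the infimum.
  have hstep : ∀ w : G, (w • U ∩ S).Nonempty → w • U ⊆ S := by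
    intro w hne
    by_contra hsub
    set W := w • U with hW
    have hWcard : #W = #U := card_smul_finset w U
    have hWe : eZ W = eZ U := edgeCount_smul w U
    have hA : #(W ∩ S) < #U := by
      rw [← hWcard]
      exact card_lt_card ⟨inter_subset_left, fun h => hsub (h.trans inter_subset_right)⟩
    have hAe := hU _ hA hne
    set S' := S ∪ W * S₀ with hS'
    have hS'Y : ∀ v ∈ S', ∀ y ∈ Y, v * P.gen y ∈ S' := by
      intro v hv y hy
      rcases mem_union.1 hv with hv | hv
      · exact mem_union_left _ (hSY v hv y hy)
      · obtain ⟨a, ha, b, hb, rfl⟩ := mem_mul.1 hv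
        refine mem_union_right _ ?_
        rw [mul_assoc]
        exact mul_mem_mul ha ((hmem _).2 (mul_mem ((hmem b).1 hb)
          (Subgroup.subset_closure ⟨y, hy, rfl⟩)))
    have hcard : #S' ≤ #S + #(W \ S) * #S₀ := by
      have : S' ⊆ S ∪ (W \ S) * S₀ := by
        intro v hv
        rcases mem_union.1 hv with hv | hv
        · exact mem_union_left _ hv
        · obtain ⟨a, ha, b, hb, rfl⟩ := mem_mul.1 hv
          by_cases haS : a ∈ S
          · exact mem_union_left _ (mul_mem_of_closed hSY haS ((hmem b).1 hb))
          · exact mem_union_right _ (mul_mem_mul (mem_sdiff.2 ⟨ha, haS⟩) hb)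
      exact (card_le_card this).trans ((card_union_le _ _).trans
        (Nat.add_le_add_left card_mul_le _))
    have hWS : #(W \ S) + #(W ∩ S) = #W := card_sdiff_add_card_inter W S
    have hsup : eZ S + eZ W ≤ eZ (S ∪ W) + eZ (S ∩ W) := edgeCount_supermodular S W
    have hmono : eZ (S ∪ W) ≤ eZ S' := edgeCount_mono <| union_subset_union_right fun a ha =>
      mem_mul.2 ⟨a, ha, 1, (hmem 1).2 (one_mem _), mul_one a⟩
    have hle : sInf V ≤ p * #S' - eZ S' :=
      csInf_le hVbdd ⟨S', hS.mono subset_union_left, hS'Y, rfl⟩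
    rw [inter_comm S W] at hsup
    have h1 : (#S' : ℝ) ≤ #S + #(W \ S) * #S₀ := by exact_mod_cast hcard
    have h2 : (#(W \ S) : ℝ) + #(W ∩ S) = #U := by
      rw [← hWcard]
      exact_mod_cast hWS
    have h3 : (eZ S : ℝ) + eZ U ≤ eZ S' + eZ (W ∩ S) := by
      rw [← hWe]
      exact_mod_cast hsup.trans (by omega)
    have h4 : p * #S' ≤ p * #S + K * #(W \ S) := by
      have := mul_le_mul_of_nonneg_left h1 hp0
      rw [hK]
      linarith
    have h5 : (#(W \ S) : ℝ) = #U - #(W ∩ S) := by linarith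
    rw [h5] at h4
    linarith
  have hedge : ∃ z ∈ Yᶜ, ∃ u ∈ U, u * P.gen z ∈ U := by
    have h0 : (0 : ℝ) < eZ U := by
      have : (1 : ℝ) ≤ #U := by exact_mod_cast hUmax.2.card_pos
      nlinarith [hUmax.1]
    have h1 : 0 < eZ U := by exact_mod_cast h0
    obtain ⟨e, he⟩ := card_pos.1 h1
    rw [mem_edgeSet] at he
    exact ⟨e.2, e.2.2, e.1, he.1, he.2⟩
  obtain ⟨z, hz, u, hu, huz⟩ := hedge
  have hSz : ∀ v ∈ S, v * P.gen z ∈ S := fun v hv => by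
    have h1 : v ∈ (v * u⁻¹) • U := by
      have := smul_mem_smul_finset (a := v * u⁻¹) hu
      simpa using this
    refine hstep (v * u⁻¹) ⟨v, mem_inter.2 ⟨h1, hv⟩⟩ ?_
    have := smul_mem_smul_finset (a := v * u⁻¹) huz
    simpa [← mul_assoc] using this
  obtain ⟨v, hv⟩ := hS
  have hL : ∀ c ∈ P.Gp (insert z Y), v * c ∈ S := fun c hc =>
    mul_mem_of_closed (s := insert z Y) (fun g hg x hx => by
      rcases hx with rfl | hx
      · exact hSz g hg
      · exact hSY g hg x hx) hv hc
  have hfin : ((P.Gp (insert z Y) : Subgroup G) : Set G).Finite :=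
    (v⁻¹ • S).finite_toSet.subset fun c hc => by
      rw [mem_coe, ← inv_smul_mem_iff, inv_inv]
      exact hL c hc
  set T := hfin.toFinset with hT
  have hTL : (T : Set G) = P.Gp (insert z Y) := hfin.coe_toFinset
  have hTne : T.Nonempty := ⟨1, by rw [hT, Set.Finite.mem_toFinset]; exact one_mem _⟩
  have h1 := edgeCount_le_Psi hred hTne
  have h2 : #{x | P.gen x ∈ P.Gp (insert z Y)} = Fintype.card Y + 1 := by
    refine (card_gen_mem_Gp hmin _).trans ?_
    have := Set.ncard_insert_of_notMem hz
    rw [← Nat.card_coe_set_eq, ← Nat.card_coe_set_eq] at this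
    refine (@Nat.card_eq_fintype_card (insert z Y : Set X) (_)).symm.trans (this.trans ?_)
    rw [Nat.card_eq_fintype_card]
  rw [edgeCount_subgroup _ T hTL, h2] at h1
  push_cast at h1
  have h3 : (0 : ℝ) < #T := by exact_mod_cast hTne.card_pos
  -- The set `S` contains a coset of `Gp(Y ∪ {z})`, a finite subgroup with k + 1 generators. Its
  -- edges would force Ψ + 1 > k + 1.
  have h4 : P.Psi + 1 ≤ k + 1 := by
    have h5 : (2 : ℝ) ≤ #S₀ := by exact_mod_cast hS₀2
    nlinarith
  have h5 : (1 : ℝ) ≤ #T := by exact_mod_cast hTne.card_pos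
  nlinarith

/-- `card_mul_add_Psi_compl_le` gives the bound on the subgroup realizing `Ψ`, and for minimal
presentations this subgroup is the worst case. -/
theorem edgeCount_add_le_of_finite_Gp (hred : P.IsReduced) (hmin : P.IsMinimal) {Y : Set X}
    [Finite (P.Gp Y)] (hΨ : P.Psi = (P.sub Y).Psi) (hlt : P.Xi < P.Psi) {c : ℝ} (hc0 : 0 ≤ c)
    (hc : c ≤ (P.sub Yᶜ).Psi) {T : Finset G} (hT : T.Nonempty) :
    (edgeCount P.gen T : ℝ) + (1 + c) ≤ (P.Xi + 1) * #T := by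
  have hfin : ((P.Gp Y : Subgroup G) : Set G).Finite := Set.toFinite _
  set S₀ := hfin.toFinset
  have hS₀ : (S₀ : Set G) = P.Gp Y := hfin.coe_toFinset
  have hcard : Nat.card (P.Gp Y) = #S₀ := by
    rw [← Set.ncard_coe_finset, hS₀, ← Nat.card_coe_set_eq]
    rfl
  have hnt : Nontrivial (P.Gp Y) := by
    by_contra h
    rw [not_nontrivial_iff_subsingleton] at h
    have h0 : (P.sub Y).Psi ≤ 0 := Psi_le le_rfl fun T hT => by
      have h1 : #T ≤ 1 := card_le_one_of_subsingleton T
      have h2 : #T = 1 := le_antisymm h1 hT.card_pos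
      obtain ⟨g, rfl⟩ := card_eq_one.1 h2
      simp [edgeCount_singleton (isReduced_sub hred Y)]
    linarith [Xi_nonneg hred]
  have hS₀2 : 2 ≤ #S₀ := by
    rw [← hcard]
    exact Finite.one_lt_card
  have hsub := Psi_of_finite_minimal (isReduced_sub hred Y) (isMinimal_sub hmin Y)
  rw [← hΨ, hcard] at hsub
  have he : (edgeCount P.gen S₀ : ℝ) = Fintype.card Y * #S₀ := by
    rw [edgeCount_subgroup _ S₀ hS₀, card_gen_mem_Gp hmin]
    push_cast
    rfl
  have h1 := card_mul_add_Psi_compl_le hred hmin hS₀ hS₀2 hsub.symm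
  have h2 := Psi_sub_le hred Yᶜ
  refine edgeCount_add_le_of_minimal hred hmin hS₀ hS₀2 (he.trans hsub.symm) (by linarith)
    (by linarith) le_rfl ?_ hT
  rw [he]
  linarith

end Complement

/-! ### Simple circuits -/

section Circuits

variable {X G : Type*} [Group G] {P : GroupPresentation X G}

/-- The element represented by a letter. -/
def letterVal (P : GroupPresentation X G) (l : X × Bool) : G :=
  if l.2 then P.gen l.1 else (P.gen l.1)⁻¹

theorem eval_cons (l : X × Bool) (w : List (X × Bool)) :
    P.eval (l :: w) = letterVal P l * P.eval w := by
  rw [GroupPresentation.eval, GroupPresentation.eval, FreeGroup.lift_mk, FreeGroup.lift_mk,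
    List.map_cons, List.prod_cons, letterVal]
  cases l.2 <;> rfl

theorem eval_nil : P.eval [] = 1 := by
  simp [GroupPresentation.eval]

theorem eval_append (w w' : List (X × Bool)) : P.eval (w ++ w') = P.eval w * P.eval w' := by
  induction w with
  | nil => simp [eval_nil]
  | cons l w ih => rw [List.cons_append, eval_cons, eval_cons, ih, mul_assoc]

theorem eval_take_succ (w : List (X × Bool)) (i : ℕ) (hi : i < w.length) :
    P.eval (w.take (i + 1)) = P.eval (w.take i) * letterVal P w[i] := by
  rw [List.take_succ_eq_append_getElem hi, eval_append, eval_cons, eval_nil, mul_one]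

/-- The graph on `G` spanned by a set of edges of the Cayley graph. -/
def spanGraph (P : GroupPresentation X G) (E : Finset (G × X)) : SimpleGraph G :=
  SimpleGraph.fromRel fun g h => ∃ x, (g, x) ∈ E ∧ g * P.gen x = h

theorem exists_word_of_walk {E : Finset (G × X)} {a b : G} (p : (spanGraph P E).Walk a b) :
    ∃ w : List (X × Bool), w.length = p.length ∧
      (∀ i ≤ p.length, a * P.eval (w.take i) = p.getVert i) ∧
      ∀ i (hi : i < w.length),
        (if w[i].2 then (p.getVert i, w[i].1) else (p.getVert (i + 1), w[i].1)) ∈ E := by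
  induction p with
  | nil => exact ⟨[], rfl, fun i _ => by simp [eval_nil], fun i hi => by simp at hi⟩
  | @cons a c b h p ih =>
    obtain ⟨w, hlen, hw, hE⟩ := ih
    obtain ⟨l, hl, hlE⟩ : ∃ l : X × Bool, a * letterVal P l = c ∧
        (if l.2 then (a, l.1) else (c, l.1)) ∈ E := by
      obtain ⟨-, ⟨x, hx, rfl⟩ | ⟨x, hx, rfl⟩⟩ := (SimpleGraph.fromRel_adj _ _ _).1 h
      · exact ⟨(x, true), by simp [letterVal], by simpa using hx⟩
      · exact ⟨(x, false), by simp [letterVal], by simpa using hx⟩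
    refine ⟨l :: w, by simp [hlen], fun i hi => ?_, fun i hi => ?_⟩
    · cases i with
      | zero => simp [eval_nil]
      | succ i =>
        rw [List.take_succ_cons, eval_cons, ← mul_assoc, hl, SimpleGraph.Walk.getVert_cons_succ]
        exact hw i (by simpa using hi)
    · cases i with
      | zero => simpa using hlE
      | succ i => simpa using hE i (by simpa using hi)

/-- A path from `v` to `v * P.gen x` that avoids the edge `(v, x)` closes up through that edge to a
simple circuit. The word is reduced at the junction precisely because the path avoids the edge. -/
theorem circuitLength_pos_of_walk {v : G} {x : X} {E : Finset (G × X)} (hE : (v, x) ∉ E)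
    (h : (spanGraph P E).Reachable v (v * P.gen x)) : 0 < P.circuitLength x := by
  obtain ⟨p, hp⟩ := h.exists_isPath
  obtain ⟨w, hlen, hw, hwE⟩ := exists_word_of_walk p
  have hinj : ∀ i j, i < j → j ≤ w.length → P.eval (w.take i) ≠ P.eval (w.take j) := by
    intro i j hij hj heq
    have h1 := hw i (by omega)
    rw [heq, hw j (by omega)] at h1
    have := hp.getVert_injOn (show j ≤ p.length by omega) (show i ≤ p.length by omega) h1
    omega
  have hend : P.eval w = P.gen x := by
    have h1 := hw p.length le_rfl
    rw [← hlen, List.take_length, hlen, p.getVert_length] at h1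
    exact mul_left_cancel h1
  have htake : ∀ i ≤ w.length, (w ++ [(x, false)]).take i = w.take i := fun i hi =>
    List.take_append_of_le_length hi
  have hcirc : P.IsSimpleCircuit (w ++ [(x, false)]) := by
    refine ⟨by simp, ?_, ?_, fun i j hij hj => ?_⟩
    · refine List.isChain_iff_getElem.2 fun i hi heq => ?_
      simp only [List.length_append, List.length_singleton] at hi
      by_contra hne
      have hi' : i < w.length := by omega
      rw [List.getElem_append_left hi'] at heq hne
      rcases Nat.lt_or_ge (i + 1) w.length with h1 | h1
      · rw [List.getElem_append_left h1] at heq hne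
        refine hinj i (i + 2) (by omega) (by omega) ?_
        rw [eval_take_succ _ _ h1, eval_take_succ _ _ hi', mul_assoc]
        have : letterVal P w[i] * letterVal P w[i + 1] = 1 := by
          rw [letterVal, letterVal, heq]
          cases h2 : w[i].2 <;> cases h3 : w[i + 1].2 <;> simp_all
        rw [this, mul_one]
      · have h2 : w.length = i + 1 := by omega
        rw [List.getElem_append_right h1] at heq hne
        simp only [h2, Nat.sub_self, List.getElem_cons_zero, Bool.not_eq_false] at heq hne
        have h3 := hwE i hi'
        rw [hne, if_pos rfl, heq] at h3
        have h4 := hw (i + 1) (by omega)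
        rw [eval_take_succ _ _ hi', ← mul_assoc, hw i (by omega), ← h2, hlen, p.getVert_length,
          letterVal, hne, if_pos rfl, heq] at h4
        rw [mul_right_cancel h4] at h3
        exact hE h3
    · rw [eval_append, hend, eval_cons, eval_nil]
      simp [letterVal]
    · simp only [List.length_append, List.length_singleton] at hj
      rw [htake i (by omega), htake j (by omega)]
      exact hinj i j hij (by omega)
  have hne : {m : ℕ | ∃ w, P.IsSimpleCircuit w ∧ (∃ b, (x, b) ∈ w) ∧ m = w.length}.Nonempty :=
    ⟨_, _, hcirc, ⟨false, by simp⟩, rfl⟩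
  obtain ⟨w', hw', -, hlen'⟩ := Nat.sInf_mem hne
  rw [GroupPresentation.circuitLength, hlen']
  exact List.length_pos_of_ne_nil hw'.1

theorem exists_simpleCircuit_of_pos {x : X} (h : 0 < P.circuitLength x) :
    ∃ w, P.IsSimpleCircuit w ∧ (∃ b, (x, b) ∈ w) ∧ w.length = P.circuitLength x := by
  have hne : {m : ℕ | ∃ w, P.IsSimpleCircuit w ∧ (∃ b, (x, b) ∈ w) ∧ m = w.length}.Nonempty := by
    by_contra hne
    rw [Set.not_nonempty_iff_eq_empty] at hne
    rw [GroupPresentation.circuitLength, hne, Nat.sInf_empty] at h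
    exact lt_irrefl _ h
  obtain ⟨w, hw, hx, hlen⟩ := Nat.sInf_mem hne
  exact ⟨w, hw, hx, hlen.symm⟩

/-- A simple circuit, unrolled to a periodic walk through `v` that runs through pairwise distinct
edges. -/
theorem exists_periodic_walk (hred : P.IsReduced) {w : List (X × Bool)} (hw : P.IsSimpleCircuit w)
    (v : G) :
    ∃ (u : ℕ → G) (E : ℕ → G × X), (∀ i ≤ w.length, u i = v * P.eval (w.take i)) ∧
      (∀ i, u (i + w.length) = u i) ∧ 2 ≤ w.length ∧
      (∀ i, ((E i).1 = u i ∧ (E i).1 * P.gen (E i).2 = u (i + 1)) ∨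
        ((E i).1 = u (i + 1) ∧ (E i).1 * P.gen (E i).2 = u i)) ∧
      ∀ i j, i < j → j < i + w.length → E i ≠ E j := by
  obtain ⟨hne, hwred, hw1, hinj⟩ := hw
  set m := w.length with hm
  have hm0 : 0 < m := List.length_pos_of_ne_nil hne
  let u : ℕ → G := fun i => v * P.eval (w.take (i % m))
  have hu : ∀ i ≤ m, u i = v * P.eval (w.take i) := fun i hi => by
    rcases hi.lt_or_eq with h | rfl
    · simp only [u, Nat.mod_eq_of_lt h]
    · simp only [u, Nat.mod_self, List.take_zero, eval_nil, hm, List.take_length, hw1]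
  have huper : ∀ i, u (i + m) = u i := fun i => by simp only [u, Nat.add_mod_right]
  have humod : ∀ i, u (i % m) = u i := fun i => by simp only [u, Nat.mod_mod]
  have hlt : ∀ i, i % m < w.length := fun i => Nat.mod_lt _ hm0
  have hsucc : ∀ i, u (i + 1) = u i * letterVal P (w[i % m]'(hlt i)) := fun i => by
    have h1 : u (i + 1) = u (i % m + 1) := by
      rw [← humod (i + 1), ← humod (i % m + 1), Nat.mod_add_mod]
    rw [h1, hu _ (hlt i), eval_take_succ w _ (hlt i), ← mul_assoc, ← hu _ (hlt i).le, humod]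
  have huinj : ∀ i j, u i = u j → i % m = j % m := fun i j h => by
    have h1 := mul_left_cancel h
    by_contra hne
    rcases Nat.lt_or_gt_of_ne hne with h2 | h2
    · exact hinj _ _ h2 (hlt j) h1
    · exact hinj _ _ h2 (hlt i) h1.symm
  let E : ℕ → G × X := fun i =>
    ((if (w[i % m]'(hlt i)).2 then u i else u (i + 1)), (w[i % m]'(hlt i)).1)
  have hm2 : 2 ≤ m := by
    by_contra h
    have h1 : m = 1 := by omega
    have h2 := hsucc 0
    have h3 := huper 0
    rw [h1] at h3
    rw [h3] at h2
    have h4 : letterVal P (w[0 % m]'(hlt 0)) = 1 := left_eq_mul.1 h2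
    rw [letterVal] at h4
    split_ifs at h4
    · exact hred _ h4
    · exact hred _ (inv_eq_one.1 h4)
  have hE : ∀ i, ((w[i % m]'(hlt i)).2 = true ∧ (E i).1 = u i ∧
      (E i).1 * P.gen (E i).2 = u (i + 1)) ∨ ((w[i % m]'(hlt i)).2 = false ∧
      (E i).1 = u (i + 1) ∧ (E i).1 * P.gen (E i).2 = u i) := fun i => by
    have := hsucc i
    rw [letterVal] at this
    cases h : (w[i % m]'(hlt i)).2
    · right
      rw [h] at this
      simp only [E, h, this]
      simp
    · left
      rw [h] at this
      simp only [E, h, this]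
      simp
  refine ⟨u, E, hu, huper, hm2, fun i => (hE i).imp And.right And.right, fun i j hij hji heq => ?_⟩
  have hmod : i % m ≠ j % m := fun h => by
    have := (Nat.modEq_iff_dvd' hij.le).1 h
    have := Nat.le_of_dvd (by omega) this
    omega
  have hmod' : (i + 1) % m ≠ (j + 1) % m := fun h => hmod (Nat.ModEq.add_right_cancel' 1 h)
  -- Opposite passages of one edge exchange its ends, so m divides 2; a circuit of length 2 of that
  -- kind is not reduced.
  have hopp : (w[i % m]'(hlt i)).2 ≠ (w[j % m]'(hlt j)).2 → False := by
    intro hb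
    have h1 : u i = u (j + 1) ∧ u (i + 1) = u j := by
      rcases hE i with ⟨h1, h2, h3⟩ | ⟨h1, h2, h3⟩ <;>
        rcases hE j with ⟨h4, h5, h6⟩ | ⟨h4, h5, h6⟩
      · exact absurd (h1.trans h4.symm) hb
      · exact ⟨by rw [← h2, ← h5, heq], by rw [← h3, ← h6, heq]⟩
      · exact ⟨by rw [← h3, ← h6, heq], by rw [← h2, ← h5, heq]⟩
      · exact absurd (h1.trans h4.symm) hb
    have h2 : i ≡ j + 1 [MOD m] := huinj _ _ h1.1
    have h3 : i + 1 ≡ j [MOD m] := huinj _ _ h1.2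
    have h4 := (Nat.modEq_iff_dvd' (by omega)).1 h2
    have h5 := (Nat.modEq_iff_dvd' (by omega)).1 h3
    have h6 : m ∣ 2 := by
      have := Nat.dvd_sub h4 h5
      have h7 : j + 1 - i - (j - (i + 1)) = 2 := by omega
      rwa [h7] at this
    have h7 : m = 2 := le_antisymm (Nat.le_of_dvd (by omega) h6) hm2
    have h8 := List.isChain_iff_getElem.1 hwred 0 (by omega)
    have hlab : (w[i % m]'(hlt i)).1 = (w[j % m]'(hlt j)).1 := congrArg Prod.snd heq
    have h9 : (i % m = 0 ∧ j % m = 1) ∨ (i % m = 1 ∧ j % m = 0) := by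
      rw [h7] at hmod ⊢
      omega
    rcases h9 with ⟨h10, h11⟩ | ⟨h10, h11⟩ <;> simp only [h10, h11] at hlab hb
    · exact hb (h8 hlab)
    · exact hb (h8 hlab.symm).symm
  by_cases hb : (w[i % m]'(hlt i)).2 = (w[j % m]'(hlt j)).2
  · rcases hE i with ⟨h1, h2, h3⟩ | ⟨h1, h2, h3⟩ <;>
      rcases hE j with ⟨h4, h5, h6⟩ | ⟨h4, h5, h6⟩
    · exact hmod (huinj _ _ (by rw [← h2, ← h5, heq]))
    · rw [h1, h4] at hb
      exact Bool.noConfusion hb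
    · rw [h1, h4] at hb
      exact Bool.noConfusion hb
    · exact hmod' (huinj _ _ (by rw [← h2, ← h5, heq]))
  · exact hopp hb

end Circuits

/-! ### Saturated sets -/

section Saturated

variable {G : Type*} [Group G]

/-- `S` is invariant under the elements that stabilize `T` on the right. -/
def IsSaturated (T S : Finset G) : Prop := ∀ y, (∀ t ∈ T, t * y⁻¹ ∈ T) → ∀ v ∈ S, v * y ∈ S

theorem isSaturated_smul (T : Finset G) (w : G) : IsSaturated T (w • T) := by
  intro y hy v hv
  obtain ⟨t, ht, rfl⟩ := mem_smul_finset.1 hv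
  rw [smul_eq_mul, mul_assoc]
  refine smul_mem_smul_finset (a := w) ?_
  refine mul_mem_of_closed (γ := fun _ : Unit => y⁻¹) (s := Set.univ)
    (fun g hg _ _ => hy g hg) ht ?_
  have : y⁻¹⁻¹ ∈ Subgroup.closure ((fun _ : Unit => y⁻¹) '' Set.univ) :=
    inv_mem (Subgroup.subset_closure ⟨(), trivial, rfl⟩)
  rwa [inv_inv] at this

theorem IsSaturated.union {T A B : Finset G} (hA : IsSaturated T A) (hB : IsSaturated T B) :
    IsSaturated T (A ∪ B) := fun y hy v hv =>
  (mem_union.1 hv).elim (fun h => mem_union_left _ (hA y hy v h))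
    fun h => mem_union_right _ (hB y hy v h)

/-- If every translate of `T` through `u'` contained `u`, then `u⁻¹ * u'` would qualify in the
definition of saturation and `u'` would lie in `A`. -/
theorem exists_smul_mem_notMem {T A : Finset G} (hA : IsSaturated T A) {u u' : G} (hu : u ∈ A)
    (hu' : u' ∉ A) : ∃ w : G, u' ∈ w • T ∧ u ∉ w • T := by
  have : ∃ t ∈ T, t * (u⁻¹ * u')⁻¹ ∉ T := by
    by_contra! h
    have := hA _ h u hu
    rw [mul_inv_cancel_left] at this
    exact hu' this
  obtain ⟨t, ht, ht'⟩ := this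
  refine ⟨u' * t⁻¹, mem_smul_finset.2 ⟨t, ht, by simp⟩, fun h => ht' ?_⟩
  rw [← inv_smul_mem_iff, smul_eq_mul] at h
  convert h using 1
  group

end Saturated

/-! ### The case where ξ has no maximum -/

section NoMaximum

variable {X G : Type*} [Group G] {P : GroupPresentation X G} [Fintype X]

/-- An edge whose label lies on no simple circuit is a bridge. -/
theorem exists_split_of_circuitLength_eq_zero {T : Finset G} {v : G} {x : X}
    (hv : (v, x) ∈ edgeSet P.gen T) (hx : P.circuitLength x = 0) :
    ∃ A B : Finset G, A.Nonempty ∧ B.Nonempty ∧ Disjoint A B ∧ A ∪ B = T ∧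
      edgeCount P.gen T ≤ edgeCount P.gen A + edgeCount P.gen B + 1 := by
  set E := (edgeSet P.gen T).erase (v, x) with hE
  have hvT := mem_edgeSet.1 hv
  have hreach : ¬ (spanGraph P E).Reachable v (v * P.gen x) := fun h => by
    have := circuitLength_pos_of_walk (notMem_erase _ _) h
    omega
  have hadj : ∀ e ∈ E, (spanGraph P E).Reachable e.1 (e.1 * P.gen e.2) := by
    intro e he
    by_cases h : e.1 = e.1 * P.gen e.2
    · rw [← h]
    · exact SimpleGraph.Adj.reachable
        ((SimpleGraph.fromRel_adj _ _ _).2 ⟨h, Or.inl ⟨e.2, he, rfl⟩⟩)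
  refine ⟨{g ∈ T | (spanGraph P E).Reachable v g}, {g ∈ T | ¬ (spanGraph P E).Reachable v g},
    ⟨v, mem_filter.2 ⟨hvT.1, SimpleGraph.Reachable.refl _⟩⟩,
    ⟨v * P.gen x, mem_filter.2 ⟨hvT.2, hreach⟩⟩, disjoint_filter_filter_not _ _ _,
    filter_union_filter_not_eq _ _, ?_⟩
  have hsub : E ⊆ edgeSet P.gen {g ∈ T | (spanGraph P E).Reachable v g} ∪
      edgeSet P.gen {g ∈ T | ¬ (spanGraph P E).Reachable v g} := by
    intro e he
    have heT := mem_edgeSet.1 (mem_of_mem_erase he)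
    rw [mem_union, mem_edgeSet, mem_edgeSet, mem_filter, mem_filter, mem_filter, mem_filter]
    by_cases h : (spanGraph P E).Reachable v e.1
    · exact Or.inl ⟨⟨heT.1, h⟩, heT.2, h.trans (hadj e he)⟩
    · exact Or.inr ⟨⟨heT.1, h⟩, heT.2, fun h' => h (h'.trans (hadj e he).symm)⟩
  have h1 := (card_le_card hsub).trans (card_union_le _ _)
  have h3 : #E = #(edgeSet P.gen T) - 1 := card_erase_of_mem hv
  rw [h3] at h1
  change #(edgeSet P.gen T) ≤ _
  have h2 : 0 < #(edgeSet P.gen T) := card_pos.2 ⟨_, hv⟩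
  simp only [edgeCount]
  omega

/-- A smallest set violating `e + 1 ≤ σ #T` lies in a coset of the subgroup generated by the labels
of simple circuits. -/
theorem exists_violation_in_coset {σ : ℝ}
    (h : ∃ T : Finset G, T.Nonempty ∧ σ * #T < (edgeCount P.gen T : ℝ) + 1) :
    ∃ T : Finset G, T.Nonempty ∧ σ * #T < (edgeCount P.gen T : ℝ) + 1 ∧
      ∀ g ∈ T, g ∈ P.Gp {x | 0 < P.circuitLength x} ∧ 1 ∈ T := by
  obtain ⟨T, ⟨hT, hTσ⟩, hmin⟩ := exists_minimalFor_of_wellFoundedLT _ (fun T : Finset G => #T) h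
  have hsmall : ∀ A : Finset G, A.Nonempty → #A < #T → (edgeCount P.gen A : ℝ) + 1 ≤ σ * #A := by
    intro A hA hAT
    by_contra! hlt
    exact absurd (hmin ⟨hA, hlt⟩ hAT.le) (not_le.2 hAT)
  -- If at most one edge joined the two parts, one of them would be a smaller violation.
  have hsplit : ∀ A B : Finset G, A.Nonempty → B.Nonempty → Disjoint A B → A ∪ B = T →
      edgeCount P.gen A + edgeCount P.gen B + 1 < edgeCount P.gen T := by
    intro A B hA hB hAB hABT
    have hcard : #A + #B = #T := by rw [← hABT, card_union_of_disjoint hAB]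
    have h1 := hsmall A hA (by have := hB.card_pos; omega)
    have h2 := hsmall B hB (by have := hA.card_pos; omega)
    have h3 : (#T : ℝ) = #A + #B := by exact_mod_cast hcard.symm
    rw [h3] at hTσ
    have : (edgeCount P.gen A : ℝ) + edgeCount P.gen B + 1 < edgeCount P.gen T := by linarith
    exact_mod_cast this
  have hlabel : ∀ e ∈ edgeSet P.gen T, 0 < P.circuitLength e.2 := by
    intro e he
    by_contra h0
    obtain ⟨A, B, hA, hB, hAB, hABT, hle⟩ :=
      exists_split_of_circuitLength_eq_zero (v := e.1) (x := e.2) he (by omega)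
    have := hsplit A B hA hB hAB hABT
    omega
  obtain ⟨t, ht⟩ := hT
  have hcoset : ∀ g ∈ T, t⁻¹ * g ∈ P.Gp {x | 0 < P.circuitLength x} := by
    by_contra! hex
    obtain ⟨g, hg, hgn⟩ := hex
    set L := P.Gp {x | 0 < P.circuitLength x} with hL
    have hA : t ∈ T.filter fun g => t⁻¹ * g ∈ L := by simp [ht, one_mem]
    have hB : g ∈ T.filter fun g => ¬ t⁻¹ * g ∈ L := mem_filter.2 ⟨hg, hgn⟩
    have h1 := hsplit _ _ ⟨_, hA⟩ ⟨_, hB⟩ (disjoint_filter_filter_not _ _ _)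
      (filter_union_filter_not_eq _ _)
    have hsub : edgeSet P.gen T ⊆ edgeSet P.gen (T.filter fun g => t⁻¹ * g ∈ L) ∪
        edgeSet P.gen (T.filter fun g => ¬ t⁻¹ * g ∈ L) := by
      intro e he
      have heT := mem_edgeSet.1 he
      have hgen : P.gen e.2 ∈ L := Subgroup.subset_closure ⟨e.2, hlabel e he, rfl⟩
      rw [mem_union, mem_edgeSet, mem_edgeSet, mem_filter, mem_filter, mem_filter, mem_filter,
        ← mul_assoc, Subgroup.mul_mem_cancel_right _ hgen]
      by_cases h : t⁻¹ * e.1 ∈ L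
      · exact Or.inl ⟨⟨heT.1, h⟩, heT.2, h⟩
      · exact Or.inr ⟨⟨heT.1, h⟩, heT.2, h⟩
    have h2 := (card_le_card hsub).trans (card_union_le _ _)
    simp only [edgeCount] at h1
    omega
  refine ⟨t⁻¹ • T, ⟨t, ht⟩ |> Nonempty.smul_finset, ?_, fun g hg => ⟨?_, ?_⟩⟩
  · rwa [card_smul_finset, edgeCount_smul]
  · rw [← inv_smul_mem_iff, inv_inv] at hg
    have := hcoset _ hg
    simpa using this
  · exact mem_smul_finset.2 ⟨t, ht, by simp⟩

theorem edgeCount_add_one_lt_Xi (hmax : ¬ P.XiHasMax) {T : Finset G} (hT : T.Nonempty) :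
    (edgeCount P.gen T : ℝ) + 1 < (P.Xi + 1) * #T := by
  refine lt_of_le_of_ne (edgeCount_add_one_le_Xi P hT) fun h => hmax ?_
  refine ⟨induced P T, hT, fun K hK => (xi_le_Xi K hK).trans ?_⟩
  have := xi_induced_ge hT h.ge
  linarith

/-- In a finite subgroup the largest ratio of its subsets is attained. By
`exists_violation_in_coset` it bounds all sets, so `ξ` would have a maximum. -/
theorem infinite_Gp_circuits (hmax : ¬ P.XiHasMax) :
    Infinite (P.Gp {x | 0 < P.circuitLength x}) := by
  by_contra hfin
  rw [not_infinite_iff_finite] at hfin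
  have hfin' : ((P.Gp {x | 0 < P.circuitLength x} : Subgroup G) : Set G).Finite := Set.toFinite _
  obtain ⟨A, ⟨hA, hAL⟩, hAmax⟩ := exists_max_of_card_le (γ := P.gen)
    (fun T : Finset G => T.Nonempty ∧ (T : Set G) ⊆ P.Gp {x | 0 < P.circuitLength x})
    #hfin'.toFinset
    (fun T hT => card_le_card fun g hg => hfin'.mem_toFinset.2 (hT.2 (mem_coe.2 hg)))
    ⟨{1}, singleton_nonempty _, by simp [one_mem]⟩ (fun e n => ((e : ℝ) + 1) / n)
  have hA0 : (0 : ℝ) < #A := by exact_mod_cast hA.card_pos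
  have hle : P.Xi ≤ ((edgeCount P.gen A : ℝ) + 1) / #A - 1 := by
    refine Xi_le ?_
    by_contra! hex
    obtain ⟨T, hT, hTσ, hTL⟩ := exists_violation_in_coset hex
    have h1 := hAmax T ⟨hT, fun g hg => (hTL g hg).1⟩
    have h2 : (0 : ℝ) < #T := by exact_mod_cast hT.card_pos
    rw [div_le_iff₀ h2] at h1
    exact absurd hTσ (not_lt.2 h1)
  have h1 := edgeCount_add_one_lt_Xi hmax hA
  have h2 : (P.Xi + 1) * #A ≤ (edgeCount P.gen A : ℝ) + 1 := by
    rw [← le_div_iff₀ hA0]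
    linarith
  linarith

/-- Adding translates of `T` along a walk that leaves `A` and comes back after `n` steps. -/
theorem exists_saturated_of_walk {T : Finset G} {s c δ : ℝ} (hc : 0 ≤ c) (hδ : 0 ≤ δ)
    (hs : ∀ A : Finset G, A.Nonempty → (edgeCount P.gen A : ℝ) + 1 ≤ s * #A)
    (hT : (edgeCount P.gen T : ℝ) + (1 + c) = s * #T + δ) {u : ℕ → G} {E : ℕ → G × X} {m : ℕ}
    (hE : ∀ i, ((E i).1 = u i ∧ (E i).1 * P.gen (E i).2 = u (i + 1)) ∨
        ((E i).1 = u (i + 1) ∧ (E i).1 * P.gen (E i).2 = u i))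
    (hEne : ∀ i j, i < j → j < i + m → E i ≠ E j) (n : ℕ) :
    ∀ (k : ℕ) (A : Finset G), IsSaturated T A → u k ∈ A → u (k + 1) ∉ A → u (k + n) ∈ A → 1 ≤ n →
      n ≤ m → ∃ A' : Finset G, A'.Nonempty ∧ IsSaturated T A' ∧
        (edgeCount P.gen A : ℝ) - s * #A + δ + 1 - (n - 1) * c ≤
          (edgeCount P.gen A' : ℝ) - s * #A' := by
  induction n using Nat.strong_induction_on with
  | _ n ih =>
  intro k A hA hk hk1 hkn hn hnm
  have hn1 : n ≠ 1 := by
    rintro rfl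
    exact hk1 hkn
  by_cases hex : ∃ n' < n, 1 ≤ n' ∧ u (k + n') ∈ A
  · obtain ⟨n', hn', hn'1, hmem⟩ := hex
    obtain ⟨A', hA'ne, hA', hle⟩ := ih n' hn' k A hA hk hk1 hmem hn'1 (by omega)
    refine ⟨A', hA'ne, hA', le_trans ?_ hle⟩
    have : (n' : ℝ) ≤ n := by exact_mod_cast hn'.le
    nlinarith
  · push Not at hex
    -- The translate contains the next vertex of the walk but not the present one, so the edge
    -- between them is gained in the union.
    obtain ⟨w, hw1, hw0⟩ := exists_smul_mem_notMem hA hk hk1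
    set B := w • T with hB
    have hBe : edgeCount P.gen B = edgeCount P.gen T := edgeCount_smul w T
    have hBc : #B = #T := card_smul_finset w T
    have hBsat : IsSaturated T B := isSaturated_smul T w
    have hcross : ∀ i, ((u i ∈ A ∧ u i ∉ B ∧ u (i + 1) ∈ B ∧ u (i + 1) ∉ A) ∨
        (u (i + 1) ∈ A ∧ u (i + 1) ∉ B ∧ u i ∈ B ∧ u i ∉ A)) →
        E i ∈ edgeSet P.gen (A ∪ B) ∧ E i ∉ edgeSet P.gen A ∧ E i ∉ edgeSet P.gen B := by
      intro i hi
      simp only [mem_edgeSet, mem_union]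
      rcases hE i with ⟨h1, h2⟩ | ⟨h1, h2⟩ <;> rw [h2, h1] <;> tauto
    have hn2 : (2 : ℝ) ≤ n := by
      have : 2 ≤ n := by omega
      exact_mod_cast this
    have hTr : (edgeCount P.gen B : ℝ) = s * #B + δ - (1 + c) := by
      rw [hBe, hBc]
      linarith
    have hfirst := hcross k (Or.inl ⟨hk, hw0, hw1, hk1⟩)
    rcases (A ∩ B).eq_empty_or_nonempty with hAB | hAB
    · have hcard : (#(A ∪ B) : ℝ) = #A + #B := by
        rw [card_union_of_disjoint (disjoint_iff_inter_eq_empty.2 hAB)]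
        push_cast
        rfl
      have hdis : ∀ g ∈ A, g ∉ B := fun g hg hg' => by
        have := mem_inter.2 ⟨hg, hg'⟩
        rw [hAB] at this
        exact notMem_empty _ this
      -- The last visit to the translate. If the walk leaves the union afterwards, the step has cost
      -- at most c and fewer than n steps remain; otherwise the returning edge is a second gain.
      obtain ⟨j, hj, hjmax⟩ := exists_max_image
        ((range n).filter fun j => 1 ≤ j ∧ u (k + j) ∈ B) id
        ⟨1, mem_filter.2 ⟨mem_range.2 (by omega), le_rfl, hw1⟩⟩
      rw [mem_filter, mem_range] at hj
      obtain ⟨hjn, hj1, hjB⟩ := hj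
      have hj1r : (1 : ℝ) ≤ j := by exact_mod_cast hj1
      rcases Nat.lt_or_ge (j + 1) n with hjn' | hjn'
      · have h1 : u (k + j + 1) ∉ A ∪ B := by
          rw [mem_union, not_or]
          refine ⟨hex (j + 1) hjn' (by omega), fun h => ?_⟩
          have := hjmax (j + 1) (mem_filter.2 ⟨mem_range.2 hjn', by omega, h⟩)
          simp only [id] at this
          omega
        obtain ⟨A', hA'ne, hA', hle⟩ := ih (n - j) (by omega) (k + j) (A ∪ B) (hA.union hBsat)
          (mem_union_right _ hjB) h1
          (mem_union_left _ (by rwa [show k + j + (n - j) = k + n by omega])) (by omega) (by omega)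
        refine ⟨A', hA'ne, hA', le_trans ?_ hle⟩
        have h2 := edgeCount_add_le_of_crossing (γ := P.gen) A B {E k} (by simpa using hfirst)
        rw [hAB, edgeCount_empty, card_singleton] at h2
        have h3 : (edgeCount P.gen A : ℝ) + edgeCount P.gen B + 1 ≤ edgeCount P.gen (A ∪ B) := by
          exact_mod_cast h2
        rw [hcard, Nat.cast_sub hjn.le]
        nlinarith
      · have hjn2 : n = j + 1 := by omega
        subst hjn2
        have hlast := hcross (k + j) (Or.inr ⟨hkn, hdis _ hkn, hjB, hex j (by omega) hj1⟩)
        have h2 := edgeCount_add_le_of_crossing (γ := P.gen) A B {E k, E (k + j)} (by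
          intro e he
          rw [mem_insert, mem_singleton] at he
          rcases he with rfl | rfl
          · exact hfirst
          · exact hlast)
        rw [hAB, edgeCount_empty, card_pair (hEne k (k + j) (by omega) (by omega))] at h2
        have h3 : (edgeCount P.gen A : ℝ) + edgeCount P.gen B + 2 ≤ edgeCount P.gen (A ∪ B) := by
          exact_mod_cast h2
        refine ⟨A ∪ B, ⟨_, mem_union_left _ hk⟩, hA.union hBsat, ?_⟩
        rw [hcard]
        push_cast
        nlinarith
    -- When the sets overlap, the bound on the intersection supplies the second gain.
    · have h2 := edgeCount_add_le_of_crossing (γ := P.gen) A B {E k} (by simpa using hfirst)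
      rw [card_singleton] at h2
      have h3 : (edgeCount P.gen A : ℝ) + edgeCount P.gen B + 1 ≤
          edgeCount P.gen (A ∪ B) + edgeCount P.gen (A ∩ B) := by exact_mod_cast h2
      have h4 := hs _ hAB
      have h5 : (#(A ∪ B) : ℝ) = #A + #B - #(A ∩ B) := by
        have := card_union_add_card_inter A B
        have : (#(A ∪ B) : ℝ) + #(A ∩ B) = #A + #B := by exact_mod_cast this
        linarith
      refine ⟨A ∪ B, ⟨_, mem_union_left _ hk⟩, hA.union hBsat, ?_⟩
      rw [h5]
      nlinarith

/-- A violation by δ is added repeatedly, around a shortest circuit leaving a saturated `S` that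
maximizes e(S) - s #S up to less than δ. The round trip of m steps gains at least δ + 1 - (m - 1)c ≥
δ, a contradiction. -/
theorem edgeCount_add_le_of_not_xiHasMax (hred : P.IsReduced) (hmax : ¬ P.XiHasMax) {c : ℝ}
    (hc : 0 ≤ c) (hcirc : ((P.maxCircuitLength : ℝ) - 1) * c ≤ 1) {T : Finset G}
    (hT : T.Nonempty) : (edgeCount P.gen T : ℝ) + (1 + c) ≤ (P.Xi + 1) * #T := by
  by_contra! hlt
  set s := P.Xi + 1 with hs_def
  set δ : ℝ := (edgeCount P.gen T : ℝ) + (1 + c) - s * #T with hδ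
  have hδ0 : 0 < δ := sub_pos.2 hlt
  have hs : ∀ A : Finset G, A.Nonempty → (edgeCount P.gen A : ℝ) + 1 ≤ s * #A := fun A hA =>
    edgeCount_add_one_le_Xi P hA
  let V : Set ℝ := {t | ∃ S : Finset G, S.Nonempty ∧ IsSaturated T S ∧
    t = (edgeCount P.gen S : ℝ) - s * #S}
  have hVne : V.Nonempty := ⟨_, T, hT, by simpa using isSaturated_smul T 1, rfl⟩
  have hVbdd : BddAbove V := ⟨-1, by
    rintro _ ⟨S, hS, -, rfl⟩
    linarith [hs S hS]⟩
  obtain ⟨_, ⟨S, hS, hSsat, rfl⟩, hSlt⟩ := exists_lt_of_lt_csSup hVne (sub_lt_self (sSup V) hδ0)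
  obtain ⟨g, hg, x, hx, hgx⟩ : ∃ g ∈ S, ∃ x, 0 < P.circuitLength x ∧ g * P.gen x ∉ S := by
    by_contra! hcl
    obtain ⟨v, hv⟩ := hS
    have hinf := infinite_Gp_circuits hmax
    refine hinf.not_finite (Set.Finite.subset (v⁻¹ • S).finite_toSet fun a ha => ?_)
    rw [mem_coe, ← inv_smul_mem_iff, inv_inv]
    exact mul_mem_of_closed (s := {x | 0 < P.circuitLength x}) (fun g hg x hx => hcl g hg x hx)
      hv ha
  obtain ⟨w, hw, ⟨b, hb⟩, hlen⟩ := exists_simpleCircuit_of_pos hx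
  obtain ⟨p, hp, hpw⟩ := List.mem_iff_getElem.1 hb
  obtain ⟨v, hv⟩ : ∃ v : G,
      (v * P.eval (w.take p) = g ∧ v * P.eval (w.take (p + 1)) = g * P.gen x) ∨
      (v * P.eval (w.take (p + 1)) = g ∧ v * P.eval (w.take p) = g * P.gen x) := by
    rw [eval_take_succ w p hp, hpw, letterVal]
    cases b
    · exact ⟨g * P.gen x * (P.eval (w.take p))⁻¹, Or.inr ⟨by simp [mul_assoc], by simp⟩⟩
    · exact ⟨g * (P.eval (w.take p))⁻¹, Or.inl ⟨by simp, by simp [mul_assoc]⟩⟩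
  obtain ⟨u, E, hu, hper, hm2, hE, hEne⟩ := exists_periodic_walk hred hw v
  set m := w.length with hm
  obtain ⟨i, j, hi, hj⟩ : ∃ i j, u i ∈ S ∧ u j ∉ S := by
    rw [← hu p hp.le, ← hu (p + 1) hp] at hv
    rcases hv with ⟨h1, h2⟩ | ⟨h1, h2⟩
    · exact ⟨p, p + 1, h1 ▸ hg, h2 ▸ hgx⟩
    · exact ⟨p + 1, p, h1 ▸ hg, h2 ▸ hgx⟩
  -- The periodic walk has vertices inside and outside `S`, so it leaves `S` at some time, whichever
  -- way the given edge is oriented.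
  obtain ⟨k, hk, hk1⟩ : ∃ k, u k ∈ S ∧ u (k + 1) ∉ S := by
    by_contra! h
    have h1 : ∀ n, u (i + n) ∈ S := fun n => by
      induction n with
      | zero => exact hi
      | succ n ih => exact h _ ih
    have h2 : ∀ n, u (j + n * m) = u j := fun n => by
      induction n with
      | zero => simp
      | succ n ih => rw [Nat.succ_mul, ← add_assoc, hper, ih]
    have h3 : i ≤ j + i * m := by nlinarith
    have h4 := h1 (j + i * m - i)
    rw [Nat.add_sub_cancel' h3, h2] at h4
    exact hj h4
  obtain ⟨A', hA'ne, hA', hle⟩ := exists_saturated_of_walk hc hδ0.le hs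
    (show (edgeCount P.gen T : ℝ) + (1 + c) = s * #T + δ by rw [hδ]; ring) hE hEne m k S hSsat hk
    hk1 (by rwa [hper]) (by omega) le_rfl
  have h1 : (edgeCount P.gen A' : ℝ) - s * #A' ≤ sSup V := le_csSup hVbdd ⟨A', hA'ne, hA', rfl⟩
  have h2 : ((m : ℝ) - 1) * c ≤ 1 := by
    refine le_trans (mul_le_mul_of_nonneg_right ?_ hc) hcirc
    have : m ≤ P.maxCircuitLength := by
      rw [hlen]
      exact le_sup (f := P.circuitLength) (mem_univ x)
    have : (m : ℝ) ≤ P.maxCircuitLength := by exact_mod_cast this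
    linarith
  linarith

end NoMaximum

/-! ### Assembling the statements on the free product -/

section Assembly

variable {ι : Type*} [Fintype ι] {G X : ι → Type*} [∀ i, Group (G i)]
  {P : ∀ i, GroupPresentation (X i) (G i)}

theorem sum_Xi_eq {i₁ i₂ : ι} (hne : i₁ ≠ i₂) :
    ∑ i, (P i).Xi = (P i₁).Xi + (P i₂).Xi + ∑ i ∈ (univ.erase i₁).erase i₂, (P i).Xi := by
  rw [add_assoc, add_sum_erase _ (fun i => (P i).Xi) (mem_erase.2 ⟨hne.symm, mem_univ _⟩),
    add_sum_erase _ (fun i => (P i).Xi) (mem_univ _)]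

variable [∀ i, Fintype (X i)]

theorem Psi_le_Xi_freeProd [∀ i, Nontrivial (G i)] (hred : ∀ i, (P i).IsReduced) {i j : ι}
    (hij : i ≠ j) (hPsi : (P j).Psi ≤ (P i).Psi) : (P j).Psi ≤ (freeProd P).Xi := by
  have h := edgeCount_add_Psi_le_Xi_freeProd hred hij hPsi (singleton_nonempty 1)
  rw [edgeCount_singleton (hred i), card_singleton] at h
  push_cast at h
  linarith

theorem Xi_le_Xi_freeProd [∀ i, Nontrivial (G i)] (hred : ∀ i, (P i).IsReduced) {i j : ι}
    (hij : i ≠ j) (hPsi : (P j).Psi ≤ (P i).Psi) : (P i).Xi ≤ (freeProd P).Xi := by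
  have h : (P i).Xi ≤ (freeProd P).Xi + 1 - 1 := Xi_le fun T hT => by
    have := edgeCount_add_Psi_le_Xi_freeProd hred hij hPsi hT
    linarith [Psi_nonneg (hred j)]
  linarith

/-- The normalizing constants cancel, so part (iii) concerns Ξ alone. -/
theorem hatXi_freeProd_sub :
    (freeProd P).hatXi - (1 - (Fintype.card ι : ℝ) + ∑ i, (P i).hatXi) =
      (freeProd P).Xi - ∑ i, (P i).Xi := by
  simp only [GroupPresentation.hatXi, Fintype.card_sigma, sum_add_distrib, sum_sub_distrib,
    sum_const, card_univ, nsmul_eq_mul]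
  push_cast
  ring

theorem Xi_freeProd_le_sum (hred : ∀ i, (P i).IsReduced) {i₁ i₂ : ι} (hne : i₁ ≠ i₂)
    (hPsi : (P i₂).Psi ≤ (P i₁).Psi) (hmax : ∀ i, i ≠ i₁ → (P i).Psi ≤ (P i₂).Psi) :
    (freeProd P).Xi ≤ ∑ i, (P i).Xi := by
  rw [sum_Xi_eq hne]
  have h1 := Xi_freeProd_le_add hred hPsi hmax
  have h2 : 0 ≤ ∑ i ∈ (univ.erase i₁).erase i₂, (P i).Xi :=
    sum_nonneg fun i _ => Xi_nonneg (hred i)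
  linarith

theorem Xi_freeProd_eq_sum_iff [∀ i, Nontrivial (G i)] (hred : ∀ i, (P i).IsReduced) {i₁ i₂ : ι}
    (hne : i₁ ≠ i₂) (hPsi : (P i₂).Psi ≤ (P i₁).Psi)
    (hmax : ∀ i, i ≠ i₁ → (P i).Psi ≤ (P i₂).Psi) :
    (freeProd P).Xi = ∑ i, (P i).Xi ↔ (P i₂).IsFree ∨ ((P i₁).IsOrderTwoFreeProdFree ∧
      (P i₂).IsOrderTwoFreeProdFree ∧ ∀ i, i ≠ i₁ → i ≠ i₂ → (P i).IsFree) := by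
  have hnn : ∀ i, 0 ≤ (P i).Xi := fun i => Xi_nonneg (hred i)
  have hXi0 : ∀ i, (P i).Psi = 0 → (P i).Xi = 0 := fun i h =>
    le_antisymm (h ▸ Xi_le_Psi (hred i)) (hnn i)
  have hadd := Xi_freeProd_le_add hred hPsi hmax
  have hge := Xi_le_Xi_freeProd hred hne hPsi
  have hrest : 0 ≤ ∑ i ∈ (univ.erase i₁).erase i₂, (P i).Xi := sum_nonneg fun i _ => hnn i
  rw [sum_Xi_eq hne]
  constructor
  · intro h
    rcases (Psi_nonneg (hred i₂)).eq_or_lt with h0 | hpos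
    · exact Or.inl (isFree_of_Psi_eq_zero (hred i₂) h0.symm)
    · have h1 : ∑ i ∈ (univ.erase i₁).erase i₂, (P i).Xi = 0 := by linarith
      obtain ⟨h2, h3⟩ := isOrderTwoFreeProdFree_of_Xi_freeProd_eq hred hPsi hmax hpos (by linarith)
      refine Or.inr ⟨h2, h3, fun i hi₁ hi₂ => isFree_of_Psi_eq_zero (hred i) ?_⟩
      have h4 := (sum_eq_zero_iff_of_nonneg fun i _ => hnn i).1 h1 i
        (mem_erase.2 ⟨hi₂, mem_erase.2 ⟨hi₁, mem_univ _⟩⟩)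
      have h5 := Psi_le_two_mul_Xi (hred i)
      exact le_antisymm (by linarith) (Psi_nonneg (hred i))
  · rintro (h | ⟨h1, h2, h3⟩)
    · have h0 := Psi_eq_zero_of_isFree (hred i₂) h
      have h4 : ∑ i ∈ (univ.erase i₁).erase i₂, (P i).Xi = 0 := sum_eq_zero fun i hi =>
        hXi0 i (le_antisymm ((hmax i (mem_erase.1 (mem_erase.1 hi).2).1).trans h0.le)
          (Psi_nonneg (hred i)))
      have h5 := hXi0 i₂ h0
      linarith
    · have h4 : ∑ i ∈ (univ.erase i₁).erase i₂, (P i).Xi = 0 := sum_eq_zero fun i hi =>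
        hXi0 i (Psi_eq_zero_of_isFree (hred i)
          (h3 i (mem_erase.1 (mem_erase.1 hi).2).1 (mem_erase.1 hi).1))
      have h5 := add_le_Xi_freeProd_of_orderTwo hred hne hPsi h1 h2
      linarith

theorem Xi_freeProd_eq_of_bound [∀ i, Nontrivial (G i)] (hred : ∀ i, (P i).IsReduced) {i₁ i₂ : ι}
    (hne : i₁ ≠ i₂) (hPsi : (P i₂).Psi ≤ (P i₁).Psi)
    (hmax : ∀ i, i ≠ i₁ → (P i).Psi ≤ (P i₂).Psi)
    (h : ∀ T : Finset (G i₁), T.Nonempty →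
      (edgeCount (P i₁).gen T : ℝ) + (1 + (P i₂).Psi) ≤ ((P i₁).Xi + 1) * #T) :
    (freeProd P).Xi = (P i₁).Xi := by
  refine le_antisymm ?_ (Xi_le_Xi_freeProd hred hne hPsi)
  have := Xi_freeProd_le hred hmax h
  linarith

theorem Xi_freeProd_of_finite_minimal [∀ i, Nontrivial (G i)] (hred : ∀ i, (P i).IsReduced)
    {i₁ i₂ : ι} (hne : i₁ ≠ i₂) (hPsi : (P i₂).Psi ≤ (P i₁).Psi)
    (hmax : ∀ i, i ≠ i₁ → (P i).Psi ≤ (P i₂).Psi) (hmin : (P i₁).IsMinimal) [Finite (G i₁)] :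
    (freeProd P).Xi = (Fintype.card (X i₁) : ℝ) - 1 + ((P i₂).Psi + 1) / (Nat.card (G i₁) : ℝ) := by
  have := Fintype.ofFinite (G i₁)
  have hN : (0 : ℝ) < Nat.card (G i₁) := by exact_mod_cast Nat.card_pos
  have hcard : #(univ : Finset (G i₁)) = Nat.card (G i₁) := by
    rw [card_univ, Nat.card_eq_fintype_card]
  have he : (edgeCount (P i₁).gen univ : ℝ) = Fintype.card (X i₁) * Nat.card (G i₁) := by
    rw [edgeCount_univ, Nat.card_eq_fintype_card]
    push_cast
    rfl
  have hΨ0 := Psi_nonneg (hred i₂)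
  have hX := Xi_of_finite (P := P i₁)
  set N : ℝ := (Nat.card (G i₁) : ℝ)
  set s : ℝ := (Fintype.card (X i₁) : ℝ) + ((P i₂).Psi + 1) / N with hs
  have hsN : s * N = Fintype.card (X i₁) * N + ((P i₂).Psi + 1) := by
    rw [hs]
    field_simp
  refine le_antisymm ?_ ?_
  · have h1 : (freeProd P).Xi ≤ s - 1 := Xi_freeProd_le hred hmax fun T hT => by
      refine edgeCount_add_le_of_minimal (hred i₁) hmin (H := ⊤) (S := univ) (by simp) ?_ ?_
        (by linarith) (by linarith) ?_ ?_ hT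
      · rw [hcard]
        exact Finite.one_lt_card
      · rw [he, hcard]
        exact (Psi_of_finite_minimal (hred i₁) hmin).symm
      · refine le_of_mul_le_mul_right ?_ hN
        rw [hX, hsN]
        linarith
      · rw [he, hcard]
        linarith
    linarith
  · have h1 := edgeCount_add_Psi_le_Xi_freeProd hred hne hPsi (univ_nonempty (α := G i₁))
    rw [he, hcard] at h1
    have h2 : s ≤ (freeProd P).Xi + 1 := by
      refine le_of_mul_le_mul_right ?_ hN
      linarith
    linarith

theorem isMinimal_of_card_eq_one {X G : Type*} [Group G] [Nontrivial G] [Fintype X]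
    (P : GroupPresentation X G) (h : Fintype.card X = 1) : P.IsMinimal := by
  intro Y hY
  have hsub : Subsingleton X := Fintype.card_le_one_iff_subsingleton.1 h.le
  rcases Y.eq_empty_or_nonempty with rfl | hne
  · rw [Set.image_empty, Subgroup.closure_empty] at hY
    exact absurd hY bot_ne_top
  · exact Subsingleton.eq_univ_of_nonempty hne

end Assembly

end CayleyGraph

/-! ### The corollary -/

theorem corollary5p5 {r : ℕ} {G X : Fin r → Type*} [∀ i, Group (G i)] [∀ i, Nontrivial (G i)]
    [∀ i, Fintype (X i)] (P : ∀ i, GroupPresentation (X i) (G i))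
    (hred : ∀ i, (P i).IsReduced)
    (hanti : Antitone fun i => (P i).Psi)
    -- the indices of the first two factors (so there are at least two)
    (i₁ i₂ : Fin r) (hi₁ : i₁.val = 0) (hi₂ : i₂.val = 1) :
    -- (i)
    ((P i₂).Psi ≤ (GroupPresentation.freeProd P).Xi ∧
      (GroupPresentation.freeProd P).Xi ≤ (P i₁).Psi) ∧
    -- (ii)
    (∀ i, (P i).Xi ≤ (GroupPresentation.freeProd P).Xi) ∧
    -- (ii)(a)
    ((P i₁).Xi = (P i₁).Psi → (GroupPresentation.freeProd P).Xi = (P i₁).Xi) ∧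
    -- (ii)(b)
    ((∀ Y : Set (X i₁), Y.Nonempty → Infinite ((P i₁).Gp Y)) →
      (GroupPresentation.freeProd P).Xi = (P i₁).Xi) ∧
    ((∀ g : G i₁, g ≠ 1 → ¬ IsOfFinOrder g) →
      (GroupPresentation.freeProd P).Xi = (P i₁).Xi) ∧
    -- (ii)(c)
    (¬ (P i₁).XiHasMax → (((P i₁).maxCircuitLength : ℝ) - 1) * (P i₂).Psi ≤ 1 →
      (GroupPresentation.freeProd P).Xi = (P i₁).Xi) ∧
    -- (ii)(d)
    ((P i₁).IsMinimal → ∀ Y : Set (X i₁), Finite ((P i₁).Gp Y) →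
      (P i₁).Psi = ((P i₁).sub Y).Psi → (P i₁).Xi < (P i₁).Psi →
      (Yᶜ).Nonempty → (P i₂).Psi ≤ ((P i₁).sub Yᶜ).Psi →
      (GroupPresentation.freeProd P).Xi = (P i₁).Xi) ∧
    -- (iii)
    (GroupPresentation.freeProd P).hatXi ≤ 1 - (r : ℝ) + ∑ i, (P i).hatXi ∧
    ((GroupPresentation.freeProd P).hatXi = 1 - (r : ℝ) + ∑ i, (P i).hatXi ↔
      (P i₂).IsFree ∨
        ((P i₁).IsOrderTwoFreeProdFree ∧ (P i₂).IsOrderTwoFreeProdFree ∧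
          ∀ i₃ : Fin r, i₃.val = 2 → (P i₃).IsFree)) ∧
    -- (iv)
    ((P i₁).IsMinimal → Infinite (G i₁) → IsAmenableGroup (G i₁) →
      (GroupPresentation.freeProd P).hatXi =
        (Fintype.card (X i₁) : ℝ) - (Fintype.card (Σ i, X i) : ℝ)) ∧
    -- (v)
    ((P i₁).IsMinimal → Finite (G i₁) →
      (GroupPresentation.freeProd P).Xi =
        (P i₁).Xi + (P i₂).Psi / (Nat.card (G i₁) : ℝ) ∧
      (GroupPresentation.freeProd P).Xi =
        (Fintype.card (X i₁) : ℝ) - 1 + ((P i₂).Psi + 1) / (Nat.card (G i₁) : ℝ)) ∧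
    ((P i₁).IsMinimal → (P i₂).IsMinimal → Finite (G i₁) → Finite (G i₂) →
      (GroupPresentation.freeProd P).Xi =
        (Fintype.card (X i₁) : ℝ) - 1 +
          ((Fintype.card (X i₂) : ℝ) * (Nat.card (G i₂) : ℝ)) /
            ((Nat.card (G i₁) : ℝ) * ((Nat.card (G i₂) : ℝ) - 1))) ∧
    -- (vi), with the convention 1/|G| = 0 for infinite G, which `Nat.card` respects
    ((∀ i, Fintype.card (X i) = 1) →
      (GroupPresentation.freeProd P).hatXi =
        1 - (r : ℝ) +
          1 / (Nat.card (G i₁) : ℝ) * (1 / (1 - 1 / (Nat.card (G i₂) : ℝ)))) ∧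
    -- (vii)
    (GroupPresentation.freeProd P).Psi = (P i₁).Psi := by
  classical
  have hne : i₁ ≠ i₂ := fun h => by rw [h, hi₂] at hi₁; exact one_ne_zero hi₁
  have hmax₁ : ∀ i, (P i).Psi ≤ (P i₁).Psi := fun i =>
    hanti (Fin.le_def.2 (by rw [hi₁]; exact Nat.zero_le _))
  have hmax : ∀ i, i ≠ i₁ → (P i).Psi ≤ (P i₂).Psi := fun i hi =>
    hanti (Fin.le_def.2 (by
      rw [hi₂]
      exact Nat.one_le_iff_ne_zero.2 fun h => hi (Fin.ext (h.trans hi₁.symm))))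
  have hΨ := hmax₁ i₂
  have hΨ0 := CayleyGraph.Psi_nonneg (hred i₂)
  have hPsi := CayleyGraph.Psi_freeProd hred i₁ hmax₁
  have hlow := CayleyGraph.Psi_le_Xi_freeProd hred hne hΨ
  have hup : (GroupPresentation.freeProd P).Xi ≤ (P i₁).Psi :=
    hPsi ▸ CayleyGraph.Xi_le_Psi (CayleyGraph.isReduced_freeProd hred)
  have hXi₁ := CayleyGraph.Xi_le_Xi_freeProd hred hne hΨ
  have hsum := CayleyGraph.hatXi_freeProd_sub (P := P)
  rw [Fintype.card_fin] at hsum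
  have hb : (∀ Y : Set (X i₁), Y.Nonempty → Infinite ((P i₁).Gp Y)) →
      (GroupPresentation.freeProd P).Xi = (P i₁).Xi := fun h =>
    le_antisymm (hup.trans (CayleyGraph.Psi_le_Xi_of_infinite_Gp (hred i₁) h)) hXi₁
  have hv : (P i₁).IsMinimal → Finite (G i₁) → (GroupPresentation.freeProd P).Xi =
      (Fintype.card (X i₁) : ℝ) - 1 + ((P i₂).Psi + 1) / (Nat.card (G i₁) : ℝ) :=
    fun hmin _ => CayleyGraph.Xi_freeProd_of_finite_minimal hred hne hΨ hmax hmin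
  refine ⟨⟨hlow, hup⟩, fun i => ?_, fun h => le_antisymm (hup.trans h.ge) hXi₁, hb, fun h => hb
    fun Y hY => CayleyGraph.infinite_Gp_of_torsionFree (hred i₁) h Y hY, fun hno hc =>
    CayleyGraph.Xi_freeProd_eq_of_bound hred hne hΨ hmax fun T hT =>
      CayleyGraph.edgeCount_add_le_of_not_xiHasMax (hred i₁) hno hΨ0 hc hT,
    fun hmin Y _ hY hlt _ hZ => CayleyGraph.Xi_freeProd_eq_of_bound hred hne hΨ hmax fun T hT =>
      CayleyGraph.edgeCount_add_le_of_finite_Gp (hred i₁) hmin hY hlt hΨ0 hZ hT,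
    ?_, ?_, ?_, ?_, ?_, ?_, hPsi⟩
  · by_cases hi : i = i₁
    · rw [hi]
      exact hXi₁
    · exact (CayleyGraph.Xi_le_Psi (hred i)).trans ((hmax i hi).trans hlow)
  · have := CayleyGraph.Xi_freeProd_le_sum hred hne hΨ hmax
    linarith
  · rw [← sub_eq_zero, hsum, sub_eq_zero, CayleyGraph.Xi_freeProd_eq_sum_iff hred hne hΨ hmax]
    refine or_congr_right (and_congr_right fun _ => and_congr_right fun _ =>
      ⟨fun h i₃ hi₃ => h i₃ ?_ ?_, fun h i hi hi' => ?_⟩)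
    · rintro rfl
      omega
    · rintro rfl
      omega
    · have h0 : i.val ≠ 0 := fun h => hi (Fin.ext (h.trans hi₁.symm))
      have h1 : i.val ≠ 1 := fun h => hi' (Fin.ext (h.trans hi₂.symm))
      have h2 : 2 ≤ i.val := by omega
      -- Freeness of the third factor means Ψ = 0, and the ordering passes this on to all later
      -- factors.
      let i₃ : Fin r := ⟨2, lt_of_le_of_lt h2 i.isLt⟩
      have h3 := CayleyGraph.Psi_eq_zero_of_isFree (hred i₃) (h i₃ rfl)
      exact CayleyGraph.isFree_of_Psi_eq_zero (hred i) (le_antisymm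
        ((hanti (show i₃ ≤ i from Fin.le_def.2 h2)).trans h3.le) (CayleyGraph.Psi_nonneg (hred i)))
  · intro hmin _ ham
    -- Here n₁ - 1 ≤ Ξ(G₁) ≤ Ξ(G) ≤ Ψ(G₁) ≤ n₁ - 1.
    have h1 := CayleyGraph.le_Xi_of_amenable (P i₁) ham
    have h2 := CayleyGraph.Psi_le_of_infinite_minimal (hred i₁) hmin
    rw [GroupPresentation.hatXi]
    linarith
  · intro hmin hfin
    have hX := CayleyGraph.Xi_of_finite (P := P i₁)
    have hN : (0 : ℝ) < Nat.card (G i₁) := by exact_mod_cast Nat.card_pos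
    refine ⟨?_, hv hmin hfin⟩
    rw [hv hmin hfin]
    have h1 : (P i₁).Xi = Fintype.card (X i₁) - 1 + 1 / Nat.card (G i₁) := by
      field_simp
      linarith
    rw [h1]
    ring
  · intro hmin hmin₂ hfin _
    have h2 := CayleyGraph.Psi_of_finite_minimal (hred i₂) hmin₂
    have hM : (1 : ℝ) < Nat.card (G i₂) := by exact_mod_cast Finite.one_lt_card
    have hM' : (Nat.card (G i₂) : ℝ) - 1 ≠ 0 := by linarith
    rw [hv hmin hfin, ← h2, mul_div_mul_right _ _ hM']
  · intro hone
    have hmin : ∀ i, (P i).IsMinimal := fun i =>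
      CayleyGraph.isMinimal_of_card_eq_one (P i) (hone i)
    have hinf : ∀ i, Infinite (G i) → (P i).Psi = 0 := fun i _ =>
      le_antisymm (by
        have := CayleyGraph.Psi_le_of_infinite_minimal (hred i) (hmin i)
        rw [hone] at this
        simpa using this) (CayleyGraph.Psi_nonneg (hred i))
    have hcard : (Fintype.card (Σ i, X i) : ℝ) = r := by
      simp [Fintype.card_sigma, hone]
    rw [GroupPresentation.hatXi, hcard]
    congr 1
    rcases finite_or_infinite (G i₁) with hfin | hinf₁
    · rw [hv (hmin i₁) hfin, hone]
      rcases finite_or_infinite (G i₂) with hfin₂ | hinf₂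
      · have h2 := CayleyGraph.Psi_of_finite_minimal (hred i₂) (hmin i₂)
        have hM : (1 : ℝ) < Nat.card (G i₂) := by exact_mod_cast Finite.one_lt_card
        have hM' : (Nat.card (G i₂) : ℝ) - 1 ≠ 0 := by linarith
        rw [hone] at h2
        have h3 : (P i₂).Psi + 1 = 1 / (1 - 1 / (Nat.card (G i₂) : ℝ)) := by
          rw [one_sub_div (by linarith), one_div_div, eq_div_iff hM', h2]
          simp
        rw [h3]
        push_cast
        ring
      -- The cardinality 0 and 1/0 = 0 turn the second factor of the fraction into 1, in agreement
      -- with Ψ(G₂) + 1.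
      · rw [hinf i₂ hinf₂, Nat.card_eq_zero_of_infinite (α := G i₂)]
        simp
    · have h0 := hinf i₁ hinf₁
      rw [Nat.card_eq_zero_of_infinite (α := G i₁)]
      simp only [Nat.cast_zero, div_zero, zero_mul]
      linarith
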